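/- **Theorem (Central Limit Theorem for Eigenvalues).** Let $k\ge 1$ be fixed, let $\alpha_1>\alpha_2>\dots>\alpha_k>0$ be constants, let $h_1,\dots,h_k:[0,1]\to\mathbb R$ be bounded Riemann-integrable functions that are orthonormal in $L^2[0,1]$, and let $f:[0,1]^2\to[0,\infty)$ be bounded and Riemann integrable. For each $N\ge 1$ let $W_N$ be the symmetric $N\times N$ random matrix $W_N(j,\ell)=X_{j\wedge \ell,\,j\vee \ell}$, where $\{X_{j,\ell}:1\le j\le \ell\le N\}$ (a family that may depend on $N$) are independent real random variables with $\mathbb E X_{j,\ell}=0$, the variance profile of $W_N$ is $$\mathbb E\big[W_N(j,\ell)^2\big]=f\Big(\frac jN,\frac \ell N\Big)\qquad\text{for all }1\le j,\ell\le N$$ (so $f$ is symmetric at the grid points), and there is a constant $B>0$, not depending on $N,j,\ell,m$, with $\mathbb E|X_{j,\ell}|^m\le m^{Bm}$ for all integers $m\ge 1$. Let $e_i=N^{-1/2}\big(h_i(1/N),h_i(2/N),\dots,h_i(1)\big)'\in\mathbb R^N$, let $\theta=\theta_N>0$ be deterministic, and put $$A=A_N=W_N+\theta_N\sum_{i=1}^k\alpha_i\,e_ie_i'.$$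 Assume that for some $\xi>\max\{4(B+1),8\}$ $$\sqrt N(\log N)^{\xi}=O(\theta_N),\qquad \theta_N=O(N)\qquad (N\to\infty).$$ Let $\lambda_1(A)\ge\lambda_2(A)\ge\cdots\ge\lambda_N(A)$ be the ordered eigenvalues of $A$. Then, for each $1\le i\le k$, $\lambda_i(A)$ is integrable, $\mathbb P(\lambda_i(A)=0)\to0$, and, as $N\to\infty$, $$\lambda_i(A)=\mathbb E[\lambda_i(A)]+\frac{\theta\alpha_i}{\lambda_i(A)}\,e_i'W_Ne_i+o_p(1),$$ where $o_p(1)$ denotes random variables $R_N$ with $\mathbb P(|R_N|>\delta)\to0$ for every $\delta>0$. Moreover, $$\big(\lambda_i(A)-\mathbb E[\lambda_i(A)]\big)_{1\le i\le k}\Rightarrow (G_i)_{1\le i\le k}$$ in distribution, where $(G_1,\dots,G_k)$ is a centered Gaussian vector in $\mathbb R^k$ with $$\mathrm{Cov}(G_i,G_j)=2\int_0^1\!\!\int_0^1 h_i(x)h_i(y)h_j(x)h_j(y)f(x,y)\,dx\,dy .$$ In particular, for each $1\le i\le k$, $\lambda_i(A)-\mathbb E[\lambda_i(A)]$ converges in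 distribution to $\mathcal N(0,\sigma_i^2)$ with $$\sigma_i^2=2\int_0^1\!\!\int_0^1 h_i(x)^2f(x,y)h_i(y)^2\,dx\,dy .$$ -/

import Mathlib

open MeasureTheory ProbabilityTheory Filter Topology

noncomputable section

namespace SpikedWigner

/-- The unit cube `[0,1]^d` as a box of Mathlib's box-integration theory. -/
def unitCube (d : ℕ) : BoxIntegral.Box (Fin d) :=
  ⟨fun _ => 0, fun _ => 1, fun _ => zero_lt_one⟩

/-- Riemann integrability of a real function on the closed cube `[0,1]^d`: the Riemann sums over
tagged partitions, with tags in the closed boxes, converge as the mesh tends to `0`. -/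
def RiemannIntegrableOnCube {d : ℕ} (g : (Fin d → ℝ) → ℝ) : Prop :=
  BoxIntegral.Integrable (unitCube d) BoxIntegral.IntegrationParams.Riemann g
    BoxIntegral.BoxAdditiveMap.volume

/-- `g` is a bounded Riemann-integrable function on `[0,1]`. -/
def BoundedRiemann₁ (g : ℝ → ℝ) : Prop :=
  (∃ C : ℝ, ∀ x ∈ Set.Icc (0 : ℝ) 1, |g x| ≤ C) ∧
    RiemannIntegrableOnCube (fun v : Fin 1 → ℝ => g (v 0))

/-- `g` is a bounded Riemann-integrable function on `[0,1]^2`. -/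
def BoundedRiemann₂ (g : ℝ → ℝ → ℝ) : Prop :=
  (∃ C : ℝ, ∀ x ∈ Set.Icc (0 : ℝ) 1, ∀ y ∈ Set.Icc (0 : ℝ) 1, |g x y| ≤ C) ∧
    RiemannIntegrableOnCube (fun v : Fin 2 → ℝ => g (v 0) (v 1))

/-- The grid point `j / N`, where the index `j : Fin N` stands for the one-based index `j + 1`. -/
def gridPoint {N : ℕ} (j : Fin N) : ℝ := ((j : ℕ) + 1 : ℝ) / (N : ℝ)

/-- The symmetric matrix with entries `W(j,l) = X (j ∧ l) (j ∨ l)`; it uses only the entries of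
`X` on and above the diagonal. -/
def wignerMatrix {N : ℕ} (X : Fin N → Fin N → ℝ) : Matrix (Fin N) (Fin N) ℝ :=
  Matrix.of fun j l => X (min j l) (max j l)

/-- The discretization `e(j) = h(j/N) / √N` of a function `h` on `[0,1]`. -/
def signalVector (N : ℕ) (h : ℝ → ℝ) : Fin N → ℝ :=
  fun j => h (gridPoint j) / √(N : ℝ)

/-- The perturbed matrix `A = W + θ ∑ᵢ αᵢ eᵢ eᵢ'`. -/
def perturbedMatrix {N k : ℕ} (θ : ℝ) (α : Fin k → ℝ) (h : Fin k → ℝ → ℝ)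
    (X : Fin N → Fin N → ℝ) : Matrix (Fin N) (Fin N) ℝ :=
  wignerMatrix X +
    θ • ∑ i, α i • Matrix.vecMulVec (signalVector N (h i)) (signalVector N (h i))

lemma perturbedMatrix_isHermitian {N k : ℕ} (θ : ℝ) (α : Fin k → ℝ) (h : Fin k → ℝ → ℝ)
    (X : Fin N → Fin N → ℝ) : (perturbedMatrix θ α h X).IsHermitian := by
  ext j l
  simp [perturbedMatrix, wignerMatrix, Matrix.vecMulVec_apply, Matrix.sum_apply, min_comm,
    max_comm, mul_comm]

/-- The `(i+1)`-th largest eigenvalue, counted with multiplicity, of a real symmetric `N × N`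
matrix; by convention `0` if `N ≤ i`. -/
def orderedEigenvalue {N : ℕ} {M : Matrix (Fin N) (Fin N) ℝ} (hM : M.IsHermitian) (i : ℕ) : ℝ :=
  if hi : i < N then hM.eigenvalues₀ ⟨i, by simpa using hi⟩ else 0

/-- The `(i+1)`-th largest eigenvalue of the perturbed matrix. -/
def outlier {N k : ℕ} (θ : ℝ) (α : Fin k → ℝ) (h : Fin k → ℝ → ℝ)
    (X : Fin N → Fin N → ℝ) (i : Fin k) : ℝ :=
  orderedEigenvalue (perturbedMatrix_isHermitian θ α h X) i

/-- The quadratic form `e' W e` in the discretization `e` of `h`. -/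
def signalForm {N : ℕ} (h : ℝ → ℝ) (X : Fin N → Fin N → ℝ) : ℝ :=
  signalVector N h ⬝ᵥ (wignerMatrix X).mulVec (signalVector N h)

/-- `Y_N = o_p(Z_N)`: `ℙ(|Y_N| > δ |Z_N|) → 0` for all `δ > 0`. The variables with different `N`
may live on different probability spaces. -/
def IsLittleOp {Ω : ℕ → Type*} [∀ N, MeasurableSpace (Ω N)] (P : ∀ N, Measure (Ω N))
    (Y Z : ∀ N, Ω N → ℝ) : Prop :=
  ∀ δ : ℝ, 0 < δ → Tendsto (fun N => P N {ω | δ * |Z N ω| < |Y N ω|}) atTop (𝓝 0)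

/-- The limiting covariance matrix `2 ∫₀¹ ∫₀¹ hᵢ(x) hᵢ(y) hⱼ(x) hⱼ(y) f(x,y) dx dy`. -/
def limitCov {k : ℕ} (h : Fin k → ℝ → ℝ) (f : ℝ → ℝ → ℝ) : Matrix (Fin k) (Fin k) ℝ :=
  Matrix.of fun i j =>
    2 * ∫ y in (0 : ℝ)..1, ∫ x in (0 : ℝ)..1, h i x * h i y * h j x * h j y * f x y

end SpikedWigner

end

/-!
The proof linearizes the sums `Sᵢ = λ₁ + ⋯ + λᵢ` of the top eigenvalues of `A = W + θ T`,
`T = ∑ αₘ eₘ eₘᵀ`, around the trace `tr (W Eᵢ)`, `Eᵢ = ∑_{m ≤ i} eₘ eₘᵀ`, and shows that the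
variance of the remainder `Sᵢ - tr (W Eᵢ)` tends to zero. Since `λᵢ = Sᵢ - Sᵢ₋₁` and
`tr (W Eᵢ) - tr (W Eᵢ₋₁) = eᵢᵀ W eᵢ` is centered, it follows that
`λᵢ - 𝔼 λᵢ - eᵢᵀ W eᵢ` tends to zero in `L²` (`tendsto_integral_sq_topEigenvalue_sub`).

The variance of the remainder is bounded by an Efron–Stein inequality that involves only the
positive parts of the increments (`variance_le_sum_integral_sq_posPart`). By the Ky Fan principle
`Sᵢ` is the maximum of `tr (A R)` over the projections `R` of rank `i` (`exists_topProj`). Hence, if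
`P` is the top spectral projection of `A` and one entry of `W` is replaced, then `Sᵢ` drops by at
most the change of `tr (W P)`, and the increment of the remainder is at most that of
`tr (W (P - Eᵢ))`. No resolvents or derivatives of eigenvalues are needed: summed over the entries,
the squared increments are governed by the Frobenius distance of `P` from `Eᵢ`
(`sum_sq_posPart_le`). This distance is small for two reasons.

* `P` is close to the top spectral projection `Q` of `T`, because the quadratic form of `W` is
  `O(√N (log N)^B)` with high probability, which is negligible against the spectral gap of `θ T`
  (`frobSq_topProj_sub_le`, `eventually_exists_good_set`). The high probability bound comes from a
  truncation at a power of `log N`, Hoeffding's inequality and a net of the sphere.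
* `Q` is close to `Eᵢ`, because the vectors `eₘ` are asymptotically orthonormal
  (`spikeSum_spectrum`).

The good event also gives `λᵢ / θ → αᵢ` in probability, hence `ℙ(λᵢ = 0) → 0` and the
expansion with the random factor `θ αᵢ / λᵢ` (`tendsto_measure_expansion`). Finally the
quadratic forms `eᵢᵀ W eᵢ` are linear in the independent entries with coefficients `O(1 / N)`; their
joint characteristic functions converge to Gaussian ones by a second-order expansion of each factor
(`norm_integral_exp_sum_sub_le`, `tendsto_integral_exp_quadForm`). The limiting variances are limits
of Riemann sums; these are treated through the mean oscillation on a grid (`SmallOscillation`),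
which the Cauchy criterion for the Riemann integral controls and which yields Lebesgue
integrability and convergence of the sums to the Lebesgue integral
(`SmallOscillation.tendsto_riemannSum`). Lévy's continuity theorem concludes.

All the analysis is done for product measures on the upper triangular entries (`IsWignerLaw`) and
then transferred to the given probability spaces.
-/

namespace SpikedWigner

/-! ### The Efron–Stein inequality -/

section EfronStein

variable {ι : Type*} [DecidableEq ι]

/-- Exchange the coordinates in `S` between the two components of a pair of families. -/
def swapOn (S : Finset ι) (z : (ι → ℝ) × (ι → ℝ)) : (ι → ℝ) × (ι → ℝ) :=
  (S.piecewise z.2 z.1, S.piecewise z.1 z.2)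

lemma swapOn_singleton_fst (i : ι) (z : (ι → ℝ) × (ι → ℝ)) :
    (swapOn {i} z).1 = Function.update z.1 i (z.2 i) := by
  simp [swapOn, Finset.piecewise_singleton]

lemma swapOn_singleton_swapOn_fst {S : Finset ι} {i : ι} (hi : i ∉ S)
    (z : (ι → ℝ) × (ι → ℝ)) : (swapOn S (swapOn {i} z)).1 = (swapOn (insert i S) z).1 := by
  ext j
  by_cases hj : j = i
  · subst hj; simp [swapOn, hi]
  · by_cases hS : j ∈ S <;> simp [swapOn, hj, hS, Finset.piecewise]

lemma swapOn_swapOn_singleton_fst {S : Finset ι} {i : ι} (hi : i ∉ S)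
    (z : (ι → ℝ) × (ι → ℝ)) : (swapOn {i} (swapOn S z)).1 = (swapOn (insert i S) z).1 := by
  ext j
  by_cases hj : j = i
  · subst hj; simp [swapOn, hi]
  · by_cases hS : j ∈ S <;> simp [swapOn, hj, hS, Finset.piecewise]

lemma swapOn_insert_swapOn_singleton_fst {S : Finset ι} {i : ι} (hi : i ∉ S)
    (z : (ι → ℝ) × (ι → ℝ)) : (swapOn (insert i S) (swapOn {i} z)).1 = (swapOn S z).1 := by
  ext j
  by_cases hj : j = i
  · subst hj; simp [swapOn, hi]
  · by_cases hS : j ∈ S <;> simp [swapOn, hj, hS, Finset.piecewise]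

lemma swapOn_singleton_swapOn_singleton (i : ι) (z : (ι → ℝ) × (ι → ℝ)) :
    swapOn {i} (swapOn {i} z) = z := by
  ext j <;> by_cases hj : j = i <;> simp [swapOn, hj, Finset.piecewise]

variable [Fintype ι] (μ : ι → Measure ℝ) [∀ i, IsProbabilityMeasure (μ i)]

lemma measurePreserving_swapOn (S : Finset ι) :
    MeasurePreserving (swapOn S) ((Measure.pi μ).prod (Measure.pi μ))
      ((Measure.pi μ).prod (Measure.pi μ)) := by
  have h1 := measurePreserving_arrowProdEquivProdArrow ℝ ℝ ι μ μ
  have h2 : MeasurePreserving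
      (fun (w : ι → ℝ × ℝ) i => (if i ∈ S then Prod.swap else id) (w i))
      (Measure.pi fun i => (μ i).prod (μ i)) (Measure.pi fun i => (μ i).prod (μ i)) := by
    refine measurePreserving_pi _ _ fun i => ?_
    split_ifs
    · exact Measure.measurePreserving_swap
    · exact MeasurePreserving.id _
  have h3 := h1.comp (h2.comp h1.symm)
  convert! h3 using 1
  ext z j <;> by_cases hj : j ∈ S <;>
    simp [swapOn, hj, MeasurableEquiv.arrowProdEquivProdArrow, Equiv.arrowProdEquivProdArrow]

variable {μ}

/-- The **Efron–Stein inequality**, with the positive parts of the differences only: the variance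
of a function of independent variables is at most the sum of the mean squares of the positive parts
of its changes when one variable is replaced by an independent copy. -/
theorem variance_le_sum_integral_sq_posPart {g : (ι → ℝ) → ℝ}
    (hg2 : MemLp g 2 (Measure.pi μ)) :
    Var[g; Measure.pi μ] ≤ ∑ i, ∫ z, (max (g z.1 - g (Function.update z.1 i (z.2 i))) 0) ^ 2
      ∂((Measure.pi μ).prod (Measure.pi μ)) := by
  set ν := (Measure.pi μ).prod (Measure.pi μ) with hν
  -- `G S` is `g` with the variables in `S` replaced by their copies; `G univ` is independent of
  -- `G ∅`, so that the variance is `E[G ∅ (G ∅ - G univ)]`, which telescopes along the subsets.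
  set G : Finset ι → ((ι → ℝ) × (ι → ℝ)) → ℝ := fun S z => g (swapOn S z).1 with hG
  have hfst : MemLp (fun z : (ι → ℝ) × (ι → ℝ) => g z.1) 2 ν :=
    hg2.comp_measurePreserving measurePreserving_fst
  have hsnd : MemLp (fun z : (ι → ℝ) × (ι → ℝ) => g z.2) 2 ν :=
    hg2.comp_measurePreserving measurePreserving_snd
  have hGL (S : Finset ι) : MemLp (G S) 2 ν :=
    hfst.comp_measurePreserving (measurePreserving_swapOn μ S)
  have hG0 : G ∅ = fun z => g z.1 := by ext z; simp [hG, swapOn]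
  have hcomp (S : Finset ι) (F : ((ι → ℝ) × (ι → ℝ)) → ℝ) (hF : AEStronglyMeasurable F ν) :
      ∫ z, F (swapOn S z) ∂ν = ∫ z, F z ∂ν := by
    have h := measurePreserving_swapOn μ S
    conv_rhs => rw [hν, ← h.map_eq]
    rw [integral_map h.measurable.aemeasurable]
    rwa [h.map_eq]
  -- Exchanging the two copies of the variable `i` preserves the measure, and it exchanges `G S`
  -- with `G (insert i S)` and `G ∅` with `G {i}`; the two resulting expressions for the left side
  -- are averaged, and Cauchy–Schwarz is applied in the form `2ab ≤ a² + b²`.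
  have key (i : ι) (S : Finset ι) (hi : i ∉ S) :
      ∫ z, G ∅ z * (G S z - G (insert i S) z) ∂ν ≤ (1 / 2) * ∫ z, (G ∅ z - G {i} z) ^ 2 ∂ν := by
    have e1 : ∫ z, G ∅ z * (G S z - G (insert i S) z) ∂ν =
        ∫ z, G {i} z * (G (insert i S) z - G S z) ∂ν := by
      rw [← hcomp {i} (fun z => G ∅ z * (G S z - G (insert i S) z))
        ((hGL ∅).1.mul ((hGL S).1.sub (hGL (insert i S)).1))]
      refine integral_congr_ae (ae_of_all _ fun z => ?_)
      simp only [hG, swapOn_singleton_swapOn_fst hi, swapOn_insert_swapOn_singleton_fst hi]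
      simp [swapOn]
    have i1 : Integrable (fun z => G ∅ z * (G S z - G (insert i S) z)) ν :=
      (hGL ∅).integrable_mul ((hGL S).sub (hGL _))
    have i2 : Integrable (fun z => G {i} z * (G (insert i S) z - G S z)) ν :=
      (hGL {i}).integrable_mul ((hGL _).sub (hGL S))
    have e2 : ∫ z, (G S z - G (insert i S) z) ^ 2 ∂ν = ∫ z, (G ∅ z - G {i} z) ^ 2 ∂ν := by
      rw [← hcomp S (fun z => (G ∅ z - G {i} z) ^ 2) (((hGL ∅).1.sub (hGL {i}).1).pow 2)]
      refine integral_congr_ae (ae_of_all _ fun z => ?_)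
      simp only [hG0]
      simp only [hG, swapOn_swapOn_singleton_fst hi]
    have i3 : Integrable (fun z => (G ∅ z - G {i} z) ^ 2) ν := ((hGL ∅).sub (hGL {i})).integrable_sq
    have i4 : Integrable (fun z => (G S z - G (insert i S) z) ^ 2) ν :=
      ((hGL S).sub (hGL _)).integrable_sq
    have e3 : ∫ z, G ∅ z * (G S z - G (insert i S) z) ∂ν
        + ∫ z, G {i} z * (G (insert i S) z - G S z) ∂ν ≤
        ∫ z, ((1 / 2) * (G ∅ z - G {i} z) ^ 2 + (1 / 2) * (G S z - G (insert i S) z) ^ 2) ∂ν := by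
      rw [← integral_add i1 i2]
      refine integral_mono (i1.add i2) ((i3.const_mul _).add (i4.const_mul _)) fun z => ?_
      dsimp only
      nlinarith [sq_nonneg ((G ∅ z - G {i} z) - (G S z - G (insert i S) z))]
    rw [integral_add (i3.const_mul _) (i4.const_mul _), integral_const_mul, integral_const_mul,
      e2] at e3
    linarith
  have tele (S : Finset ι) : ∫ z, G ∅ z * (G ∅ z - G S z) ∂ν ≤
      ∑ i ∈ S, (1 / 2) * ∫ z, (G ∅ z - G {i} z) ^ 2 ∂ν := by
    induction S using Finset.induction_on with
    | empty => simp
    | insert i S hi ih =>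
      rw [Finset.sum_insert hi]
      have : ∫ z, G ∅ z * (G ∅ z - G (insert i S) z) ∂ν =
          ∫ z, G ∅ z * (G S z - G (insert i S) z) ∂ν + ∫ z, G ∅ z * (G ∅ z - G S z) ∂ν := by
        have j1 : Integrable (fun z => G ∅ z * (G S z - G (insert i S) z)) ν :=
          (hGL ∅).integrable_mul ((hGL S).sub (hGL _))
        have j2 : Integrable (fun z => G ∅ z * (G ∅ z - G S z)) ν :=
          (hGL ∅).integrable_mul ((hGL ∅).sub (hGL S))
        rw [← integral_add j1 j2]
        refine integral_congr_ae (ae_of_all _ fun z => ?_)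
        dsimp only
        ring
      rw [this]
      exact add_le_add (key i S hi) ih
  -- The same exchange shows that the two signs of the increment contribute equally.
  have pos (i : ι) : (1 / 2) * ∫ z, (G ∅ z - G {i} z) ^ 2 ∂ν =
      ∫ z, (max (G ∅ z - G {i} z) 0) ^ 2 ∂ν := by
    have m1 : MemLp (fun z => max (G ∅ z - G {i} z) 0) 2 ν := ((hGL ∅).sub (hGL {i})).pos_part
    have m2 : MemLp (fun z => max (G {i} z - G ∅ z) 0) 2 ν := ((hGL {i}).sub (hGL ∅)).pos_part
    have e : ∫ z, (max (G {i} z - G ∅ z) 0) ^ 2 ∂ν = ∫ z, (max (G ∅ z - G {i} z) 0) ^ 2 ∂ν := by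
      rw [← hcomp {i} (fun z => (max (G ∅ z - G {i} z) 0) ^ 2) (m1.1.pow 2)]
      refine integral_congr_ae (ae_of_all _ fun z => ?_)
      simp only [hG0]
      simp only [hG, swapOn_singleton_swapOn_singleton]
    have s : ∫ z, (G ∅ z - G {i} z) ^ 2 ∂ν =
        ∫ z, ((max (G ∅ z - G {i} z) 0) ^ 2 + (max (G {i} z - G ∅ z) 0) ^ 2) ∂ν := by
      refine integral_congr_ae (ae_of_all _ fun z => ?_)
      dsimp only
      rcases le_total (G ∅ z) (G {i} z) with h | h
      · rw [max_eq_right (by linarith), max_eq_left (by linarith)]; ring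
      · rw [max_eq_left (by linarith), max_eq_right (by linarith)]; ring
    rw [s, integral_add m1.integrable_sq m2.integrable_sq, e]
    ring
  have hvar : Var[g; Measure.pi μ] = ∫ z, G ∅ z * (G ∅ z - G Finset.univ z) ∂ν := by
    have hU : G Finset.univ = fun z => g z.2 := by ext z; simp [hG, swapOn]
    rw [variance_eq_sub hg2, hG0, hU]
    have : ∀ z : (ι → ℝ) × (ι → ℝ), g z.1 * (g z.1 - g z.2) = (g z.1) ^ 2 - g z.1 * g z.2 := by
      intro z; ring
    simp only [this]
    have j : Integrable (fun z : (ι → ℝ) × (ι → ℝ) => g z.1 * g z.2) ν := hfst.integrable_mul hsnd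
    rw [integral_sub hfst.integrable_sq j, hν,
      integral_prod_mul (μ := Measure.pi μ) (ν := Measure.pi μ) g g,
      integral_fun_fst (fun x => g x ^ 2)]
    simp [sq]
  rw [hvar]
  refine (tele _).trans (le_of_eq (Finset.sum_congr rfl fun i _ => ?_))
  rw [pos, hG0]
  simp only [hG, swapOn_singleton_fst]

end EfronStein

/-! ### Sums of the largest eigenvalues -/

section KyFan

variable {N : ℕ}

/-- The squared Frobenius norm of a real matrix. -/
def frobSq (M : Matrix (Fin N) (Fin N) ℝ) : ℝ := ∑ j, ∑ l, M j l ^ 2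

lemma frobSq_nonneg (M : Matrix (Fin N) (Fin N) ℝ) : 0 ≤ frobSq M :=
  Finset.sum_nonneg fun _ _ => Finset.sum_nonneg fun _ _ => sq_nonneg _

lemma frobSq_neg (M : Matrix (Fin N) (Fin N) ℝ) : frobSq (-M) = frobSq M := by
  simp [frobSq]

lemma frobSq_smul (c : ℝ) (M : Matrix (Fin N) (Fin N) ℝ) : frobSq (c • M) = c ^ 2 * frobSq M := by
  simp [frobSq, mul_pow, Finset.mul_sum]

lemma frobSq_add_le (M M' : Matrix (Fin N) (Fin N) ℝ) :
    frobSq (M + M') ≤ 2 * frobSq M + 2 * frobSq M' := by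
  simp only [frobSq, Finset.mul_sum, ← Finset.sum_add_distrib, Matrix.add_apply]
  gcongr with j _ l _
  nlinarith [sq_nonneg (M j l - M' j l)]

lemma frobSq_eq_trace {M : Matrix (Fin N) (Fin N) ℝ} (hM : M.transpose = M) :
    frobSq M = (M * M).trace := by
  simp only [frobSq, Matrix.trace, Matrix.diag, Matrix.mul_apply]
  refine Finset.sum_congr rfl fun j _ => Finset.sum_congr rfl fun l _ => ?_
  rw [sq]
  congr 1
  exact congrFun (congrFun hM l) j ▸ rfl

lemma trace_mul_eq_sum (M R : Matrix (Fin N) (Fin N) ℝ) (hR : R.transpose = R) :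
    (M * R).trace = ∑ j, ∑ l, R j l * M j l := by
  simp only [Matrix.trace, Matrix.diag, Matrix.mul_apply]
  refine Finset.sum_congr rfl fun j _ => Finset.sum_congr rfl fun l _ => ?_
  rw [mul_comm]
  congr 1
  exact congrFun (congrFun hR j) l

lemma sq_trace_mul_le (M R : Matrix (Fin N) (Fin N) ℝ) (hR : R.transpose = R) :
    (M * R).trace ^ 2 ≤ frobSq M * frobSq R := by
  rw [trace_mul_eq_sum M R hR]
  simp only [frobSq, ← Fintype.sum_prod_type']
  rw [mul_comm (∑ x : Fin N × Fin N, M x.1 x.2 ^ 2)]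
  exact Finset.sum_mul_sq_le_sq_mul_sq _ _ _

/-- The matrix of an orthogonal projection of rank `i`. -/
structure IsRankProj (R : Matrix (Fin N) (Fin N) ℝ) (i : ℕ) : Prop where
  transpose_eq : R.transpose = R
  mul_self : R * R = R
  trace_eq : R.trace = i

lemma IsRankProj.frobSq_eq {R : Matrix (Fin N) (Fin N) ℝ} {i : ℕ} (h : IsRankProj R i) :
    frobSq R = i := by
  rw [frobSq_eq_trace h.transpose_eq, h.mul_self, h.trace_eq]

lemma IsRankProj.diag_eq {R : Matrix (Fin N) (Fin N) ℝ} {i : ℕ} (h : IsRankProj R i) (a : Fin N) :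
    R a a = ∑ b, R a b ^ 2 := by
  conv_lhs => rw [← h.mul_self]
  rw [Matrix.mul_apply]
  refine Finset.sum_congr rfl fun b _ => ?_
  rw [sq]
  congr 1
  exact congrFun (congrFun h.transpose_eq a) b

lemma IsRankProj.diag_nonneg {R : Matrix (Fin N) (Fin N) ℝ} {i : ℕ} (h : IsRankProj R i)
    (a : Fin N) : 0 ≤ R a a := by
  rw [h.diag_eq]; exact Finset.sum_nonneg fun _ _ => sq_nonneg _

lemma IsRankProj.sq_le_diag {R : Matrix (Fin N) (Fin N) ℝ} {i : ℕ} (h : IsRankProj R i)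
    (a b : Fin N) : R a b ^ 2 ≤ R a a := by
  rw [h.diag_eq]
  exact Finset.single_le_sum (f := fun b => R a b ^ 2) (fun _ _ => sq_nonneg _) (Finset.mem_univ b)

lemma IsRankProj.diag_le_one {R : Matrix (Fin N) (Fin N) ℝ} {i : ℕ} (h : IsRankProj R i)
    (a : Fin N) : R a a ≤ 1 := by
  nlinarith [h.sq_le_diag a a, h.diag_nonneg a]

lemma IsRankProj.abs_le_one {R : Matrix (Fin N) (Fin N) ℝ} {i : ℕ} (h : IsRankProj R i)
    (a b : Fin N) : |R a b| ≤ 1 := by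
  rw [← sq_le_one_iff_abs_le_one]
  exact (h.sq_le_diag a b).trans (h.diag_le_one a)

lemma IsRankProj.abs_trace_mul_le_sum {R : Matrix (Fin N) (Fin N) ℝ} {i : ℕ}
    (h : IsRankProj R i) (M : Matrix (Fin N) (Fin N) ℝ) :
    |(M * R).trace| ≤ ∑ j, ∑ l, |M j l| := by
  rw [trace_mul_eq_sum M R h.transpose_eq]
  refine (Finset.abs_sum_le_sum_abs _ _).trans (Finset.sum_le_sum fun j _ => ?_)
  refine (Finset.abs_sum_le_sum_abs _ _).trans (Finset.sum_le_sum fun l _ => ?_)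
  rw [abs_mul]
  nlinarith [h.abs_le_one j l, abs_nonneg (M j l)]

/-- A bound for the quadratic form of `W`, summed over the rows of the projection `R`, whose squared
lengths add up to `i`. -/
lemma IsRankProj.abs_trace_mul_le {R : Matrix (Fin N) (Fin N) ℝ} {i : ℕ}
    (h : IsRankProj R i) {W : Matrix (Fin N) (Fin N) ℝ} {L : ℝ}
    (hW : ∀ v : Fin N → ℝ, |v ⬝ᵥ W.mulVec v| ≤ L * (v ⬝ᵥ v)) :
    |(W * R).trace| ≤ i * L := by
  have e : (W * R).trace = ∑ b : Fin N, (R.row b) ⬝ᵥ W.mulVec (R.row b) := by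
    conv_lhs => rw [← h.mul_self, ← Matrix.mul_assoc, Matrix.trace_mul_comm, Matrix.trace]
    refine Finset.sum_congr rfl fun b _ => ?_
    rw [Matrix.diag_apply, Matrix.mul_apply]
    refine Finset.sum_congr rfl fun j _ => ?_
    rw [Matrix.mul_apply]
    congr 1
    refine Finset.sum_congr rfl fun l _ => ?_
    congr 1
    exact congrFun (congrFun h.transpose_eq b) l
  rw [e]
  calc |∑ b, (R.row b) ⬝ᵥ W.mulVec (R.row b)| ≤ ∑ b, |(R.row b) ⬝ᵥ W.mulVec (R.row b)| :=
        Finset.abs_sum_le_sum_abs _ _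
    _ ≤ ∑ b, L * (R.row b ⬝ᵥ R.row b) := Finset.sum_le_sum fun b _ => hW _
    _ = i * L := by
        rw [← Finset.mul_sum, mul_comm, ← h.frobSq_eq]
        congr 1
        simp [frobSq, dotProduct, sq]

/-- An orthonormal eigenbasis, listed by decreasing eigenvalue, as the columns of a matrix `U`. -/
lemma exists_orthogonal_diagonalization {M : Matrix (Fin N) (Fin N) ℝ} (hM : M.IsHermitian) :
    ∃ U : Matrix (Fin N) (Fin N) ℝ, U.transpose * U = 1 ∧ U * U.transpose = 1 ∧
      M = U * Matrix.diagonal (fun a : Fin N => orderedEigenvalue hM a) * U.transpose := by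
  set e : Fin N ≃ Fin N := (finCongr (Fintype.card_fin N).symm).trans
    (Fintype.equivOfCardEq (Fintype.card_fin _)) with he
  set U₀ : Matrix (Fin N) (Fin N) ℝ := (hM.eigenvectorUnitary : Matrix (Fin N) (Fin N) ℝ) with hU₀
  have h1 : U₀.transpose * U₀ = 1 := by
    have := Unitary.coe_star_mul_self hM.eigenvectorUnitary
    simpa [Matrix.star_eq_conjTranspose, Matrix.conjTranspose_eq_transpose_of_trivial] using this
  have h2 : U₀ * U₀.transpose = 1 := by
    have := Unitary.coe_mul_star_self hM.eigenvectorUnitary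
    simpa [Matrix.star_eq_conjTranspose, Matrix.conjTranspose_eq_transpose_of_trivial] using this
  have h3 : M = U₀ * Matrix.diagonal hM.eigenvalues * U₀.transpose := by
    have := hM.spectral_theorem
    rw [Unitary.conjStarAlgAut_apply] at this
    simpa [Matrix.star_eq_conjTranspose, Matrix.conjTranspose_eq_transpose_of_trivial,
      Function.comp_def] using! this
  have hl : (fun a : Fin N => orderedEigenvalue hM a) = hM.eigenvalues ∘ e := by
    ext a
    simp [orderedEigenvalue, Matrix.IsHermitian.eigenvalues, he]
    rfl
  refine ⟨U₀.submatrix id e, ?_, ?_, ?_⟩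
  · rw [Matrix.transpose_submatrix, ← Matrix.submatrix_mul _ _ _ id _ Function.bijective_id, h1]
    simp
  · rw [Matrix.transpose_submatrix, Matrix.submatrix_mul_equiv, h2]
    simp
  · have hd : Matrix.diagonal (hM.eigenvalues ∘ e) =
        (Matrix.diagonal hM.eigenvalues).submatrix e e :=
      (Matrix.submatrix_diagonal_equiv _ e).symm
    rw [hl, hd, Matrix.transpose_submatrix, Matrix.submatrix_mul_equiv, Matrix.submatrix_mul_equiv,
      ← h3]
    simp

lemma orderedEigenvalue_antitone {M : Matrix (Fin N) (Fin N) ℝ} (hM : M.IsHermitian)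
    {a b : ℕ} (hab : a ≤ b) (hb : b < N) : orderedEigenvalue hM b ≤ orderedEigenvalue hM a := by
  simp only [orderedEigenvalue, hb, hab.trans_lt hb, dif_pos]
  exact hM.eigenvalues₀_antitone (by simpa using hab)

/-- The sum of the `i` largest eigenvalues. -/
noncomputable def topSum {M : Matrix (Fin N) (Fin N) ℝ} (hM : M.IsHermitian) (i : ℕ) : ℝ :=
  ∑ a ∈ Finset.range i, orderedEigenvalue hM a

lemma orderedEigenvalue_eq_sub {M : Matrix (Fin N) (Fin N) ℝ} (hM : M.IsHermitian) (i : ℕ) :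
    orderedEigenvalue hM i = topSum hM (i + 1) - topSum hM i := by
  simp [topSum, Finset.sum_range_succ]

/-- The Ky Fan principle with a remainder: the projection `P` on the span of the top `i`
eigenvectors maximizes `R ↦ tr (M R)` among the projections of rank `i`, and a competitor `R` falls
short by at least half the spectral gap times the squared distance from `P`. -/
lemma exists_topProj {M : Matrix (Fin N) (Fin N) ℝ} (hM : M.IsHermitian) {i : ℕ} (hi : i ≤ N) :
    ∃ P, IsRankProj P i ∧ (M * P).trace = topSum hM i ∧ ∀ R, IsRankProj R i → ∀ c d : ℝ,
      (∀ a < i, c ≤ orderedEigenvalue hM a) → (∀ a, i ≤ a → a < N → orderedEigenvalue hM a ≤ d) →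
      (M * R).trace + (c - d) / 2 * frobSq (P - R) ≤ topSum hM i := by
  obtain ⟨U, hU1, hU2, hMU⟩ := exists_orthogonal_diagonalization hM
  set l : Fin N → ℝ := fun a => orderedEigenvalue hM a with hl
  set J : Fin N → ℝ := fun a => if (a : ℕ) < i then 1 else 0 with hJ
  set P := U * Matrix.diagonal J * U.transpose with hP
  have sumJ (F : ℕ → ℝ) : ∑ a : Fin N, J a * F a = ∑ a ∈ Finset.range i, F a := by
    have h0 : ∑ a : Fin N, J a * F a
        = ∑ a ∈ Finset.range N, (if a < i then 1 else 0) * F a :=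
      Fin.sum_univ_eq_sum_range (fun a => (if a < i then (1 : ℝ) else 0) * F a) N
    rw [h0]
    simp only [ite_mul, one_mul, zero_mul]
    rw [← Finset.sum_filter]
    congr 1
    ext a
    simp only [Finset.mem_filter, Finset.mem_range]
    omega
  have trD (D : Fin N → ℝ) (R : Matrix (Fin N) (Fin N) ℝ) :
      (U * Matrix.diagonal D * U.transpose * R).trace
        = ∑ a, D a * (U.transpose * R * U) a a := by
    rw [Matrix.mul_assoc, Matrix.mul_assoc, Matrix.trace_mul_comm, Matrix.mul_assoc, Matrix.trace]
    exact Finset.sum_congr rfl fun a _ => by rw [Matrix.diag_apply, Matrix.diagonal_mul]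
  have hPt : P.transpose = P := by
    simp [hP, Matrix.transpose_mul, Matrix.mul_assoc]
  have hUPU : U.transpose * P * U = Matrix.diagonal J := by
    rw [hP]
    calc U.transpose * (U * Matrix.diagonal J * U.transpose) * U
        = (U.transpose * U) * Matrix.diagonal J * (U.transpose * U) := by
          simp only [Matrix.mul_assoc]
      _ = _ := by simp [hU1]
  have hPP : P * P = P := by
    have hJJ : Matrix.diagonal J * Matrix.diagonal J = Matrix.diagonal J := by
      rw [Matrix.diagonal_mul_diagonal]
      congr 1
      ext a
      simp only [hJ]
      split_ifs <;> simp
    calc P * P = U * Matrix.diagonal J * (U.transpose * U) * Matrix.diagonal J * U.transpose := by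
          simp only [hP, Matrix.mul_assoc]
      _ = U * (Matrix.diagonal J * Matrix.diagonal J) * U.transpose := by
          simp only [hU1, Matrix.mul_one, Matrix.mul_assoc]
      _ = P := by rw [hJJ]
  have hPtr : P.trace = i := by
    rw [hP, Matrix.trace_mul_comm, ← Matrix.mul_assoc, hU1, Matrix.one_mul, Matrix.trace_diagonal]
    simpa using sumJ (fun _ => 1)
  have hMP : (M * P).trace = topSum hM i := by
    conv_lhs => rw [hMU]
    rw [trD, hUPU]
    simp only [Matrix.diagonal_apply_eq]
    rw [topSum, ← sumJ]
    exact Finset.sum_congr rfl fun a _ => mul_comm _ _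
  have hPproj : IsRankProj P i := ⟨hPt, hPP, hPtr⟩
  refine ⟨P, hPproj, hMP, fun R hR c d hc hd => ?_⟩
  set V := U.transpose * R * U with hV
  have hVproj : IsRankProj V i := by
    refine ⟨by simp [hV, Matrix.transpose_mul, hR.transpose_eq, Matrix.mul_assoc], ?_, ?_⟩
    · calc V * V = U.transpose * R * (U * U.transpose) * R * U := by
            simp only [hV, Matrix.mul_assoc]
        _ = U.transpose * (R * R) * U := by simp only [hU2, Matrix.mul_one, Matrix.mul_assoc]
        _ = V := by rw [hR.mul_self]
    · rw [hV, Matrix.mul_assoc, Matrix.trace_mul_comm, Matrix.mul_assoc, hU2, Matrix.mul_one,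
        hR.trace_eq]
  have hMR : (M * R).trace = ∑ a, l a * V a a := by
    conv_lhs => rw [hMU]
    rw [trD]
  have hPR : (P * R).trace = ∑ a, J a * V a a := trD J R
  have hfrob : frobSq (P - R) = 2 * i - 2 * ∑ a, J a * V a a := by
    rw [frobSq_eq_trace (by rw [Matrix.transpose_sub, hPt, hR.transpose_eq]), ← hPR, mul_sub,
      sub_mul, sub_mul, Matrix.trace_sub, Matrix.trace_sub, Matrix.trace_sub, hPP, hR.mul_self,
      hPtr, hR.trace_eq, Matrix.trace_mul_comm R P]
    ring
  have hsumV : ∑ a, V a a = i := hVproj.trace_eq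
  have hsumJ : ∑ a, J a = i := by simpa using sumJ (fun _ => 1)
  -- The diagonal entries of `V` lie in `[0, 1]`: those below `i` lose at least `c` each by falling
  -- short of `1`, and those from `i` on gain at most `d` each. As they add up to `i`, loss and gain
  -- concern the same total weight, which is half of `‖P - R‖²`.
  have hterm : ∀ a : Fin N, l a * V a a ≤ J a * l a - c * (J a - J a * V a a)
      + d * (V a a - J a * V a a) := by
    intro a
    have h0 := hVproj.diag_nonneg a
    have h1 := hVproj.diag_le_one a
    by_cases ha : (a : ℕ) < i
    · have : c ≤ l a := hc a ha
      simp only [hJ, ha, if_true]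
      nlinarith
    · have : l a ≤ d := hd a (not_lt.1 ha) a.2
      simp only [hJ, ha, if_false]
      nlinarith
  have hsum := Finset.sum_le_sum fun a (_ : a ∈ Finset.univ) => hterm a
  rw [Finset.sum_add_distrib, Finset.sum_sub_distrib, ← Finset.mul_sum, ← Finset.mul_sum,
    Finset.sum_sub_distrib, Finset.sum_sub_distrib, hsumV, hsumJ, ← hMR] at hsum
  have htop : ∑ a : Fin N, J a * l a = topSum hM i := sumJ (fun a => orderedEigenvalue hM a)
  rw [hfrob]
  rw [htop] at hsum
  linarith

/-- The **Ky Fan inequality**: the remainder of `exists_topProj` is discarded by taking `c = d`. -/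
lemma IsRankProj.trace_mul_le_topSum {R : Matrix (Fin N) (Fin N) ℝ} {i : ℕ}
    (hR : IsRankProj R i) (hi : i ≤ N) {M : Matrix (Fin N) (Fin N) ℝ} (hM : M.IsHermitian) :
    (M * R).trace ≤ topSum hM i := by
  obtain ⟨P, -, -, hP⟩ := exists_topProj hM hi
  obtain ⟨c, hc1, hc2⟩ : ∃ c : ℝ, (∀ a < i, c ≤ orderedEigenvalue hM a) ∧
      (∀ a, i ≤ a → a < N → orderedEigenvalue hM a ≤ c) := by
    rcases hi.lt_or_eq with h | rfl
    · exact ⟨orderedEigenvalue hM i, fun a ha => orderedEigenvalue_antitone hM ha.le h,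
        fun a ha haN => orderedEigenvalue_antitone hM ha haN⟩
    · exact ⟨orderedEigenvalue hM (i - 1), fun a ha =>
        orderedEigenvalue_antitone hM (by omega) (by omega), fun a h1 h2 => by omega⟩
  simpa using hP R hR c c hc1 hc2

/-- The sum of the `i` top eigenvalues moves by at most `L` under a perturbation whose traces
against the projections of rank `i` are at most `L` in absolute value. -/
lemma abs_topSum_sub_le {M M' W : Matrix (Fin N) (Fin N) ℝ} (hM : M.IsHermitian)
    (hM' : M'.IsHermitian) (h : M = W + M') {i : ℕ} (hi : i ≤ N) {L : ℝ}
    (hW : ∀ R, IsRankProj R i → |(W * R).trace| ≤ L) :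
    |topSum hM i - topSum hM' i| ≤ L := by
  obtain ⟨P, hP, hPM, -⟩ := exists_topProj hM hi
  obtain ⟨P', hP', hPM', -⟩ := exists_topProj hM' hi
  have h1 := hP.trace_mul_le_topSum hi hM'
  have h2 := hP'.trace_mul_le_topSum hi hM
  have e (R : Matrix (Fin N) (Fin N) ℝ) : (M * R).trace = (W * R).trace + (M' * R).trace := by
    rw [h, add_mul, Matrix.trace_add]
  rw [e] at hPM h2
  have h3 := abs_le.1 (hW P hP)
  have h4 := abs_le.1 (hW P' hP')
  rw [abs_le]
  constructor <;> linarith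

lemma abs_topSum_sub_le_sum {M M' : Matrix (Fin N) (Fin N) ℝ} (hM : M.IsHermitian)
    (hM' : M'.IsHermitian) {i : ℕ} (hi : i ≤ N) :
    |topSum hM i - topSum hM' i| ≤ ∑ j, ∑ l, |M j l - M' j l| :=
  abs_topSum_sub_le hM hM' (W := M - M') (by simp) hi fun _ hR => hR.abs_trace_mul_le_sum _

lemma topSum_smul {θ : ℝ} (hθ : 0 < θ) {T : Matrix (Fin N) (Fin N) ℝ} (hT : T.IsHermitian)
    (hθT : (θ • T).IsHermitian) {i : ℕ} (hi : i ≤ N) : topSum hθT i = θ * topSum hT i := by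
  obtain ⟨P, hP, hPM, -⟩ := exists_topProj hT hi
  obtain ⟨P', hP', hPM', -⟩ := exists_topProj hθT hi
  have h1 := hP'.trace_mul_le_topSum hi hT
  have h2 := hP.trace_mul_le_topSum hi hθT
  rw [Matrix.smul_mul, Matrix.trace_smul, smul_eq_mul] at h2 hPM'
  rw [hPM] at h2
  refine le_antisymm ?_ h2
  rw [← hPM']
  exact mul_le_mul_of_nonneg_left h1 hθ.le

/-- The top spectral projections of `W + θ T` and of `T` are close if `W` is small compared with
the spectral gap of `θ T`. -/
lemma frobSq_topProj_sub_le {W T P Q : Matrix (Fin N) (Fin N) ℝ} {θ L c d : ℝ} {i : ℕ}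
    (hA : (W + θ • T).IsHermitian) (hi : i ≤ N) (hθ : 0 < θ)
    (hW : ∀ R, IsRankProj R i → |(W * R).trace| ≤ L)
    (hP : IsRankProj P i) (hPA : ((W + θ • T) * P).trace = topSum hA i)
    (hQ : IsRankProj Q i)
    (hQT : (T * P).trace + (c - d) / 2 * frobSq (Q - P) ≤ (T * Q).trace) :
    (c - d) * frobSq (Q - P) * θ ≤ 4 * L := by
  have h1 := hQ.trace_mul_le_topSum hi hA
  rw [← hPA, add_mul, add_mul, Matrix.trace_add, Matrix.trace_add, Matrix.smul_mul,
    Matrix.smul_mul, Matrix.trace_smul, Matrix.trace_smul, smul_eq_mul, smul_eq_mul] at h1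
  have h3 := abs_le.1 (hW P hP)
  have h4 := abs_le.1 (hW Q hQ)
  nlinarith [mul_le_mul_of_nonneg_left hQT hθ.le]

end KyFan

/-! ### Symmetric matrices in terms of their upper triangles -/

section Upper

variable {N : ℕ}

/-- The positions on and above the diagonal. -/
abbrev UpperIdx (N : ℕ) : Type := {p : Fin N × Fin N // p.1 ≤ p.2}

/-- The symmetric matrix with upper triangle `x`. -/
def symOf (x : UpperIdx N → ℝ) : Matrix (Fin N) (Fin N) ℝ :=
  Matrix.of fun j l => x ⟨(min j l, max j l), min_le_max⟩

lemma symOf_comm (x : UpperIdx N → ℝ) (j l : Fin N) : symOf x j l = symOf x l j := by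
  simp only [symOf, Matrix.of_apply, min_comm, max_comm]

lemma symOf_apply (x : UpperIdx N → ℝ) (p : UpperIdx N) : symOf x p.1.1 p.1.2 = x p := by
  obtain ⟨⟨j, l⟩, h⟩ := p
  simp only [symOf, Matrix.of_apply]
  congr 1
  have h' : j ≤ l := h
  simp [min_eq_left h', max_eq_right h']

lemma symOf_sub (x y : UpperIdx N → ℝ) : symOf (x - y) = symOf x - symOf y := rfl

/-- The coefficient of the upper-triangular entry at `p` in the linear form `W ↦ ∑ a(j,l) W(j,l)`
on symmetric matrices. -/
def upperCoef (a : Matrix (Fin N) (Fin N) ℝ) (p : UpperIdx N) : ℝ :=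
  if p.1.1 = p.1.2 then a p.1.1 p.1.2 else a p.1.1 p.1.2 + a p.1.2 p.1.1

lemma sum_eq_sum_upperCoef (a : Matrix (Fin N) (Fin N) ℝ) :
    ∑ j, ∑ l, a j l = ∑ p, upperCoef a p := by
  have h1 : ∑ p, upperCoef a p = ∑ j, ∑ l, if j ≤ l then
      (if j = l then a j l else a j l + a l j) else 0 := by
    rw [← Fintype.sum_prod_type' (f := fun j l : Fin N => if j ≤ l then
      (if j = l then a j l else a j l + a l j) else 0), ← Finset.sum_filter]
    exact (Finset.sum_subtype _ (by simp) (fun q : Fin N × Fin N =>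
      if q.1 = q.2 then a q.1 q.2 else a q.1 q.2 + a q.2 q.1)).symm
  have h2 : ∀ j l : Fin N, (if j ≤ l then (if j = l then a j l else a j l + a l j) else 0) =
      (if j ≤ l then a j l else 0) + (if j < l then a l j else 0) := by
    intro j l
    rcases lt_trichotomy j l with h | h | h
    · simp [h.le, h, h.ne]
    · simp [h]
    · simp [not_le.2 h, not_lt.2 h.le]
  rw [h1]
  simp only [h2, Finset.sum_add_distrib]
  rw [Finset.sum_comm (f := fun j l : Fin N => if j < l then a l j else 0),
    ← Finset.sum_add_distrib]
  refine Finset.sum_congr rfl fun j _ => ?_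
  rw [← Finset.sum_add_distrib]
  refine Finset.sum_congr rfl fun l _ => ?_
  by_cases h : j ≤ l
  · simp [h, not_lt.2 h]
  · simp [h, not_le.1 h]

lemma sum_mul_symOf (a : Matrix (Fin N) (Fin N) ℝ) (x : UpperIdx N → ℝ) :
    ∑ j, ∑ l, a j l * symOf x j l = ∑ p, upperCoef a p * x p := by
  refine (sum_eq_sum_upperCoef (Matrix.of fun j l => a j l * symOf x j l)).trans ?_
  refine Finset.sum_congr rfl fun p _ => ?_
  unfold upperCoef
  have := symOf_apply x p
  simp only [Matrix.of_apply]
  split_ifs with h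
  · rw [this]
  · rw [symOf_comm x p.1.2, this]; ring

lemma sum_upperCoef_sq_le (a : Matrix (Fin N) (Fin N) ℝ) :
    ∑ p, upperCoef a p ^ 2 ≤ 2 * frobSq a := by
  have h := sum_eq_sum_upperCoef (Matrix.of fun j l => a j l ^ 2)
  simp only [Matrix.of_apply] at h
  rw [frobSq, h, Finset.mul_sum]
  refine Finset.sum_le_sum fun p _ => ?_
  unfold upperCoef
  simp only [Matrix.of_apply]
  split_ifs with h
  · nlinarith [sq_nonneg (a p.1.1 p.1.2)]
  · nlinarith [sq_nonneg (a p.1.1 p.1.2 - a p.1.2 p.1.1)]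

lemma abs_upperCoef_le {a : Matrix (Fin N) (Fin N) ℝ} {C : ℝ} (ha : ∀ j l, |a j l| ≤ C)
    (p : UpperIdx N) : |upperCoef a p| ≤ 2 * C := by
  have h1 := ha p.1.1 p.1.2
  have h2 := ha p.1.2 p.1.1
  unfold upperCoef
  split_ifs
  · linarith [abs_nonneg (a p.1.1 p.1.2)]
  · exact (abs_add_le _ _).trans (by linarith)

lemma upperCoef_add (a b : Matrix (Fin N) (Fin N) ℝ) (p : UpperIdx N) :
    upperCoef (a + b) p = upperCoef a p + upperCoef b p := by
  unfold upperCoef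
  split_ifs <;> simp; ring

lemma card_upperIdx_le (N : ℕ) : (Fintype.card (UpperIdx N) : ℝ) ≤ (N : ℝ) ^ 2 := by
  have := Fintype.card_subtype_le (fun p : Fin N × Fin N => p.1 ≤ p.2)
  rw [Fintype.card_prod, Fintype.card_fin] at this
  rw [sq]
  exact_mod_cast this

/-- Replacing one entry changes a linear form by the change of the entry times its coefficient. -/
lemma trace_symOf_sub_update (a : Matrix (Fin N) (Fin N) ℝ) (ha : a.transpose = a)
    (x : UpperIdx N → ℝ) (p : UpperIdx N) (t : ℝ) :
    ((symOf x - symOf (Function.update x p t)) * a).trace = upperCoef a p * (x p - t) := by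
  rw [trace_mul_eq_sum _ _ ha, ← symOf_sub, sum_mul_symOf, Finset.sum_eq_single p]
  · simp
  · intro q _ hq
    simp [hq]
  · simp

end Upper

/-! ### The quadratic form of a random symmetric matrix -/

section Net

/-- A finite net of the sphere of radius `2`, of at most exponential size. -/
lemma exists_net (E : Type*) [NormedAddCommGroup E] [NormedSpace ℝ E] [FiniteDimensional ℝ E] :
    ∃ s : Finset E, s.card ≤ 5 ^ Module.finrank ℝ E ∧ (∀ c ∈ s, ‖c‖ = 2) ∧
      ∀ x : E, ‖x‖ = 2 → ∃ c ∈ s, ‖x - c‖ ≤ 1 := by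
  classical
  let Q : Finset E → Prop := fun s => (∀ c ∈ s, ‖c‖ = 2) ∧ ∀ c ∈ s, ∀ d ∈ s, c ≠ d → 1 ≤ ‖c - d‖
  have hQ : ∀ s, Q s → s.card ≤ 5 ^ Module.finrank ℝ E := fun s hs =>
    Besicovitch.card_le_of_separated s (fun c hc => (hs.1 c hc).le) hs.2
  let P : ℕ → Prop := fun n => ∃ s, Q s ∧ s.card = n
  have hP0 : P 0 := ⟨∅, by simp [Q]⟩
  -- a `1`-separated set of maximal cardinality is a net
  obtain ⟨s, hs, hcard⟩ : P (Nat.findGreatest P (5 ^ Module.finrank ℝ E)) :=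
    Nat.findGreatest_spec (Nat.zero_le _) hP0
  refine ⟨s, hQ s hs, hs.1, fun x hx => ?_⟩
  by_contra! hcon
  have hxs : x ∉ s := fun h => by
    have := hcon x h
    simp at this
    linarith
  have hQx : Q (insert x s) := by
    refine ⟨fun c hc => ?_, fun c hc d hd hcd => ?_⟩
    · rcases Finset.mem_insert.1 hc with rfl | hc
      · exact hx
      · exact hs.1 c hc
    · rcases Finset.mem_insert.1 hc with rfl | hc' <;> rcases Finset.mem_insert.1 hd with rfl | hd'
      · exact absurd rfl hcd
      · exact (hcon d hd').le
      · rw [norm_sub_rev]; exact (hcon c hc').le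
      · exact hs.2 c hc' d hd' hcd
  have := Nat.le_findGreatest (P := P) (hQ _ hQx) ⟨_, hQx, rfl⟩
  rw [Finset.card_insert_of_notMem hxs, hcard] at this
  omega

/-- A bound for the bilinear form of an operator on a `1`-net of the sphere of radius `2` bounds its
quadratic form: the distance to the net is half of the radius, so each of the two variables of the
bilinear form can be replaced by a point of the net at the cost of a constant factor. -/
lemma inner_le_of_net {E : Type*} [NormedAddCommGroup E] [InnerProductSpace ℝ E] (A : E →L[ℝ] E)
    {s : Finset E} (hs : ∀ x : E, ‖x‖ = 2 → ∃ c ∈ s, ‖x - c‖ ≤ 1) {C : ℝ} (hC : 0 ≤ C)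
    (h : ∀ y ∈ s, ∀ z ∈ s, inner ℝ z (A y) ≤ C) (v : E) :
    |inner ℝ v (A v)| ≤ C * ‖v‖ ^ 2 := by
  have h1 : ∀ y ∈ s, ‖A y‖ ≤ C := by
    intro y hy
    rcases eq_or_ne (A y) 0 with h0 | h0
    · simpa [h0] using hC
    have hpos : 0 < ‖A y‖ := norm_pos_iff.2 h0
    obtain ⟨z, hz, hz1⟩ := hs ((2 / ‖A y‖) • A y) (by
      rw [norm_smul, Real.norm_of_nonneg (by positivity)]; field_simp)
    have e : inner ℝ ((2 / ‖A y‖) • A y) (A y) = 2 * ‖A y‖ := by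
      rw [real_inner_smul_left, real_inner_self_eq_norm_sq]; field_simp
    have e2 : inner ℝ ((2 / ‖A y‖) • A y - z) (A y) ≤ 1 * ‖A y‖ :=
      (real_inner_le_norm _ _).trans (by gcongr)
    rw [inner_sub_left, e] at e2
    linarith [h y hy z hz]
  -- a vector of length `2` is within distance `1` of the net, which gives `2 ‖A‖ ≤ C + ‖A‖`
  have h2 : ‖A‖ ≤ (C + ‖A‖) / 2 := by
    refine A.opNorm_le_bound (by positivity) fun x => ?_
    rcases eq_or_ne x 0 with h0 | h0
    · simp [h0]
    have hpos : 0 < ‖x‖ := norm_pos_iff.2 h0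
    obtain ⟨y, hy, hy1⟩ := hs ((2 / ‖x‖) • x) (by
      rw [norm_smul, Real.norm_of_nonneg (by positivity)]; field_simp)
    have e : ‖A ((2 / ‖x‖) • x)‖ ≤ C + ‖A‖ := by
      have : A ((2 / ‖x‖) • x) = A y + A ((2 / ‖x‖) • x - y) := by rw [← map_add]; congr 1; abel
      rw [this]
      refine (norm_add_le _ _).trans (add_le_add (h1 y hy) ?_)
      exact (A.le_opNorm _).trans (mul_le_of_le_one_right (norm_nonneg _) hy1)
    rw [map_smul, norm_smul, Real.norm_of_nonneg (by positivity), div_mul_eq_mul_div,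
      div_le_iff₀ hpos] at e
    linarith
  have h3 : ‖A‖ ≤ C := by linarith
  refine (abs_real_inner_le_norm _ _).trans ?_
  calc ‖v‖ * ‖A v‖ ≤ ‖v‖ * (C * ‖v‖) := by
        gcongr
        exact (A.le_opNorm v).trans (by gcongr)
    _ = _ := by ring

end Net
section Tail

/-- Truncation at level `K`. -/
noncomputable def trunc (K t : ℝ) : ℝ := if |t| ≤ K then t else 0

lemma measurable_trunc (K : ℝ) : Measurable (trunc K) :=
  Measurable.ite (measurableSet_le measurable_id.abs measurable_const) measurable_id
    measurable_const

lemma trunc_mem_Icc {K : ℝ} (hK : 0 ≤ K) (t : ℝ) : trunc K t ∈ Set.Icc (-K) K := by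
  unfold trunc
  split_ifs with h
  · exact abs_le.1 h
  · constructor <;> linarith

/-- Hoeffding's inequality for a linear form in truncated independent variables. -/
lemma measureReal_sum_trunc_ge_le {ι : Type*} [Fintype ι] (μ : ι → Measure ℝ)
    [∀ i, IsProbabilityMeasure (μ i)] {K V s : ℝ} (hK : 0 < K) (hV : 0 < V) (hs : 0 ≤ s)
    (c : ι → ℝ) (hc : ∑ i, c i ^ 2 ≤ V) :
    (Measure.pi μ).real {x | s ≤ ∑ i, c i * (trunc K (x i) - ∫ t, trunc K t ∂(μ i))} ≤
      Real.exp (-s ^ 2 / (2 * (V * K ^ 2))) := by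
  set Y : ι → ℝ → ℝ := fun i t => c i * (trunc K t - ∫ t, trunc K t ∂(μ i)) with hY
  have hmeas : ∀ i, Measurable (Y i) := fun i =>
    ((measurable_trunc K).sub measurable_const).const_mul _
  have hind : iIndepFun (fun i (x : ι → ℝ) => Y i (x i)) (Measure.pi μ) :=
    iIndepFun_pi fun i => (hmeas i).aemeasurable
  have hsub : ∀ i, HasSubgaussianMGF (fun x : ι → ℝ => Y i (x i)) (Real.toNNReal (c i ^ 2 * K ^ 2))
      (Measure.pi μ) := by
    intro i
    have h0 : HasSubgaussianMGF (fun t => trunc K t - ∫ t, trunc K t ∂(μ i))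
        ((‖K - -K‖₊ / 2) ^ 2) (μ i) :=
      hasSubgaussianMGF_of_mem_Icc (measurable_trunc K).aemeasurable
        (ae_of_all _ fun t => trunc_mem_Icc hK.le t)
    have h1 := h0.const_mul (c i)
    have h2 : (⟨c i ^ 2, sq_nonneg _⟩ * (‖K - -K‖₊ / 2) ^ 2 : NNReal)
        = Real.toNNReal (c i ^ 2 * K ^ 2) := by
      apply NNReal.eq
      rw [Real.coe_toNNReal _ (by positivity)]
      change c i ^ 2 * (((‖K - -K‖₊ / 2) ^ 2 : NNReal) : ℝ) = _
      simp only [NNReal.coe_pow, NNReal.coe_div, coe_nnnorm, NNReal.coe_ofNat]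
      rw [div_pow, Real.norm_eq_abs, sq_abs]
      ring
    rw [h2] at h1
    have hmp : MeasurePreserving (Function.eval i) (Measure.pi μ) (μ i) :=
      measurePreserving_eval μ i
    refine HasSubgaussianMGF.of_map (X := Y i) (Y := Function.eval i) hmp.measurable.aemeasurable ?_
    rwa [hmp.map_eq]
  have hsum := HasSubgaussianMGF.sum_of_iIndepFun hind (s := Finset.univ) fun i _ => hsub i
  have hle : ((∑ i, Real.toNNReal (c i ^ 2 * K ^ 2) : NNReal) : ℝ) ≤ V * K ^ 2 := by
    push_cast
    calc ∑ i, ((Real.toNNReal (c i ^ 2 * K ^ 2) : NNReal) : ℝ) = ∑ i, c i ^ 2 * K ^ 2 :=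
          Finset.sum_congr rfl fun i _ => Real.coe_toNNReal _ (by positivity)
      _ ≤ _ := by rw [← Finset.sum_mul]; gcongr
  have hVK : 0 < V * K ^ 2 := by positivity
  have hsub' : HasSubgaussianMGF (fun x : ι → ℝ => ∑ i, Y i (x i)) (Real.toNNReal (V * K ^ 2))
      (Measure.pi μ) := by
    refine ⟨hsum.integrable_exp_mul, fun t => (hsum.mgf_le t).trans ?_⟩
    rw [Real.coe_toNNReal _ hVK.le]
    gcongr
  have := hsub'.measure_ge_le hs
  rwa [Real.coe_toNNReal _ hVK.le] at this

variable {N : ℕ}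

lemma dotProduct_symOf_mulVec (v w : Fin N → ℝ) (x : UpperIdx N → ℝ) :
    v ⬝ᵥ (symOf x).mulVec w = ∑ p, upperCoef (Matrix.vecMulVec v w) p * x p := by
  rw [← sum_mul_symOf]
  simp only [dotProduct, Matrix.mulVec, Finset.mul_sum, Matrix.vecMulVec_apply]
  refine Finset.sum_congr rfl fun j _ => Finset.sum_congr rfl fun l _ => ?_
  ring

lemma frobSq_vecMulVec (v w : Fin N → ℝ) :
    frobSq (Matrix.vecMulVec v w) = (∑ j, v j ^ 2) * ∑ l, w l ^ 2 := by
  simp only [frobSq, Matrix.vecMulVec_apply, mul_pow, Finset.sum_mul_sum]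

/-- With high probability, all entries of a random symmetric matrix are at most `K` in absolute
value and its quadratic form is of order `K √N`. The constant `17` is `16` for the centered
truncated entries, by Hoeffding's inequality and a union bound over the at most `25 ^ N` pairs of a
net, and `1` for the means of the truncated entries. -/
lemma exists_good_set (hN : 0 < N) (μ : UpperIdx N → Measure ℝ) [∀ p, IsProbabilityMeasure (μ p)]
    {K δ : ℝ} (hK : 0 < K)
    (htail : ∀ p, (μ p).real {t | K < |t|} ≤ δ) (hmean : ∀ p, |∫ t, trunc K t ∂(μ p)| ≤ K * δ)
    (hδ : 8 * (N : ℝ) ^ 2 * δ ≤ √N) :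
    ∃ G : Set (UpperIdx N → ℝ), MeasurableSet G ∧
      (Measure.pi μ).real Gᶜ ≤ (N : ℝ) ^ 2 * δ + (1 / 2) ^ N ∧
      ∀ x ∈ G, (∀ p, |x p| ≤ K) ∧
        ∀ v : Fin N → ℝ, |v ⬝ᵥ (symOf x).mulVec v| ≤ 17 * K * √N * (v ⬝ᵥ v) := by
  obtain ⟨S, hScard, hS2, hSnet⟩ := exists_net (EuclideanSpace ℝ (Fin N))
  rw [finrank_euclideanSpace_fin] at hScard
  have hNr : (0 : ℝ) < N := by exact_mod_cast hN
  set s : ℝ := 16 * K * √N with hs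
  have hs0 : 0 ≤ s := by positivity
  let coef : EuclideanSpace ℝ (Fin N) × EuclideanSpace ℝ (Fin N) → UpperIdx N → ℝ :=
    fun q => upperCoef (Matrix.vecMulVec (q.2 : Fin N → ℝ) (q.1 : Fin N → ℝ))
  let bad1 : UpperIdx N → Set (UpperIdx N → ℝ) := fun p => {x | K < |x p|}
  let bad2 : EuclideanSpace ℝ (Fin N) × EuclideanSpace ℝ (Fin N) → Set (UpperIdx N → ℝ) :=
    fun q => {x | s ≤ ∑ p, coef q p * (trunc K (x p) - ∫ t, trunc K t ∂(μ p))}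
  have m1 : ∀ p, MeasurableSet (bad1 p) := fun p =>
    measurableSet_lt measurable_const (measurable_pi_apply p).abs
  have m2 : ∀ q, MeasurableSet (bad2 q) := fun q => by
    refine measurableSet_le measurable_const (Finset.measurable_sum _ fun p _ => ?_)
    exact (((measurable_trunc K).comp (measurable_pi_apply p)).sub measurable_const).const_mul _
  have p1 : ∀ p, (Measure.pi μ).real (bad1 p) ≤ δ := by
    intro p
    have hmp : MeasurePreserving (Function.eval p) (Measure.pi μ) (μ p) :=
      measurePreserving_eval μ p
    have : (Measure.pi μ).real (bad1 p) = (μ p).real {t | K < |t|} :=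
      hmp.measureReal_preimage
        (measurableSet_lt measurable_const measurable_id.abs).nullMeasurableSet
    rw [this]
    exact htail p
  have normsq : ∀ y : EuclideanSpace ℝ (Fin N), ‖y‖ = 2 → ∑ j, y j ^ 2 = 4 := by
    intro y hy
    rw [← EuclideanSpace.real_norm_sq_eq, hy]
    norm_num
  have p2 : ∀ q ∈ S ×ˢ S, (Measure.pi μ).real (bad2 q) ≤ Real.exp (-4) ^ N := by
    intro q hq
    rw [Finset.mem_product] at hq
    have hcoef : ∑ p, coef q p ^ 2 ≤ 32 := by
      refine (sum_upperCoef_sq_le _).trans ?_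
      rw [frobSq_vecMulVec, normsq _ (hS2 _ hq.1), normsq _ (hS2 _ hq.2)]
      norm_num
    refine (measureReal_sum_trunc_ge_le μ hK (V := 32) (by norm_num) hs0 (coef q) hcoef).trans ?_
    rw [← Real.exp_nat_mul]
    apply Real.exp_le_exp.2
    apply le_of_eq
    rw [hs, mul_pow, mul_pow, Real.sq_sqrt hNr.le]
    field_simp
    norm_num
  refine ⟨((⋃ p ∈ Finset.univ, bad1 p) ∪ ⋃ q ∈ S ×ˢ S, bad2 q)ᶜ, ?_, ?_, ?_⟩
  · exact ((Finset.measurableSet_biUnion _ fun p _ => m1 p).union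
      (Finset.measurableSet_biUnion _ fun q _ => m2 q)).compl
  · rw [compl_compl]
    refine (measureReal_union_le _ _).trans (add_le_add ?_ ?_)
    · refine (measureReal_biUnion_finset_le _ _).trans ?_
      refine (Finset.sum_le_sum fun p _ => p1 p).trans ?_
      rw [Finset.sum_const, nsmul_eq_mul, Finset.card_univ]
      by_cases hne : Nonempty (UpperIdx N)
      · have : 0 ≤ δ := measureReal_nonneg.trans (p1 hne.some)
        gcongr
        exact card_upperIdx_le N
      · exact absurd ⟨⟨(⟨0, hN⟩, ⟨0, hN⟩), le_rfl⟩⟩ hne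
    · refine (measureReal_biUnion_finset_le _ _).trans ?_
      refine (Finset.sum_le_sum fun q hq => p2 q hq).trans ?_
      rw [Finset.sum_const, nsmul_eq_mul, Finset.card_product]
      have e4 : Real.exp (-4) ≤ 1 / 50 := by
        rw [Real.exp_neg, ← one_div]
        apply one_div_le_one_div_of_le (by norm_num)
        have h1 := Real.exp_one_gt_d9
        have : Real.exp 4 = Real.exp 1 ^ 4 := by rw [← Real.exp_nat_mul]; norm_num
        rw [this]
        calc (50 : ℝ) ≤ 2.7 ^ 4 := by norm_num
          _ ≤ _ := by gcongr; linarith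
      have hc : ((S.card * S.card : ℕ) : ℝ) ≤ 25 ^ N := by
        calc ((S.card * S.card : ℕ) : ℝ) ≤ ((5 ^ N * 5 ^ N : ℕ) : ℝ) := by
              exact_mod_cast Nat.mul_le_mul hScard hScard
          _ = 25 ^ N := by push_cast; rw [← mul_pow]; norm_num
      calc ((S.card * S.card : ℕ) : ℝ) * Real.exp (-4) ^ N ≤ 25 ^ N * (1 / 50) ^ N := by gcongr
        _ = (1 / 2) ^ N := by rw [← mul_pow]; norm_num
  · intro x hx
    simp only [Set.mem_compl_iff, Set.mem_union, Set.mem_iUnion, not_or, not_exists] at hx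
    have hxK : ∀ p, |x p| ≤ K := fun p => not_lt.1 (hx.1 p (Finset.mem_univ p))
    refine ⟨hxK, fun v => ?_⟩
    set A := Matrix.toEuclideanCLM (n := Fin N) (𝕜 := ℝ) (symOf x) with hA
    have hbil : ∀ y ∈ S, ∀ z ∈ S, inner ℝ z (A y) ≤ 17 * K * √N := by
      intro y hy z hz
      have hb : ∑ p, coef (y, z) p * (trunc K (x p) - ∫ t, trunc K t ∂(μ p)) < s :=
        not_le.1 (hx.2 (y, z) (Finset.mk_mem_product hy hz))
      rw [hA, Matrix.inner_toEuclideanCLM, dotProduct_symOf_mulVec]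
      have habs : ∀ p, |coef (y, z) p| ≤ 8 := by
        intro p
        have hco : ∀ (y : EuclideanSpace ℝ (Fin N)), ‖y‖ = 2 → ∀ j, |y j| ≤ 2 := by
          intro y hy j
          have := PiLp.norm_apply_le y j
          rwa [hy] at this
        refine (abs_upperCoef_le (C := 4) (fun j l => ?_) p).trans (by norm_num)
        rw [Matrix.vecMulVec_apply, abs_mul]
        calc _ ≤ (2 : ℝ) * 2 := mul_le_mul (hco z (hS2 z hz) j) (hco y (hS2 y hy) l)
              (abs_nonneg _) (by norm_num)
          _ = 4 := by norm_num
      have hsplit : ∑ p, coef (y, z) p * x p =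
          ∑ p, coef (y, z) p * (trunc K (x p) - ∫ t, trunc K t ∂(μ p)) +
          ∑ p, coef (y, z) p * ∫ t, trunc K t ∂(μ p) := by
        rw [← Finset.sum_add_distrib]
        refine Finset.sum_congr rfl fun p _ => ?_
        rw [trunc, if_pos (hxK p)]
        ring
      have hm : ∑ p, coef (y, z) p * ∫ t, trunc K t ∂(μ p) ≤ K * √N := by
        calc _ ≤ ∑ p : UpperIdx N, 8 * (K * δ) := by
              refine Finset.sum_le_sum fun p _ => (le_abs_self _).trans ?_
              rw [abs_mul]
              exact mul_le_mul (habs p) (hmean p) (abs_nonneg _) (by norm_num)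
          _ = (Fintype.card (UpperIdx N) : ℝ) * (8 * (K * δ)) := by
              rw [Finset.sum_const, nsmul_eq_mul, Finset.card_univ]
          _ ≤ (N : ℝ) ^ 2 * (8 * (K * δ)) := by
              have : 0 ≤ K * δ := (abs_nonneg _).trans (hmean ⟨(⟨0, hN⟩, ⟨0, hN⟩), le_rfl⟩)
              gcongr
              exact card_upperIdx_le N
          _ = K * (8 * (N : ℝ) ^ 2 * δ) := by ring
          _ ≤ _ := by gcongr
      change ∑ p, coef (y, z) p * x p ≤ _
      rw [hsplit]
      linarith
    have := inner_le_of_net A hSnet (by positivity) hbil (WithLp.toLp 2 v)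
    rw [hA, Matrix.inner_toEuclideanCLM, EuclideanSpace.real_norm_sq_eq] at this
    simpa [dotProduct, sq] using this

end Tail
section Moments

/-- A level which all the entries of an `N × N` matrix satisfying the moment condition with
constant `B` respect with high probability. -/
noncomputable def entryBound (B : ℝ) (N : ℕ) : ℝ := Real.exp 10 * (⌈Real.log N⌉₊ : ℝ) ^ B

/-- Markov's inequality for the `m`-th moment at the level `K = e¹⁰ mᴮ`, for which the moment
condition gives `𝔼 |t / K| ^ m ≤ e⁻¹⁰ᵐ`. As the mean vanishes, the truncated mean is controlled by
the tail. -/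
lemma tail_and_truncated_mean_le (ν : Measure ℝ) [IsProbabilityMeasure ν] {B : ℝ} {m : ℕ}
    (hm : 1 ≤ m) (h1 : Integrable (fun t => t) ν) (h0 : ∫ t, t ∂ν = 0)
    (hi : Integrable (fun t => |t| ^ m) ν) (hB : ∫ t, |t| ^ m ∂ν ≤ (m : ℝ) ^ (B * m)) :
    ν.real {t | Real.exp 10 * (m : ℝ) ^ B < |t|} ≤ Real.exp (-10) ^ m ∧
      |∫ t, trunc (Real.exp 10 * (m : ℝ) ^ B) t ∂ν| ≤
        Real.exp 10 * (m : ℝ) ^ B * Real.exp (-10) ^ m := by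
  have hm0 : (0 : ℝ) < m := by exact_mod_cast hm
  set K := Real.exp 10 * (m : ℝ) ^ B with hK
  have hKpos : 0 < K := by positivity
  have hρ : ∫ t, |t| ^ m / K ^ m ∂ν ≤ Real.exp (-10) ^ m := by
    rw [integral_div, div_le_iff₀ (by positivity)]
    refine hB.trans (le_of_eq ?_)
    rw [hK, ← mul_pow, ← mul_assoc, ← Real.exp_add, Real.rpow_mul hm0.le, Real.rpow_natCast]
    norm_num
  have hKm : Integrable (fun t => |t| ^ m / K ^ m) ν := hi.div_const _
  have hset : MeasurableSet {t : ℝ | K < |t|} := measurableSet_lt measurable_const measurable_id.abs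
  have hratio : ∀ t : ℝ, K < |t| → 1 ≤ |t| ^ m / K ^ m := fun t ht => by
    rw [le_div_iff₀ (by positivity), one_mul]
    gcongr
  constructor
  · refine le_trans ?_ hρ
    rw [← integral_indicator_one hset]
    refine integral_mono ((integrable_const 1).indicator hset) hKm fun t => ?_
    by_cases ht : K < |t|
    · simpa [Set.indicator, ht] using hratio t ht
    · simp only [Set.indicator, Set.mem_ofPred_eq, ht, if_false]
      positivity
  · have htr : Integrable (trunc K) ν := by
      refine h1.mono (measurable_trunc K).aestronglyMeasurable (ae_of_all _ fun t => ?_)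
      unfold trunc
      split_ifs <;> simp
    have e : ∫ t, trunc K t ∂ν = ∫ t, (trunc K t - t) ∂ν := by
      rw [integral_sub htr h1, h0, sub_zero]
    rw [e]
    refine (abs_integral_le_integral_abs).trans ?_
    calc ∫ t, |trunc K t - t| ∂ν ≤ ∫ t, K * (|t| ^ m / K ^ m) ∂ν := by
          refine integral_mono (htr.sub h1).abs (hKm.const_mul K) fun t => ?_
          by_cases ht : K < |t|
          · simp only [trunc, not_le.2 ht, if_false, zero_sub, abs_neg]
            -- `|t| ≤ K (|t| / K) ^ m` for `|t| ≥ K` and `m ≥ 1`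
            have h2 : |t| / K ≤ (|t| / K) ^ m := by
              have : 1 ≤ |t| / K := by rw [le_div_iff₀ hKpos]; linarith
              exact le_self_pow₀ this (by omega)
            rw [div_pow, div_le_iff₀ hKpos] at h2
            linarith
          · simp only [trunc, not_lt.1 ht, if_true, sub_self, abs_zero]
            positivity
      _ = K * ∫ t, |t| ^ m / K ^ m ∂ν := integral_const_mul _ _
      _ ≤ _ := by gcongr

/-- The moment condition bounds the entries by a power of `log N`, and the quadratic form of the
matrix by `√N` times that power, outside an event of probability `O(N⁻⁸)`. -/
theorem eventually_exists_good_set (B : ℝ) : ∀ᶠ N : ℕ in atTop,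
    ∀ μ : UpperIdx N → Measure ℝ, (∀ p, IsProbabilityMeasure (μ p)) →
      (∀ p, ∫ t, t ∂(μ p) = 0) →
      (∀ p, ∀ m : ℕ, 1 ≤ m →
        Integrable (fun t => |t| ^ m) (μ p) ∧ ∫ t, |t| ^ m ∂(μ p) ≤ (m : ℝ) ^ (B * m)) →
      ∃ G : Set (UpperIdx N → ℝ), MeasurableSet G ∧
        (Measure.pi μ).real Gᶜ ≤ 2 / (N : ℝ) ^ 8 ∧
        ∀ x ∈ G, (∀ p, |x p| ≤ entryBound B N) ∧
          ∀ v : Fin N → ℝ,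
            |v ⬝ᵥ (symOf x).mulVec v| ≤ 17 * entryBound B N * √N * (v ⬝ᵥ v) := by
  have hgeom : ∀ᶠ N : ℕ in atTop, (N : ℝ) ^ 8 * (1 / 2 : ℝ) ^ N < 1 :=
    (tendsto_pow_const_mul_const_pow_of_lt_one 8 (by norm_num) (by norm_num)).eventually_lt_const
      one_pos
  filter_upwards [hgeom, eventually_ge_atTop 2] with N hN hN2 μ hμ h0 hmom
  have hNr : (2 : ℝ) ≤ N := by exact_mod_cast hN2
  have hNpos : (0 : ℝ) < N := by linarith
  -- with this choice of `m` the tail bound `exp (-10 m)` is at most `N⁻¹⁰`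
  set m := ⌈Real.log N⌉₊ with hm
  have hlog : 0 < Real.log N := Real.log_pos (by linarith)
  have hm1 : 1 ≤ m := Nat.one_le_ceil_iff.2 hlog
  have hm0 : (0 : ℝ) < m := by exact_mod_cast hm1
  have hδ : Real.exp (-10) ^ m ≤ 1 / (N : ℝ) ^ 10 := by
    have : (N : ℝ) ≤ Real.exp m := by
      rw [← Real.log_le_iff_le_exp hNpos]
      exact Nat.le_ceil _
    rw [← Real.exp_nat_mul, show (m : ℝ) * -10 = -((10 : ℕ) * (m : ℝ)) by push_cast; ring,
      Real.exp_neg, Real.exp_nat_mul, ← one_div]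
    gcongr
  have key := fun p => tail_and_truncated_mean_le (μ p) hm1 (by
    have := (hmom p 1 le_rfl).1
    simp only [pow_one] at this
    exact (integrable_norm_iff measurable_id.aestronglyMeasurable).1 this) (h0 p) (hmom p m hm1).1
    (hmom p m hm1).2
  obtain ⟨G, hG, hGm, hGx⟩ := exists_good_set (by omega) μ (K := entryBound B N)
    (δ := Real.exp (-10) ^ m) (by rw [entryBound]; positivity) (fun p => (key p).1)
    (fun p => (key p).2) (by
      have h2 : (1 : ℝ) ≤ √N := Real.one_le_sqrt.2 (by linarith)
      refine le_trans ?_ h2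
      calc 8 * (N : ℝ) ^ 2 * Real.exp (-10) ^ m ≤ 8 * (N : ℝ) ^ 2 * (1 / (N : ℝ) ^ 10) := by gcongr
        _ = 8 / (N : ℝ) ^ 8 := by field_simp
        _ ≤ 1 := by
          rw [div_le_one (by positivity)]
          calc (8 : ℝ) ≤ 2 ^ 8 := by norm_num
            _ ≤ _ := by gcongr)
  refine ⟨G, hG, hGm.trans ?_, hGx⟩
  have e1 : (N : ℝ) ^ 2 * Real.exp (-10) ^ m ≤ 1 / (N : ℝ) ^ 8 := by
    calc (N : ℝ) ^ 2 * Real.exp (-10) ^ m ≤ (N : ℝ) ^ 2 * (1 / (N : ℝ) ^ 10) := by gcongr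
      _ = _ := by field_simp
  have e2 : (1 / 2 : ℝ) ^ N ≤ 1 / (N : ℝ) ^ 8 := by
    rw [le_div_iff₀ (by positivity)]
    linarith
  calc _ ≤ 1 / (N : ℝ) ^ 8 + 1 / (N : ℝ) ^ 8 := add_le_add e1 e2
    _ = _ := by ring

end Moments

/-! ### The variance of the fluctuations beyond the linear term -/

section Variance

variable {N : ℕ}

lemma isHermitian_symOf_add_smul (x : UpperIdx N → ℝ) (θ : ℝ) {T : Matrix (Fin N) (Fin N) ℝ}
    (hT : T.IsHermitian) : (symOf x + θ • T).IsHermitian := by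
  refine Matrix.IsHermitian.add ?_ ?_
  · ext j l
    simp [symOf_comm x j l]
  · ext j l
    have := congrFun (congrFun hT j) l
    simp only [Matrix.conjTranspose_apply, star_trivial] at this
    simp [this]

lemma continuous_symOf_apply (j l : Fin N) : Continuous fun x : UpperIdx N → ℝ => symOf x j l :=
  continuous_apply _

lemma continuous_topSum {T : Matrix (Fin N) (Fin N) ℝ} (hT : T.IsHermitian) (θ : ℝ) {i : ℕ}
    (hi : i ≤ N) :
    Continuous fun x : UpperIdx N → ℝ => topSum (isHermitian_symOf_add_smul x θ hT) i := by
  rw [continuous_iff_continuousAt]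
  intro x
  rw [ContinuousAt, tendsto_iff_norm_sub_tendsto_zero]
  have hc : Continuous fun y : UpperIdx N → ℝ => ∑ j, ∑ l, |symOf y j l - symOf x j l| :=
    continuous_finsetSum _ fun j _ => continuous_finsetSum _ fun l _ =>
      ((continuous_symOf_apply j l).sub continuous_const).abs
  have h0 := hc.tendsto x
  simp only [sub_self, abs_zero, Finset.sum_const_zero] at h0
  refine squeeze_zero (fun _ => norm_nonneg _) (fun y => ?_) h0
  refine (abs_topSum_sub_le_sum (isHermitian_symOf_add_smul y θ hT)
    (isHermitian_symOf_add_smul x θ hT) hi).trans (le_of_eq ?_)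
  simp

lemma abs_topSum_le_sum {M : Matrix (Fin N) (Fin N) ℝ} (hM : M.IsHermitian) {i : ℕ} (hi : i ≤ N) :
    |topSum hM i| ≤ ∑ j, ∑ l, |M j l| := by
  obtain ⟨P, hP, hPM, -⟩ := exists_topProj hM hi
  rw [← hPM]
  exact hP.abs_trace_mul_le_sum M

variable {μ : UpperIdx N → Measure ℝ} [∀ p, IsProbabilityMeasure (μ p)]

lemma memLp_eval (hμ : ∀ p, MemLp (fun t => t) 2 (μ p)) (p : UpperIdx N) :
    MemLp (fun x : UpperIdx N → ℝ => x p) 2 (Measure.pi μ) :=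
  (hμ p).comp_measurePreserving (measurePreserving_eval μ p)

lemma memLp_topSum (hμ : ∀ p, MemLp (fun t => t) 2 (μ p)) {T : Matrix (Fin N) (Fin N) ℝ}
    (hT : T.IsHermitian) (θ : ℝ) {i : ℕ} (hi : i ≤ N) :
    MemLp (fun x : UpperIdx N → ℝ => topSum (isHermitian_symOf_add_smul x θ hT) i) 2
      (Measure.pi μ) := by
  have hb : MemLp (fun x : UpperIdx N → ℝ => ∑ j, ∑ l, |(symOf x + θ • T) j l|) 2
      (Measure.pi μ) := by
    refine memLp_finsetSum _ fun j _ => memLp_finsetSum _ fun l _ => ?_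
    exact ((memLp_eval hμ _).add (memLp_const (θ * T j l))).abs
  refine hb.mono (continuous_topSum hT θ hi).aestronglyMeasurable (ae_of_all _ fun x => ?_)
  exact (abs_topSum_le_sum _ hi).trans (le_abs_self _)

lemma memLp_trace_mul (hμ : ∀ p, MemLp (fun t => t) 2 (μ p)) {E : Matrix (Fin N) (Fin N) ℝ}
    (hE : E.transpose = E) :
    MemLp (fun x : UpperIdx N → ℝ => (symOf x * E).trace) 2 (Measure.pi μ) := by
  simp only [trace_mul_eq_sum _ E hE, sum_mul_symOf]
  exact memLp_finsetSum _ fun p _ => (memLp_eval hμ p).const_mul _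

/-- Replacing one entry of a matrix `A` changes the sum of its `i` top eigenvalues by at most the
change of `tr (A P)`, where `P` is the top spectral projection of the original matrix; this uses
the convexity of the sum. The changes are thus controlled by the distance of `P` from `E`, which is
at most the distance of `Q` from `E` up to a term that is small on a likely event. -/
lemma sum_sq_posPart_le {T E Q : Matrix (Fin N) (Fin N) ℝ} (hT : T.IsHermitian)
    (hE : E.transpose = E) {θ κ K L : ℝ} (hθ : 0 < θ) (hκ : 0 < κ) (hL : 0 ≤ L)
    {i : ℕ} (hi : i ≤ N) (hQ : IsRankProj Q i)
    (hgap : ∀ R, IsRankProj R i → (T * R).trace + κ / 2 * frobSq (Q - R) ≤ (T * Q).trace)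
    {G : Set (UpperIdx N → ℝ)}
    (hG : ∀ x ∈ G, (∀ p, |x p| ≤ K) ∧ ∀ v : Fin N → ℝ, |v ⬝ᵥ (symOf x).mulVec v| ≤ L * (v ⬝ᵥ v))
    {g : (UpperIdx N → ℝ) → ℝ}
    (hg : g = fun x => topSum (isHermitian_symOf_add_smul x θ hT) i - (symOf x * E).trace)
    (x y : UpperIdx N → ℝ) :
    ∑ p, (max (g x - g (Function.update x p (y p))) 0) ^ 2 ≤
      64 * K ^ 2 * (i * L) / (κ * θ) +
        (32 * ∑ p, (G ×ˢ G)ᶜ.indicator 1 (x, y) * (x p - y p) ^ 2 +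
        2 * ∑ p, upperCoef (Q - E) p ^ 2 * (x p - y p) ^ 2) := by
  obtain ⟨P, hP, hPA, -⟩ := exists_topProj (isHermitian_symOf_add_smul x θ hT) hi
  have hPE : (P - E).transpose = P - E := by rw [Matrix.transpose_sub, hP.transpose_eq, hE]
  -- One-sided increments suffice: `P` is optimal for `x` and a competitor for the modified matrix.
  have step : ∀ p, (max (g x - g (Function.update x p (y p))) 0) ^ 2 ≤
      2 * (upperCoef (P - Q) p ^ 2 * (x p - y p) ^ 2) +
      2 * (upperCoef (Q - E) p ^ 2 * (x p - y p) ^ 2) := by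
    intro p
    set x' := Function.update x p (y p) with hx'
    have h1 : g x - g x' ≤ upperCoef (P - E) p * (x p - y p) := by
      rw [← trace_symOf_sub_update (P - E) hPE x p (y p), ← hx', hg]
      have h2 := hP.trace_mul_le_topSum hi (isHermitian_symOf_add_smul x' θ hT)
      dsimp only
      rw [← hPA]
      rw [add_mul, Matrix.trace_add] at h2 ⊢
      rw [mul_sub, sub_mul, sub_mul, Matrix.trace_sub, Matrix.trace_sub, Matrix.trace_sub]
      linarith
    have h3 : upperCoef (P - E) p = upperCoef (P - Q) p + upperCoef (Q - E) p := by
      rw [← upperCoef_add]; congr 1; abel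
    have h4 : (max (g x - g x') 0) ^ 2 ≤ (upperCoef (P - E) p * (x p - y p)) ^ 2 := by
      rcases le_total (g x - g x') 0 with h | h
      · rw [max_eq_right h, zero_pow two_ne_zero]; exact sq_nonneg _
      · rw [max_eq_left h]; exact pow_le_pow_left₀ h h1 2
    refine h4.trans ?_
    rw [mul_pow, h3]
    have : (upperCoef (P - Q) p + upperCoef (Q - E) p) ^ 2
        ≤ 2 * upperCoef (P - Q) p ^ 2 + 2 * upperCoef (Q - E) p ^ 2 := by
      nlinarith [sq_nonneg (upperCoef (P - Q) p - upperCoef (Q - E) p)]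
    nlinarith [mul_le_mul_of_nonneg_right this (sq_nonneg (x p - y p))]
  refine (Finset.sum_le_sum fun p _ => step p).trans ?_
  rw [Finset.sum_add_distrib, ← Finset.mul_sum, ← Finset.mul_sum, ← add_assoc]
  refine add_le_add ?_ le_rfl
  -- On the good event `P - Q` is small; off it, the entries of `P - Q` are merely at most `2`.
  by_cases hxy : x ∈ G ∧ y ∈ G
  · have hx := hG x hxy.1
    have hy := hG y hxy.2
    have hind : (G ×ˢ G)ᶜ.indicator (1 : (UpperIdx N → ℝ) × (UpperIdx N → ℝ) → ℝ) (x, y) = 0 := by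
      simp [hxy]
    simp only [hind, zero_mul, Finset.sum_const_zero, mul_zero, add_zero]
    have hfrob : κ * frobSq (Q - P) * θ ≤ 4 * (i * L) := by
      have := frobSq_topProj_sub_le (c := κ) (d := 0)
        (isHermitian_symOf_add_smul x θ hT) hi hθ (fun R hR => hR.abs_trace_mul_le hx.2) hP hPA hQ
        (by simpa using hgap P hP)
      simpa using this
    have hfrob' : frobSq (P - Q) ≤ 4 * (i * L) / (κ * θ) := by
      rw [le_div_iff₀ (by positivity), ← neg_sub Q P, frobSq_neg]
      linarith
    calc 2 * ∑ p, upperCoef (P - Q) p ^ 2 * (x p - y p) ^ 2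
        ≤ 2 * ∑ p, upperCoef (P - Q) p ^ 2 * (4 * K ^ 2) := by
          gcongr with p
          have h1 := abs_le.1 (hx.1 p)
          have h2 := abs_le.1 (hy.1 p)
          nlinarith
      _ = 8 * K ^ 2 * ∑ p, upperCoef (P - Q) p ^ 2 := by rw [← Finset.sum_mul]; ring
      _ ≤ 8 * K ^ 2 * (2 * frobSq (P - Q)) := by
          gcongr
          exact sum_upperCoef_sq_le _
      _ ≤ 8 * K ^ 2 * (2 * (4 * (i * L) / (κ * θ))) := by gcongr
      _ = _ := by ring
  · have hind : (G ×ˢ G)ᶜ.indicator (1 : (UpperIdx N → ℝ) × (UpperIdx N → ℝ) → ℝ) (x, y) = 1 := by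
      simp only [Set.indicator, Set.mem_compl_iff, Set.mem_prod, hxy, not_false_eq_true, if_true,
        Pi.one_apply]
    simp only [hind, one_mul]
    have hb : 2 * ∑ p, upperCoef (P - Q) p ^ 2 * (x p - y p) ^ 2 ≤ 32 * ∑ p, (x p - y p) ^ 2 := by
      rw [Finset.mul_sum, Finset.mul_sum]
      refine Finset.sum_le_sum fun p _ => ?_
      have h1 : |upperCoef (P - Q) p| ≤ 2 * 2 := abs_upperCoef_le (fun j l => by
        rw [Matrix.sub_apply]
        exact (abs_sub _ _).trans (by linarith [hP.abs_le_one j l, hQ.abs_le_one j l])) p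
      have h2 : upperCoef (P - Q) p ^ 2 ≤ 16 := by
        rw [← sq_abs]; nlinarith [abs_nonneg (upperCoef (P - Q) p)]
      nlinarith [mul_le_mul_of_nonneg_right h2 (sq_nonneg (x p - y p))]
    have : 0 ≤ 64 * K ^ 2 * (i * L) / (κ * θ) := by positivity
    linarith

lemma integral_sq_sub_le (hμ4 : ∀ p, MemLp (fun t => t) 4 (μ p)) {V : ℝ}
    (hV : ∀ p, ∫ t, t ^ 2 ∂(μ p) ≤ V) (p : UpperIdx N) :
    Integrable (fun z : (UpperIdx N → ℝ) × (UpperIdx N → ℝ) => (z.1 p - z.2 p) ^ 2)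
      ((Measure.pi μ).prod (Measure.pi μ)) ∧
    ∫ z, (z.1 p - z.2 p) ^ 2 ∂((Measure.pi μ).prod (Measure.pi μ)) ≤ 4 * V := by
  have h2 : MemLp (fun x : UpperIdx N → ℝ => x p) 2 (Measure.pi μ) :=
    memLp_eval (fun p => (hμ4 p).mono_exponent (by norm_num)) p
  have hx : MemLp (fun z : (UpperIdx N → ℝ) × (UpperIdx N → ℝ) => z.1 p) 2
    ((Measure.pi μ).prod (Measure.pi μ)) := h2.comp_measurePreserving measurePreserving_fst
  have hy : MemLp (fun z : (UpperIdx N → ℝ) × (UpperIdx N → ℝ) => z.2 p) 2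
    ((Measure.pi μ).prod (Measure.pi μ)) := h2.comp_measurePreserving measurePreserving_snd
  have hint : ∫ x : UpperIdx N → ℝ, x p ^ 2 ∂(Measure.pi μ) = ∫ t, t ^ 2 ∂(μ p) :=
    integral_comp_eval (μ := μ) (f := fun t => t ^ 2) (by fun_prop)
  refine ⟨(hx.sub hy).integrable_sq, ?_⟩
  calc ∫ z, (z.1 p - z.2 p) ^ 2 ∂((Measure.pi μ).prod (Measure.pi μ))
      ≤ ∫ z, (2 * z.1 p ^ 2 + 2 * z.2 p ^ 2) ∂((Measure.pi μ).prod (Measure.pi μ)) := by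
        refine integral_mono (hx.sub hy).integrable_sq
          ((hx.integrable_sq.const_mul 2).add (hy.integrable_sq.const_mul 2)) fun z => ?_
        nlinarith [sq_nonneg (z.1 p + z.2 p)]
    _ = 4 * ∫ t, t ^ 2 ∂(μ p) := by
        rw [integral_add (hx.integrable_sq.const_mul 2) (hy.integrable_sq.const_mul 2),
          integral_const_mul, integral_const_mul,
          integral_fun_fst (μ := Measure.pi μ) (ν := Measure.pi μ) (fun x => x p ^ 2),
          integral_fun_snd (μ := Measure.pi μ) (ν := Measure.pi μ) (fun x => x p ^ 2), hint]
        simp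
        ring
    _ ≤ _ := by linarith [hV p]

/-- The contribution of the unlikely event that one of two independent copies of the matrix is not
good; the parameter `r` balances the probability of the event against the fourth moments. -/
lemma integral_indicator_mul_sq_sub_le (hμ4 : ∀ p, MemLp (fun t => t) 4 (μ p)) {V η r : ℝ}
    (hV : ∀ p, ∫ t, t ^ 4 ∂(μ p) ≤ V) (hr : 0 < r) {G : Set (UpperIdx N → ℝ)}
    (hG : MeasurableSet G) (hη : (Measure.pi μ).real Gᶜ ≤ η) (p : UpperIdx N) :
    Integrable (fun z : (UpperIdx N → ℝ) × (UpperIdx N → ℝ) =>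
      (G ×ˢ G)ᶜ.indicator 1 z * (z.1 p - z.2 p) ^ 2) ((Measure.pi μ).prod (Measure.pi μ)) ∧
    ∫ z, (G ×ˢ G)ᶜ.indicator 1 z * (z.1 p - z.2 p) ^ 2 ∂((Measure.pi μ).prod (Measure.pi μ)) ≤
      r * η + 8 * V / r := by
  set ν := (Measure.pi μ).prod (Measure.pi μ) with hν
  have h4 : MemLp (fun x : UpperIdx N → ℝ => x p) 4 (Measure.pi μ) :=
    (hμ4 p).comp_measurePreserving (measurePreserving_eval μ p)
  have hx : MemLp (fun z : (UpperIdx N → ℝ) × (UpperIdx N → ℝ) => z.1 p) 4 ν :=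
    h4.comp_measurePreserving measurePreserving_fst
  have hy : MemLp (fun z : (UpperIdx N → ℝ) × (UpperIdx N → ℝ) => z.2 p) 4 ν :=
    h4.comp_measurePreserving measurePreserving_snd
  have pow4 : ∀ {f : (UpperIdx N → ℝ) × (UpperIdx N → ℝ) → ℝ}, MemLp f 4 ν →
      Integrable (fun z => f z ^ 4) ν := fun {f} hf => by
    have := hf.integrable_norm_pow (p := 4) (by norm_num)
    refine this.congr (ae_of_all _ fun z => ?_)
    simp only [Real.norm_eq_abs]
    exact Even.pow_abs (by decide) _
  have hint : ∫ x : UpperIdx N → ℝ, x p ^ 4 ∂(Measure.pi μ) = ∫ t, t ^ 4 ∂(μ p) :=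
    integral_comp_eval (μ := μ) (f := fun t => t ^ 4) (by fun_prop)
  have hset : MeasurableSet (G ×ˢ G)ᶜ := (hG.prod hG).compl
  have hprob : ν.real (G ×ˢ G)ᶜ ≤ 2 * η := by
    have hsub : (G ×ˢ G)ᶜ ⊆ (Prod.fst ⁻¹' Gᶜ) ∪ (Prod.snd ⁻¹' Gᶜ) := by
      intro z hz
      by_contra hc
      simp only [Set.mem_union, Set.mem_preimage, Set.mem_compl_iff, not_or, not_not] at hc
      exact hz ⟨hc.1, hc.2⟩
    have e1 : ν.real (Prod.fst ⁻¹' Gᶜ) = (Measure.pi μ).real Gᶜ :=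
      measurePreserving_fst.measureReal_preimage hG.compl.nullMeasurableSet
    have e2 : ν.real (Prod.snd ⁻¹' Gᶜ) = (Measure.pi μ).real Gᶜ :=
      measurePreserving_snd.measureReal_preimage hG.compl.nullMeasurableSet
    calc ν.real (G ×ˢ G)ᶜ ≤ ν.real ((Prod.fst ⁻¹' Gᶜ) ∪ (Prod.snd ⁻¹' Gᶜ)) := measureReal_mono hsub
      _ ≤ _ := measureReal_union_le _ _
      _ ≤ 2 * η := by rw [e1, e2]; linarith
  have hI : Integrable ((G ×ˢ G)ᶜ.indicator (1 : (UpperIdx N → ℝ) × (UpperIdx N → ℝ) → ℝ)) ν :=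
    (integrable_const 1).indicator hset
  have hsum : Integrable (fun z : (UpperIdx N → ℝ) × (UpperIdx N → ℝ) =>
      4 / r * z.1 p ^ 4 + 4 / r * z.2 p ^ 4) ν :=
    ((pow4 hx).const_mul _).add ((pow4 hy).const_mul _)
  have hdom : Integrable (fun z => r / 2 * (G ×ˢ G)ᶜ.indicator 1 z +
      (4 / r * z.1 p ^ 4 + 4 / r * z.2 p ^ 4)) ν :=
    (hI.const_mul _).add hsum
  have hle : ∀ z : (UpperIdx N → ℝ) × (UpperIdx N → ℝ),
      (G ×ˢ G)ᶜ.indicator 1 z * (z.1 p - z.2 p) ^ 2 ≤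
      r / 2 * (G ×ˢ G)ᶜ.indicator 1 z + (4 / r * z.1 p ^ 4 + 4 / r * z.2 p ^ 4) := by
    intro z
    by_cases hz : z ∈ (G ×ˢ G)ᶜ
    · rw [Set.indicator_of_mem hz, Pi.one_apply, one_mul, mul_one]
      -- `t² ≤ r / 2 + t⁴ / (2 r)` with `t = x - y` and `t⁴ ≤ 8 (x⁴ + y⁴)`
      set a := z.1 p
      set b := z.2 p
      have h8 : (a - b) ^ 4 ≤ 8 * (a ^ 4 + b ^ 4) := by
        nlinarith [sq_nonneg (a ^ 2 - b ^ 2), sq_nonneg (a + b), sq_nonneg ((a + b) ^ 2),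
          mul_nonneg (sq_nonneg (a + b)) (sq_nonneg (a - b)), sq_nonneg (a ^ 2 + b ^ 2),
          sq_nonneg (a * b), mul_nonneg (sq_nonneg (a + b)) (sq_nonneg a),
          mul_nonneg (sq_nonneg (a + b)) (sq_nonneg b)]
      have h9 : (a - b) ^ 2 ≤ r / 2 + (a - b) ^ 4 / (2 * r) := by
        have : r / 2 + (a - b) ^ 4 / (2 * r) - (a - b) ^ 2 = (r - (a - b) ^ 2) ^ 2 / (2 * r) := by
          field_simp; ring
        have h : 0 ≤ (r - (a - b) ^ 2) ^ 2 / (2 * r) := by positivity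
        linarith
      calc (a - b) ^ 2 ≤ r / 2 + (a - b) ^ 4 / (2 * r) := h9
        _ ≤ r / 2 + 8 * (a ^ 4 + b ^ 4) / (2 * r) := by gcongr
        _ = _ := by field_simp; ring
    · rw [Set.indicator_of_notMem hz]
      have : 0 ≤ 4 / r * z.1 p ^ 4 + 4 / r * z.2 p ^ 4 := by positivity
      linarith
  have hInt : Integrable (fun z : (UpperIdx N → ℝ) × (UpperIdx N → ℝ) =>
      (G ×ˢ G)ᶜ.indicator 1 z * (z.1 p - z.2 p) ^ 2) ν := by
    refine hdom.mono' ?_ (ae_of_all _ fun z => ?_)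
    · exact hI.1.mul ((hx.1.sub hy.1).pow 2)
    · have h0 : 0 ≤ (G ×ˢ G)ᶜ.indicator 1 z * (z.1 p - z.2 p) ^ 2 :=
        mul_nonneg (Set.indicator_apply_nonneg fun _ => zero_le_one) (sq_nonneg _)
      rw [Real.norm_of_nonneg h0]
      exact hle z
  refine ⟨hInt, (integral_mono hInt hdom hle).trans ?_⟩
  rw [integral_add (hI.const_mul _) hsum,
    integral_add ((pow4 hx).const_mul _) ((pow4 hy).const_mul _), integral_const_mul,
    integral_const_mul, integral_const_mul, hν,
    integral_fun_fst (μ := Measure.pi μ) (ν := Measure.pi μ) (fun x => x p ^ 4),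
    integral_fun_snd (μ := Measure.pi μ) (ν := Measure.pi μ) (fun x => x p ^ 4), hint, ← hν,
    integral_indicator_one hset]
  simp only [probReal_univ, one_smul]
  calc r / 2 * ν.real (G ×ˢ G)ᶜ + (4 / r * ∫ t, t ^ 4 ∂(μ p) + 4 / r * ∫ t, t ^ 4 ∂(μ p))
      ≤ r / 2 * (2 * η) + (4 / r * V + 4 / r * V) := by
        have := hV p
        gcongr
    _ = _ := by ring

/-- The sum of the top `i` eigenvalues of `W + θ T` differs from its linearization `tr (W E)` by
a variable of small variance, for `E` close to the top spectral projection `Q` of `T`. -/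
theorem variance_topSum_sub_trace_le (hμ4 : ∀ p, MemLp (fun t => t) 4 (μ p)) {V₂ V₄ : ℝ}
    (hV₂ : ∀ p, ∫ t, t ^ 2 ∂(μ p) ≤ V₂) (hV₄ : ∀ p, ∫ t, t ^ 4 ∂(μ p) ≤ V₄)
    (hV₂0 : 0 ≤ V₂) {T E Q : Matrix (Fin N) (Fin N) ℝ} (hT : T.IsHermitian)
    (hE : E.transpose = E) {θ κ K L : ℝ} (hθ : 0 < θ) (hκ : 0 < κ) (hL : 0 ≤ L)
    {i : ℕ} (hi : i ≤ N) (hQ : IsRankProj Q i)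
    (hgap : ∀ R, IsRankProj R i → (T * R).trace + κ / 2 * frobSq (Q - R) ≤ (T * Q).trace)
    {G : Set (UpperIdx N → ℝ)} (hGm : MeasurableSet G) {η r : ℝ} (hr : 0 < r)
    (hη : (Measure.pi μ).real Gᶜ ≤ η)
    (hG : ∀ x ∈ G, (∀ p, |x p| ≤ K) ∧
      ∀ v : Fin N → ℝ, |v ⬝ᵥ (symOf x).mulVec v| ≤ L * (v ⬝ᵥ v)) :
    Var[fun x => topSum (isHermitian_symOf_add_smul x θ hT) i - (symOf x * E).trace;
      Measure.pi μ] ≤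
      64 * K ^ 2 * (i * L) / (κ * θ) +
        (32 * ((Fintype.card (UpperIdx N) : ℝ) * (r * η + 8 * V₄ / r)) +
          16 * V₂ * frobSq (Q - E)) := by
  set g : (UpperIdx N → ℝ) → ℝ :=
    fun x => topSum (isHermitian_symOf_add_smul x θ hT) i - (symOf x * E).trace with hg
  have hμ2 : ∀ p, MemLp (fun t => t) 2 (μ p) := fun p => (hμ4 p).mono_exponent (by norm_num)
  have hgL : MemLp g 2 (Measure.pi μ) := (memLp_topSum hμ2 hT θ hi).sub (memLp_trace_mul hμ2 hE)
  set ν := (Measure.pi μ).prod (Measure.pi μ) with hν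
  refine (variance_le_sum_integral_sq_posPart hgL).trans ?_
  have hIS := fun p => integral_sq_sub_le hμ4 hV₂ p
  have hII := fun p => integral_indicator_mul_sq_sub_le hμ4 hV₄ hr hGm hη p
  rw [← hν] at hIS hII ⊢
  have hfst : MemLp (fun z : (UpperIdx N → ℝ) × (UpperIdx N → ℝ) => g z.1) 2 ν :=
    hgL.comp_measurePreserving measurePreserving_fst
  have hupd : ∀ p, MemLp (fun z : (UpperIdx N → ℝ) × (UpperIdx N → ℝ) =>
      g (Function.update z.1 p (z.2 p))) 2 ν := fun p => by
    have := hfst.comp_measurePreserving (measurePreserving_swapOn μ {p})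
    simpa only [Function.comp_def, swapOn_singleton_fst] using this
  have hpos : ∀ p, Integrable (fun z : (UpperIdx N → ℝ) × (UpperIdx N → ℝ) =>
      (max (g z.1 - g (Function.update z.1 p (z.2 p))) 0) ^ 2) ν := fun p =>
    ((hfst.sub (hupd p)).pos_part).integrable_sq
  rw [← integral_finsetSum _ fun p _ => hpos p]
  have i1 : Integrable (fun z : (UpperIdx N → ℝ) × (UpperIdx N → ℝ) =>
      32 * ∑ p, (G ×ˢ G)ᶜ.indicator 1 z * (z.1 p - z.2 p) ^ 2) ν :=
    (integrable_finsetSum _ fun p _ => (hII p).1).const_mul _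
  have i2 : Integrable (fun z : (UpperIdx N → ℝ) × (UpperIdx N → ℝ) =>
      2 * ∑ p, upperCoef (Q - E) p ^ 2 * (z.1 p - z.2 p) ^ 2) ν :=
    (integrable_finsetSum _ fun p _ => (hIS p).1.const_mul _).const_mul _
  have i12 : Integrable (fun z : (UpperIdx N → ℝ) × (UpperIdx N → ℝ) =>
      32 * ∑ p, (G ×ˢ G)ᶜ.indicator 1 z * (z.1 p - z.2 p) ^ 2 +
      2 * ∑ p, upperCoef (Q - E) p ^ 2 * (z.1 p - z.2 p) ^ 2) ν := i1.add i2
  have i0 : Integrable (fun z : (UpperIdx N → ℝ) × (UpperIdx N → ℝ) =>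
      64 * K ^ 2 * (i * L) / (κ * θ) +
      (32 * ∑ p, (G ×ˢ G)ᶜ.indicator 1 z * (z.1 p - z.2 p) ^ 2 +
      2 * ∑ p, upperCoef (Q - E) p ^ 2 * (z.1 p - z.2 p) ^ 2)) ν := (integrable_const _).add i12
  refine (integral_mono (integrable_finsetSum _ fun p _ => hpos p)
    i0 fun z =>
    sum_sq_posPart_le hT hE hθ hκ hL hi hQ hgap hG hg z.1 z.2).trans ?_
  rw [integral_add (integrable_const _) i12, integral_add i1 i2, integral_const_mul,
    integral_const_mul,
    integral_finsetSum _ fun p _ => (hII p).1,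
    integral_finsetSum _ fun p _ => (hIS p).1.const_mul _, integral_const]
  simp only [probReal_univ, one_smul, integral_const_mul]
  refine add_le_add le_rfl (add_le_add (mul_le_mul_of_nonneg_left ?_ (by norm_num)) ?_)
  · calc _ ≤ ∑ p : UpperIdx N, (r * η + 8 * V₄ / r) := Finset.sum_le_sum fun p _ => (hII p).2
      _ = _ := by rw [Finset.sum_const, nsmul_eq_mul, Finset.card_univ]
  · calc 2 * ∑ p, upperCoef (Q - E) p ^ 2 * ∫ z, (z.1 p - z.2 p) ^ 2 ∂ν
        ≤ 2 * ∑ p, upperCoef (Q - E) p ^ 2 * (4 * V₂) := by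
          gcongr with p
          exact (hIS p).2
      _ = 8 * V₂ * ∑ p, upperCoef (Q - E) p ^ 2 := by rw [← Finset.sum_mul]; ring
      _ ≤ 8 * V₂ * (2 * frobSq (Q - E)) := by
          gcongr
          exact sum_upperCoef_sq_le _
      _ = _ := by ring

end Variance

/-! ### The spectrum of the deterministic part -/

section GramSchmidt

/-- An asymptotically orthonormal family is asymptotically close to an orthonormal one,
namely the one obtained by the Gram–Schmidt process; the dimension of the space may vary with `N`. -/
lemma exists_orthonormal_near {k : ℕ} {E : ℕ → Type*} [∀ N, NormedAddCommGroup (E N)]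
    [∀ N, InnerProductSpace ℝ (E N)] (e : ∀ N, Fin k → E N)
    (h : ∀ i j, Tendsto (fun N => inner ℝ (e N i) (e N j)) atTop (𝓝 (if i = j then 1 else 0))) :
    ∃ u : ∀ N, Fin k → E N, (∀ᶠ N in atTop, Orthonormal ℝ (u N)) ∧
      ∀ i, Tendsto (fun N => ‖e N i - u N i‖) atTop (𝓝 0) := by
  set g : ∀ N, Fin k → E N := fun N => InnerProductSpace.gramSchmidt ℝ (e N) with hg
  have hnorm : ∀ i, Tendsto (fun N => ‖e N i‖) atTop (𝓝 1) := by
    intro i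
    have h1 := (h i i).sqrt
    simp only [if_true, Real.sqrt_one, real_inner_self_eq_norm_sq, Real.sqrt_sq (norm_nonneg _)]
      at h1
    exact h1
  have gnorm : ∀ i, Tendsto (fun N => ‖e N i - g N i‖) atTop (𝓝 0) →
      Tendsto (fun N => ‖g N i‖) atTop (𝓝 1) := by
    intro i hi
    refine tendsto_of_tendsto_of_tendsto_of_le_of_le
      (g := fun N => ‖e N i‖ - ‖e N i - g N i‖) (h := fun N => ‖e N i‖ + ‖e N i - g N i‖)
      (by simpa using (hnorm i).sub hi) (by simpa using (hnorm i).add hi) (fun N => ?_) fun N => ?_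
    · have := norm_sub_norm_le (e N i) (g N i)
      dsimp only
      linarith
    · have := norm_sub_norm_le (g N i) (e N i)
      rw [norm_sub_rev] at this
      dsimp only
      linarith
  have hclose : ∀ i, Tendsto (fun N => ‖e N i - g N i‖) atTop (𝓝 0) := by
    intro i
    induction i using WellFoundedLT.induction with
    | ind i ih =>
      have hterm : ∀ j ∈ Finset.Iio i,
          Tendsto (fun N => |inner ℝ (g N j) (e N i)| / ‖g N j‖) atTop (𝓝 0) := by
        intro j hj
        have hji : j < i := Finset.mem_Iio.1 hj
        have h1 : Tendsto (fun N => inner ℝ (g N j) (e N i)) atTop (𝓝 0) := by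
          have h2 : Tendsto (fun N => inner ℝ (e N j) (e N i)) atTop (𝓝 0) := by
            simpa [hji.ne] using h j i
          have h3 : Tendsto (fun N => inner ℝ (e N j - g N j) (e N i)) atTop (𝓝 0) := by
            refine squeeze_zero_norm (fun N => norm_inner_le_norm _ _) ?_
            simpa using (ih j hji).mul (hnorm i)
          have h4 := h2.sub h3
          simp only [inner_sub_left, sub_sub_cancel, sub_zero] at h4
          exact h4
        have h5 := h1.abs.div (gnorm j (ih j hji)) one_ne_zero
        simp only [abs_zero, zero_div] at h5
        exact h5
      have hsum := tendsto_finsetSum (Finset.Iio i) hterm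
      simp only [Finset.sum_const_zero] at hsum
      refine squeeze_zero (fun N => norm_nonneg _) (fun N => ?_) hsum
      have hdef : e N i - g N i = ∑ j ∈ Finset.Iio i, (ℝ ∙ g N j).starProjection (e N i) := by
        simp only [hg]
        rw [InnerProductSpace.gramSchmidt_def, sub_sub_cancel]
      rw [hdef]
      refine (norm_sum_le _ _).trans (Finset.sum_le_sum fun j _ => ?_)
      rw [Submodule.starProjection_singleton, norm_smul]
      rcases eq_or_ne (g N j) 0 with h0 | h0
      · simp [h0]
      · have : 0 < ‖g N j‖ := norm_pos_iff.2 h0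
        simp only [RCLike.ofReal_real_eq_id, id, norm_div, norm_pow, Real.norm_eq_abs,
          abs_of_pos this]
        apply le_of_eq
        field_simp
  refine ⟨fun N i => (‖g N i‖)⁻¹ • g N i, ?_, fun i => ?_⟩
  · have hne : ∀ᶠ N in atTop, ∀ i, 0 < ‖g N i‖ :=
      eventually_all.2 fun i => (gnorm i (hclose i)).eventually_const_lt one_pos
    filter_upwards [hne] with N hN
    refine ⟨fun i => ?_, fun i j hij => ?_⟩
    · rw [norm_smul, norm_inv, norm_norm, inv_mul_cancel₀ (hN i).ne']
    · change inner ℝ ((‖g N i‖)⁻¹ • g N i) ((‖g N j‖)⁻¹ • g N j) = 0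
      rw [real_inner_smul_left, real_inner_smul_right,
        InnerProductSpace.gramSchmidt_orthogonal ℝ (e N) hij]
      simp
  · have h1 : Tendsto (fun N => ‖e N i - g N i‖ + |‖g N i‖ - 1|) atTop (𝓝 0) := by
      have := (hclose i).add ((gnorm i (hclose i)).sub_const 1).abs
      simpa using this
    refine squeeze_zero (fun N => norm_nonneg _) (fun N => ?_) h1
    have e1 : e N i - (‖g N i‖)⁻¹ • g N i = (e N i - g N i) + (1 - (‖g N i‖)⁻¹) • g N i := by
      rw [sub_smul, one_smul]; abel
    rw [e1]
    refine (norm_add_le _ _).trans (add_le_add le_rfl ?_)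
    rw [norm_smul]
    rcases eq_or_ne ‖g N i‖ 0 with h0 | h0
    · simp [h0]
    · apply le_of_eq
      have hpos : 0 < ‖g N i‖ := lt_of_le_of_ne (norm_nonneg _) (Ne.symm h0)
      calc ‖1 - (‖g N i‖)⁻¹‖ * ‖g N i‖ = |1 - (‖g N i‖)⁻¹| * |‖g N i‖| := by
            rw [Real.norm_eq_abs, abs_of_pos hpos]
        _ = |‖g N i‖ - 1| := by rw [← abs_mul, sub_mul, inv_mul_cancel₀ h0, one_mul]

end GramSchmidt

section Spikes

variable {N k : ℕ}

/-- The matrix `∑ βₘ eₘ eₘ'`. -/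
def spikeSum (β : Fin k → ℝ) (e : Fin k → Fin N → ℝ) : Matrix (Fin N) (Fin N) ℝ :=
  ∑ m, β m • Matrix.vecMulVec (e m) (e m)

/-- The weights that select the first `i` spikes. -/
def firstOnes (k i : ℕ) (m : Fin k) : ℝ := if (m : ℕ) < i then 1 else 0

/-- The sum of the first `i` members of a finite sequence. -/
def partialSum (α : Fin k → ℝ) (i : ℕ) : ℝ := ∑ m, firstOnes k i m * α m

lemma spikeSum_transpose (β : Fin k → ℝ) (e : Fin k → Fin N → ℝ) :
    (spikeSum β e).transpose = spikeSum β e := by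
  simp only [spikeSum, Matrix.transpose_sum, Matrix.transpose_smul, Matrix.transpose_vecMulVec]

lemma spikeSum_isHermitian (β : Fin k → ℝ) (e : Fin k → Fin N → ℝ) :
    (spikeSum β e).IsHermitian := by
  rw [Matrix.IsHermitian, Matrix.conjTranspose_eq_transpose_of_trivial, spikeSum_transpose]

lemma frobSq_sum_le (M : Fin k → Matrix (Fin N) (Fin N) ℝ) :
    frobSq (∑ m, M m) ≤ k * ∑ m, frobSq (M m) := by
  simp only [frobSq, Matrix.sum_apply]
  calc ∑ j, ∑ l, (∑ m, M m j l) ^ 2 ≤ ∑ j, ∑ l, (k * ∑ m, M m j l ^ 2) := by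
        gcongr with j _ l _
        simpa using sq_sum_le_card_mul_sum_sq (s := Finset.univ) (f := fun m => M m j l)
    _ = k * ∑ m, ∑ j, ∑ l, M m j l ^ 2 := by
        simp only [← Finset.mul_sum]
        congr 1
        exact (Finset.sum_congr rfl fun j _ => Finset.sum_comm).trans Finset.sum_comm

lemma frobSq_vecMulVec_sub_le (v w : EuclideanSpace ℝ (Fin N)) :
    frobSq (Matrix.vecMulVec (v : Fin N → ℝ) v - Matrix.vecMulVec (w : Fin N → ℝ) w) ≤
      2 * ‖v - w‖ ^ 2 * (‖v‖ ^ 2 + ‖w‖ ^ 2) := by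
  simp only [frobSq, Matrix.sub_apply, Matrix.vecMulVec_apply, EuclideanSpace.real_norm_sq_eq,
    PiLp.sub_apply]
  calc ∑ j, ∑ l, (v j * v l - w j * w l) ^ 2
      ≤ ∑ j, ∑ l, (2 * ((v j - w j) ^ 2 * v l ^ 2) + 2 * (w j ^ 2 * (v l - w l) ^ 2)) := by
        gcongr with j _ l _
        nlinarith [sq_nonneg ((v j - w j) * v l - w j * (v l - w l))]
    _ = _ := by
        simp only [Finset.sum_add_distrib, ← Finset.mul_sum, ← Finset.sum_mul]
        ring

/-- The trace of the product of two orthogonal projections is nonnegative. -/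
lemma trace_mul_nonneg {R S : Matrix (Fin N) (Fin N) ℝ} (hR : R.transpose = R) (hRR : R * R = R)
    (hS : S.transpose = S) (hSS : S * S = S) : 0 ≤ (R * S).trace := by
  have e : (R * S).trace = ((R * S) * (R * S).transpose).trace := by
    rw [Matrix.transpose_mul, hR, hS, ← Matrix.mul_assoc, Matrix.mul_assoc R S S, hSS,
      Matrix.trace_mul_comm (R * S) R, ← Matrix.mul_assoc, hRR]
  rw [e]
  refine Finset.sum_nonneg fun j _ => ?_
  rw [Matrix.diag_apply, Matrix.mul_apply]
  exact Finset.sum_nonneg fun l _ => mul_self_nonneg _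

lemma spikeSum_mul_spikeSum {u : Fin k → Fin N → ℝ}
    (hu : ∀ m n, u m ⬝ᵥ u n = if m = n then 1 else 0) (β γ : Fin k → ℝ) :
    spikeSum β u * spikeSum γ u = spikeSum (β * γ) u := by
  simp only [spikeSum, Finset.sum_mul_sum, Matrix.smul_mul, Matrix.mul_smul,
    Matrix.vecMulVec_mul_vecMulVec, hu]
  refine Finset.sum_congr rfl fun m _ => ?_
  rw [Finset.sum_eq_single m]
  · simp [smul_smul, mul_comm]
  · intro n _ hn
    simp [hn.symm]
  · simp

lemma trace_spikeSum {u : Fin k → Fin N → ℝ}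
    (hu : ∀ m n, u m ⬝ᵥ u n = if m = n then 1 else 0) (β : Fin k → ℝ) :
    (spikeSum β u).trace = ∑ m, β m := by
  simp [spikeSum, Matrix.trace_sum, Matrix.trace_smul, Matrix.trace_vecMulVec, hu]

lemma sum_firstOnes {i : ℕ} (hi : i ≤ k) : ∑ m, firstOnes k i m = i := by
  simp only [firstOnes]
  rw [Fin.sum_univ_eq_sum_range (fun a => if a < i then (1 : ℝ) else 0) k, ← Finset.sum_filter]
  have : (Finset.range k).filter (· < i) = Finset.range i := by
    ext a
    simp only [Finset.mem_filter, Finset.mem_range]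
    omega
  rw [this]
  simp

lemma firstOnes_mul_self (i : ℕ) : firstOnes k i * firstOnes k i = firstOnes k i := by
  ext m
  simp [firstOnes]

lemma isRankProj_spikeSum {u : Fin k → Fin N → ℝ}
    (hu : ∀ m n, u m ⬝ᵥ u n = if m = n then 1 else 0) {i : ℕ} (hi : i ≤ k) :
    IsRankProj (spikeSum (firstOnes k i) u) i where
  transpose_eq := spikeSum_transpose _ _
  mul_self := by rw [spikeSum_mul_spikeSum hu, firstOnes_mul_self]
  trace_eq := by rw [trace_spikeSum hu, sum_firstOnes hi]

lemma trace_spikeSum_mul_firstOnes {u : Fin k → Fin N → ℝ}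
    (hu : ∀ m n, u m ⬝ᵥ u n = if m = n then 1 else 0) (α : Fin k → ℝ) (i : ℕ) :
    (spikeSum α u * spikeSum (firstOnes k i) u).trace = partialSum α i := by
  rw [spikeSum_mul_spikeSum hu, trace_spikeSum hu, partialSum]
  simp [mul_comm]

lemma trace_spikeSum_mul (β : Fin k → ℝ) (u : Fin k → Fin N → ℝ) (R : Matrix (Fin N) (Fin N) ℝ) :
    (spikeSum β u * R).trace = ∑ m, β m * (Matrix.vecMulVec (u m) (u m) * R).trace := by
  simp [spikeSum, Finset.sum_mul, Matrix.trace_sum, Matrix.trace_smul]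

/-- The Ky Fan inequality for a matrix with an explicit orthonormal system of eigenvectors. -/
lemma trace_spikeSum_mul_le {u : Fin k → Fin N → ℝ}
    (hu : ∀ m n, u m ⬝ᵥ u n = if m = n then 1 else 0) {α : Fin k → ℝ} (hα : StrictAnti α)
    (hα0 : ∀ m, 0 < α m) {i : ℕ} {R : Matrix (Fin N) (Fin N) ℝ} (hR : IsRankProj R i) :
    (spikeSum α u * R).trace ≤ partialSum α i := by
  set q : Fin k → ℝ := fun m => (Matrix.vecMulVec (u m) (u m) * R).trace with hq
  have hR1 : (1 - R).transpose = 1 - R := by rw [Matrix.transpose_sub, hR.transpose_eq]; simp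
  have hR2 : (1 - R) * (1 - R) = 1 - R := by
    rw [mul_sub, sub_mul, sub_mul, hR.mul_self]; simp
  have hproj : ∀ β : Fin k → ℝ, β * β = β → 0 ≤ (spikeSum β u * R).trace ∧
      0 ≤ (spikeSum β u * (1 - R)).trace ∧ 0 ≤ ((1 - spikeSum β u) * R).trace := by
    intro β hβ
    have h1 : spikeSum β u * spikeSum β u = spikeSum β u := by rw [spikeSum_mul_spikeSum hu, hβ]
    have h2 := spikeSum_transpose β u
    refine ⟨trace_mul_nonneg h2 h1 hR.transpose_eq hR.mul_self, trace_mul_nonneg h2 h1 hR1 hR2,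
      trace_mul_nonneg ?_ ?_ hR.transpose_eq hR.mul_self⟩
    · rw [Matrix.transpose_sub, h2]; simp
    · rw [mul_sub, sub_mul, sub_mul, h1]; simp
  have hq0 : ∀ m, 0 ≤ q m ∧ q m ≤ 1 := by
    intro m
    have hs : (Pi.single m 1 : Fin k → ℝ) * Pi.single m 1 = Pi.single m 1 := by
      rw [← Pi.single_mul]; simp
    have h1 := hproj (Pi.single m 1) hs
    have e : (spikeSum (Pi.single m 1) u * R).trace = q m := by
      rw [trace_spikeSum_mul, Finset.sum_eq_single m]
      · simp [hq]
      · intro n _ hn; simp [hn]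
      · simp
    have e2 : (spikeSum (Pi.single m 1) u).trace = 1 := by
      rw [trace_spikeSum hu]; simp
    rw [mul_sub, Matrix.trace_sub, mul_one, e, e2] at h1
    exact ⟨h1.1, by linarith [h1.2.1]⟩
  have hqsum : ∑ m, q m ≤ i := by
    have h1 := (hproj 1 (by simp)).2.2
    rw [sub_mul, Matrix.trace_sub, one_mul, hR.trace_eq, trace_spikeSum_mul] at h1
    simp only [Pi.one_apply, one_mul] at h1
    linarith
  rw [trace_spikeSum_mul, partialSum]
  rcases lt_or_ge i k with hik | hik
  · set c := α ⟨i, hik⟩ with hc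
    have hterm : ∀ m, α m * q m ≤ firstOnes k i m * α m + c * (q m - firstOnes k i m) := by
      intro m
      by_cases hm : (m : ℕ) < i
      · have : c ≤ α m := hα.antitone (by rw [Fin.le_def]; exact hm.le)
        simp only [firstOnes, hm, if_true]
        nlinarith [hq0 m]
      · have : α m ≤ c := hα.antitone (by rw [Fin.le_def]; exact not_lt.1 hm)
        simp only [firstOnes, hm, if_false]
        nlinarith [hq0 m]
    refine (Finset.sum_le_sum fun m _ => hterm m).trans ?_
    rw [Finset.sum_add_distrib, ← Finset.mul_sum, Finset.sum_sub_distrib, sum_firstOnes hik.le]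
    nlinarith [hα0 ⟨i, hik⟩]
  · refine Finset.sum_le_sum fun m _ => ?_
    have : (m : ℕ) < i := m.2.trans_le hik
    simp only [firstOnes, this, if_true, one_mul]
    exact mul_le_of_le_one_right (hα0 m).le (hq0 m).2

/-- The next member of the sequence, or `0` after its end. -/
def extendZero (α : Fin k → ℝ) (i : ℕ) : ℝ := if h : i < k then α ⟨i, h⟩ else 0

lemma partialSum_succ (α : Fin k → ℝ) (i : ℕ) :
    partialSum α (i + 1) = partialSum α i + extendZero α i := by
  have h1 : ∀ m : Fin k, firstOnes k (i + 1) m * α m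
      = firstOnes k i m * α m + if (m : ℕ) = i then α m else 0 := by
    intro m
    unfold firstOnes
    rcases lt_trichotomy (m : ℕ) i with h | h | h
    · simp [h, h.ne, Nat.lt_succ_of_lt h]
    · simp [h]
    · simp [not_lt.2 h.le, h.ne', not_lt.2 (Nat.succ_le_of_lt h)]
  simp only [partialSum, h1, Finset.sum_add_distrib]
  congr 1
  unfold extendZero
  split_ifs with h
  · rw [Finset.sum_eq_single ⟨i, h⟩]
    · simp
    · intro m _ hm
      rw [if_neg fun h' => hm (Fin.ext h')]
    · simp
  · refine Finset.sum_eq_zero fun m _ => ?_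
    rw [if_neg]
    have := m.2
    omega

/-- A matrix close to a spike matrix with orthonormal spikes has nearly the same top eigenvalues
and top spectral projections. -/
lemma topSum_spikeSum_of_near {e u : Fin k → Fin N → ℝ}
    (hu : ∀ m n, u m ⬝ᵥ u n = if m = n then 1 else 0) {α : Fin k → ℝ} (hα : StrictAnti α)
    (hα0 : ∀ m, 0 < α m) {t : ℝ} (ht : 0 ≤ t)
    (hnear : frobSq (spikeSum α e - spikeSum α u) * (k + 1) ≤ t ^ 2) {i : ℕ} (hiN : i ≤ N)
    (hi : i ≤ k + 1) :
    topSum (spikeSum_isHermitian α e) i ≤ partialSum α i + t ∧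
      (i ≤ k → partialSum α i - t ≤ (spikeSum α e * spikeSum (firstOnes k i) u).trace) ∧
      (i ≤ k → partialSum α i - t ≤ topSum (spikeSum_isHermitian α e) i) := by
  have hdiff : ∀ R, IsRankProj R i →
      |(spikeSum α e * R).trace - (spikeSum α u * R).trace| ≤ t := by
    intro R hR
    rw [← Matrix.trace_sub, ← sub_mul]
    refine abs_le_of_sq_le_sq ?_ ht
    refine (sq_trace_mul_le _ _ hR.transpose_eq).trans (le_trans ?_ hnear)
    rw [hR.frobSq_eq]
    refine mul_le_mul_of_nonneg_left ?_ (frobSq_nonneg _)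
    exact_mod_cast hi
  have h2 : i ≤ k → partialSum α i - t ≤ (spikeSum α e * spikeSum (firstOnes k i) u).trace := by
    intro hik
    have := abs_le.1 (hdiff _ (isRankProj_spikeSum hu hik))
    rw [trace_spikeSum_mul_firstOnes hu] at this
    linarith
  refine ⟨?_, h2, fun hik => (h2 hik).trans
    ((isRankProj_spikeSum hu hik).trace_mul_le_topSum hiN _)⟩
  obtain ⟨P, hP, hPM, -⟩ := exists_topProj (spikeSum_isHermitian α e) hiN
  rw [← hPM]
  have h3 := abs_le.1 (hdiff P hP)
  have h4 := trace_spikeSum_mul_le hu hα hα0 hP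
  linarith

/-- Spike matrices depend continuously on their spikes near unit vectors, uniformly in the
dimension. -/
lemma tendsto_frobSq_spikeSum_sub {e u : ∀ N, Fin k → EuclideanSpace ℝ (Fin N)}
    (hu : ∀ᶠ N in atTop, Orthonormal ℝ (u N))
    (hnear : ∀ m, Tendsto (fun N => ‖e N m - u N m‖) atTop (𝓝 0)) (β : Fin k → ℝ) :
    Tendsto (fun N => frobSq (spikeSum β (fun m => (e N m : Fin N → ℝ)) -
      spikeSum β (fun m => (u N m : Fin N → ℝ)))) atTop (𝓝 0) := by
  have hb : Tendsto (fun N : ℕ => (k : ℝ) * ∑ m, β m ^ 2 *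
      (2 * ‖e N m - u N m‖ ^ 2 * ((1 + ‖e N m - u N m‖) ^ 2 + 1 ^ 2))) atTop (𝓝 0) := by
    have : ∀ m, Tendsto (fun N => β m ^ 2 *
      (2 * ‖e N m - u N m‖ ^ 2 * ((1 + ‖e N m - u N m‖) ^ 2 + 1 ^ 2))) atTop (𝓝 0) := by
      intro m
      have h1 := (((hnear m).pow 2).const_mul 2).mul
        ((((hnear m).const_add 1).pow 2).add_const (1 ^ 2))
      have h2 := h1.const_mul (β m ^ 2)
      simpa using h2
    have h3 := (tendsto_finsetSum Finset.univ fun m _ => this m).const_mul (k : ℝ)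
    simp only [Finset.sum_const_zero, mul_zero] at h3
    exact h3
  refine squeeze_zero' (Eventually.of_forall fun N => frobSq_nonneg _) ?_ hb
  filter_upwards [hu] with N hN
  rw [spikeSum, spikeSum, ← Finset.sum_sub_distrib]
  refine (frobSq_sum_le _).trans ?_
  gcongr with m
  rw [← smul_sub, frobSq_smul]
  gcongr
  refine (frobSq_vecMulVec_sub_le _ _).trans ?_
  have h1 : ‖u N m‖ = 1 := hN.1 m
  have h2 : ‖e N m‖ ≤ 1 + ‖e N m - u N m‖ := by
    have := norm_sub_norm_le (e N m) (u N m)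
    linarith
  rw [h1]
  gcongr

/-- The spectrum of a spike matrix with asymptotically orthonormal spikes: the top spectral
projections converge and stay separated from the rest of the spectrum. -/
theorem spikeSum_spectrum {e : ∀ N, Fin k → EuclideanSpace ℝ (Fin N)}
    (he : ∀ i j, Tendsto (fun N => inner ℝ (e N i) (e N j)) atTop (𝓝 (if i = j then 1 else 0)))
    {α : Fin k → ℝ} (hα : StrictAnti α) (hα0 : ∀ m, 0 < α m) {i : ℕ} (hik : i ≤ k) :
    Tendsto (fun N => topSum (spikeSum_isHermitian α fun m => (e N m : Fin N → ℝ)) i) atTop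
      (𝓝 (partialSum α i)) ∧
    (1 ≤ i → ∃ κ > 0, ∀ ε > 0, ∀ᶠ N in atTop, ∃ Q : Matrix (Fin N) (Fin N) ℝ, IsRankProj Q i ∧
      (∀ R, IsRankProj R i → (spikeSum α (fun m => (e N m : Fin N → ℝ)) * R).trace +
        κ / 2 * frobSq (Q - R) ≤ (spikeSum α (fun m => (e N m : Fin N → ℝ)) * Q).trace) ∧
      frobSq (Q - spikeSum (firstOnes k i) (fun m => (e N m : Fin N → ℝ))) ≤ ε) := by
  obtain ⟨u, hu, hnear⟩ := exists_orthonormal_near e he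
  have hT := (tendsto_frobSq_spikeSum_sub hu hnear α).mul_const ((k : ℝ) + 1)
  rw [zero_mul] at hT
  have hE := tendsto_frobSq_spikeSum_sub hu hnear (firstOnes k i)
  have hdot : ∀ N, Orthonormal ℝ (u N) → ∀ m n,
      (u N m : Fin N → ℝ) ⬝ᵥ (u N n : Fin N → ℝ) = if m = n then 1 else 0 := by
    intro N hN m n
    rw [← orthonormal_iff_ite.1 hN m n, PiLp.inner_apply, dotProduct]
    simp [mul_comm]
  constructor
  · rw [Metric.tendsto_nhds]
    intro ε hε
    filter_upwards [hu, hT.eventually_le_const (show (0 : ℝ) < (ε / 2) ^ 2 by positivity),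
      eventually_ge_atTop (k + 1)] with N hN hTN hkN
    have h1 := topSum_spikeSum_of_near (hdot N hN) hα hα0 (by positivity) hTN
      (show i ≤ N by omega) (by omega)
    rw [Real.dist_eq]
    have h2 := h1.2.2 hik
    exact (abs_le.2 ⟨by linarith, by linarith [h1.1]⟩ : _ ≤ ε / 2).trans_lt (by linarith)
  · intro hi1
    obtain ⟨i', rfl⟩ : ∃ i', i = i' + 1 := ⟨i - 1, by omega⟩
    set γ := extendZero α i' - extendZero α (i' + 1) with hγ
    have hγ0 : 0 < γ := by
      have hi'k : i' < k := by omega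
      simp only [hγ, extendZero, hi'k, dif_pos]
      split_ifs with h
      · have : α ⟨i' + 1, h⟩ < α ⟨i', hi'k⟩ := hα (by rw [Fin.lt_def]; simp)
        linarith
      · simpa using hα0 _
    -- `γ` is the gap between the limits of two consecutive eigenvalues. Each eigenvalue is a
    -- difference of two sums known up to `t`, so that half of the gap remains if `4 t ≤ γ / 2`.
    refine ⟨γ / 2, by positivity, fun ε hε => ?_⟩
    set t := min (γ / 8) (ε * γ / 32) with ht
    have ht0 : 0 < t := lt_min (by positivity) (by positivity)
    have ht1 : t ≤ γ / 8 := min_le_left _ _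
    have ht2 : t ≤ ε * γ / 32 := min_le_right _ _
    filter_upwards [hu, hT.eventually_le_const (show (0 : ℝ) < t ^ 2 by positivity),
      eventually_ge_atTop (k + 2), hE.eventually_le_const (show (0 : ℝ) < ε / 4 by positivity)]
      with N hN hTN hkN hEN
    set T := spikeSum α (fun m => (e N m : Fin N → ℝ)) with hTdef
    have hTh : T.IsHermitian := spikeSum_isHermitian α _
    have near := fun (j : ℕ) (hj : j ≤ k + 1) =>
      topSum_spikeSum_of_near (hdot N hN) hα hα0 ht0.le hTN (show j ≤ N by omega) hj
    obtain ⟨Q, hQ, hQT, hgap⟩ := exists_topProj hTh (show i' + 1 ≤ N by omega)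
    have hgap' : ∀ R, IsRankProj R (i' + 1) →
        (T * R).trace + γ / 2 / 2 * frobSq (Q - R) ≤ topSum hTh (i' + 1) := by
      intro R hR
      have h1 := hgap R hR (orderedEigenvalue hTh i') (orderedEigenvalue hTh (i' + 1))
        (fun a ha => orderedEigenvalue_antitone hTh (by omega) (by omega))
        (fun a ha haN => orderedEigenvalue_antitone hTh ha haN)
      have h2 : γ / 2 ≤ orderedEigenvalue hTh i' - orderedEigenvalue hTh (i' + 1) := by
        rw [orderedEigenvalue_eq_sub, orderedEigenvalue_eq_sub]
        have n0 := (near i' (by omega)).1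
        have n1 := (near (i' + 1) (by omega)).2.2 hik
        have n2 := (near (i' + 1 + 1) (by omega)).1
        rw [partialSum_succ, partialSum_succ] at n2
        rw [partialSum_succ] at n1
        linarith
      refine le_trans ?_ h1
      have := frobSq_nonneg (Q - R)
      gcongr
    refine ⟨Q, hQ, fun R hR => by rw [hQT]; exact hgap' R hR, ?_⟩
    -- the projection on the orthonormal spikes nearly attains the maximum, so it is near `Q`
    have h3 := hgap' _ (isRankProj_spikeSum (hdot N hN) hik)
    have n1 := near (i' + 1) (by omega)
    have h4 : γ / 2 / 2 *
        frobSq (Q - spikeSum (firstOnes k (i' + 1)) (fun m => (u N m : Fin N → ℝ))) ≤ 2 * t := by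
      linarith [n1.1, n1.2.1 hik]
    have h5 : frobSq (Q - spikeSum (firstOnes k (i' + 1)) (fun m => (u N m : Fin N → ℝ)))
        ≤ ε / 4 := by
      by_contra! hc
      have := mul_lt_mul_of_pos_left hc (show 0 < γ / 2 / 2 by positivity)
      linarith
    have h6 : Q - spikeSum (firstOnes k (i' + 1)) (fun m => (e N m : Fin N → ℝ)) =
        (Q - spikeSum (firstOnes k (i' + 1)) (fun m => (u N m : Fin N → ℝ))) +
        -(spikeSum (firstOnes k (i' + 1)) (fun m => (e N m : Fin N → ℝ)) -
          spikeSum (firstOnes k (i' + 1)) (fun m => (u N m : Fin N → ℝ))) := by abel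
    rw [h6]
    refine (frobSq_add_le _ _).trans ?_
    rw [frobSq_neg]
    linarith

end Spikes

/-! ### Gaussian limits of linear forms -/

section CLT

lemma norm_exp_mul_I_sub_le (s : ℝ) :
    ‖Complex.exp (s * Complex.I) - (1 + s * Complex.I - s ^ 2 / 2)‖ ≤ 4 * |s| ^ 3 := by
  rcases le_or_gt |s| 1 with h | h
  · have h1 := Complex.norm_exp_sub_sum_le_norm_mul_exp (s * Complex.I) 3
    have e : ∑ m ∈ Finset.range 3, (s * Complex.I) ^ m / (m.factorial : ℂ)
        = 1 + s * Complex.I - s ^ 2 / 2 := by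
      simp [Finset.sum_range_succ, mul_pow, Nat.factorial]
      ring
    rw [e] at h1
    simp only [norm_mul, Complex.norm_I, mul_one, Complex.norm_real, Real.norm_eq_abs] at h1
    refine h1.trans ?_
    have : Real.exp |s| ≤ 4 := (Real.exp_le_exp.2 h).trans (by linarith [Real.exp_one_lt_d9])
    nlinarith [pow_nonneg (abs_nonneg s) 3]
  · have h1 : ‖Complex.exp (s * Complex.I) - (1 + s * Complex.I - s ^ 2 / 2)‖
        ≤ 1 + (1 + |s| + |s| ^ 2 / 2) := by
      refine (norm_sub_le _ _).trans (add_le_add (Complex.norm_exp_ofReal_mul_I s).le ?_)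
      refine (norm_sub_le _ _).trans (add_le_add ((norm_add_le _ _).trans ?_) ?_)
      · simp
      · simp
    refine h1.trans ?_
    have h2 : |s| ≤ |s| ^ 3 := le_self_pow₀ h.le (by norm_num)
    have h3 : |s| ^ 2 ≤ |s| ^ 3 := pow_le_pow_right₀ h.le (by norm_num)
    linarith

lemma abs_exp_neg_sub_le {a : ℝ} (ha : 0 ≤ a) : |Real.exp (-a) - (1 - a)| ≤ a ^ 2 := by
  rcases le_or_gt a 1 with h | h
  · have := Real.abs_exp_sub_one_sub_id_le (x := -a) (by rwa [abs_neg, abs_of_nonneg ha])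
    rw [neg_sq] at this
    rwa [show Real.exp (-a) - (1 - a) = Real.exp (-a) - 1 - -a by ring]
  · have h1 := Real.one_sub_le_exp_neg a
    have h2 : Real.exp (-a) ≤ 1 := Real.exp_le_one_iff.2 (by linarith)
    rw [abs_of_nonneg (by linarith)]
    nlinarith

/-- Second-order expansion of the characteristic function of a centered variable, compared with that
of a centered Gaussian variable of the same variance. -/
lemma norm_integral_exp_sub_le (ν : Measure ℝ) [IsProbabilityMeasure ν] {v M : ℝ}
    (h3 : MemLp (fun t => t) 3 ν) (h0 : ∫ t, t ∂ν = 0) (hv : ∫ t, t ^ 2 ∂ν = v)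
    (hM : ∫ t, |t| ^ 3 ∂ν ≤ M) (c : ℝ) :
    ‖∫ t, Complex.exp ((c * t : ℝ) * Complex.I) ∂ν - Real.exp (-(c ^ 2 * v / 2))‖ ≤
      4 * |c| ^ 3 * M + c ^ 4 * v ^ 2 := by
  have i1 : Integrable (fun t : ℝ => t) ν := h3.integrable (by norm_num)
  have i2 : Integrable (fun t : ℝ => t ^ 2) ν :=
    (h3.mono_exponent (by norm_num : (2 : ENNReal) ≤ 3)).integrable_sq
  have i3 : Integrable (fun t : ℝ => |t| ^ 3) ν := h3.integrable_norm_pow (p := 3) (by norm_num)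
  have iexp : Integrable (fun t : ℝ => Complex.exp ((c * t : ℝ) * Complex.I)) ν := by
    refine Integrable.of_bound (by fun_prop) 1 (ae_of_all _ fun t => ?_)
    exact (Complex.norm_exp_ofReal_mul_I _).le
  have ipol1 : Integrable (fun t : ℝ => 1 + (((c * t : ℝ) : ℂ)) * Complex.I) ν :=
    (integrable_const _).add ((i1.const_mul c).ofReal.mul_const _)
  have ipol2 : Integrable (fun t : ℝ => (((c * t : ℝ) : ℂ)) ^ 2 / 2) ν := by
    have := ((i2.const_mul (c ^ 2)).ofReal (𝕜 := ℂ)).div_const 2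
    refine this.congr (ae_of_all _ fun t => ?_)
    change ((c ^ 2 * t ^ 2 : ℝ) : ℂ) / 2 = _
    push_cast
    ring
  have ipol : Integrable (fun t : ℝ => 1 + (((c * t : ℝ) : ℂ)) * Complex.I -
      (((c * t : ℝ) : ℂ)) ^ 2 / 2) ν := ipol1.sub ipol2
  have epol : ∫ t, (1 + (((c * t : ℝ) : ℂ)) * Complex.I - (((c * t : ℝ) : ℂ)) ^ 2 / 2) ∂ν
      = ((1 - c ^ 2 * v / 2 : ℝ) : ℂ) := by
    rw [integral_sub ipol1 ipol2,
      integral_add (integrable_const _) ((i1.const_mul c).ofReal.mul_const _),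
      integral_mul_const, integral_div]
    have e1 : ∫ t, ((c * t : ℝ) : ℂ) ∂ν = 0 := by
      rw [integral_complex_ofReal, integral_const_mul, h0]; simp
    have e2 : ∫ t, ((c * t : ℝ) : ℂ) ^ 2 ∂ν = ((c ^ 2 * v : ℝ) : ℂ) := by
      rw [← hv, ← integral_const_mul, ← integral_complex_ofReal]
      refine integral_congr_ae (ae_of_all _ fun t => ?_)
      push_cast
      ring
    rw [e1, e2]
    simp
  have hA : ‖∫ t, Complex.exp ((c * t : ℝ) * Complex.I) ∂ν - ((1 - c ^ 2 * v / 2 : ℝ) : ℂ)‖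
      ≤ 4 * |c| ^ 3 * M := by
    rw [← epol, ← integral_sub iexp ipol]
    refine (norm_integral_le_integral_norm _).trans ?_
    calc _ ≤ ∫ t, 4 * |c| ^ 3 * |t| ^ 3 ∂ν := by
          refine integral_mono (iexp.sub ipol).norm (i3.const_mul _) fun t => ?_
          refine (norm_exp_mul_I_sub_le (c * t)).trans (le_of_eq ?_)
          rw [abs_mul, mul_pow]
          ring
      _ = 4 * |c| ^ 3 * ∫ t, |t| ^ 3 ∂ν := integral_const_mul _ _
      _ ≤ _ := by gcongr
  have hv0 : 0 ≤ v := hv ▸ integral_nonneg fun t => sq_nonneg t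
  have hB : ‖((1 - c ^ 2 * v / 2 : ℝ) : ℂ) - Real.exp (-(c ^ 2 * v / 2))‖ ≤ c ^ 4 * v ^ 2 := by
    rw [← Complex.ofReal_sub, Complex.norm_real, Real.norm_eq_abs, abs_sub_comm]
    refine (abs_exp_neg_sub_le (by positivity)).trans ?_
    nlinarith [mul_nonneg (pow_nonneg (sq_nonneg c) 2) (sq_nonneg v)]
  calc _ ≤ _ := norm_sub_le_norm_sub_add_norm_sub _ ((1 - c ^ 2 * v / 2 : ℝ) : ℂ) _
    _ ≤ _ := add_le_add hA hB

lemma norm_prod_sub_prod_le {ι : Type*} (s : Finset ι) (a b : ι → ℂ) (ha : ∀ i, ‖a i‖ ≤ 1)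
    (hb : ∀ i, ‖b i‖ ≤ 1) : ‖∏ i ∈ s, a i - ∏ i ∈ s, b i‖ ≤ ∑ i ∈ s, ‖a i - b i‖ := by
  classical
  induction s using Finset.induction_on with
  | empty => simp
  | insert i s hi ih =>
    rw [Finset.prod_insert hi, Finset.prod_insert hi, Finset.sum_insert hi]
    have e : a i * ∏ j ∈ s, a j - b i * ∏ j ∈ s, b j
        = (a i - b i) * ∏ j ∈ s, a j + b i * (∏ j ∈ s, a j - ∏ j ∈ s, b j) := by ring
    rw [e]
    refine (norm_add_le _ _).trans (add_le_add ?_ ?_)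
    · rw [norm_mul]
      refine mul_le_of_le_one_right (norm_nonneg _) ?_
      rw [norm_prod]
      exact Finset.prod_le_one (fun _ _ => norm_nonneg _) fun j _ => ha j
    · rw [norm_mul]
      exact (mul_le_of_le_one_left (norm_nonneg _) (hb i)).trans ih

/-- A quantitative central limit theorem for linear forms in independent centered variables. -/
lemma norm_integral_exp_sum_sub_le {ι : Type*} [Fintype ι] (μ : ι → Measure ℝ)
    [∀ i, IsProbabilityMeasure (μ i)] {M V : ℝ} (v : ι → ℝ)
    (h3 : ∀ i, MemLp (fun t => t) 3 (μ i)) (h0 : ∀ i, ∫ t, t ∂(μ i) = 0)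
    (hv : ∀ i, ∫ t, t ^ 2 ∂(μ i) = v i) (hV : ∀ i, v i ≤ V)
    (hM : ∀ i, ∫ t, |t| ^ 3 ∂(μ i) ≤ M) (c : ι → ℝ) {C : ℝ} (hc : ∀ i, |c i| ≤ C) :
    ‖∫ x, Complex.exp ((∑ i, c i * x i : ℝ) * Complex.I) ∂(Measure.pi μ) -
      Real.exp (-(∑ i, c i ^ 2 * v i) / 2)‖ ≤
      Fintype.card ι * (4 * C ^ 3 * M + C ^ 4 * V ^ 2) := by
  have e1 : ∫ x, Complex.exp ((∑ i, c i * x i : ℝ) * Complex.I) ∂(Measure.pi μ) =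
      ∏ i, ∫ t, Complex.exp ((c i * t : ℝ) * Complex.I) ∂(μ i) := by
    rw [← integral_fintype_prod_eq_prod (fun i t => Complex.exp ((c i * t : ℝ) * Complex.I))]
    refine integral_congr_ae (ae_of_all _ fun x => ?_)
    dsimp only
    rw [← Complex.exp_sum]
    push_cast
    rw [Finset.sum_mul]
  have e2 : ((Real.exp (-(∑ i, c i ^ 2 * v i) / 2) : ℝ) : ℂ) =
      ∏ i, ((Real.exp (-(c i ^ 2 * v i / 2)) : ℝ) : ℂ) := by
    rw [← Complex.ofReal_prod, ← Real.exp_sum]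
    congr 2
    rw [Finset.sum_neg_distrib, ← Finset.sum_div, neg_div]
  have hv0 : ∀ i, 0 ≤ v i := fun i => hv i ▸ integral_nonneg fun t => sq_nonneg t
  rw [e1, e2]
  refine (norm_prod_sub_prod_le _ _ _ (fun i => ?_) fun i => ?_).trans ?_
  · refine (norm_integral_le_integral_norm _).trans ?_
    simp only [Complex.norm_exp_ofReal_mul_I]
    simp
  · rw [Complex.norm_real, Real.norm_of_nonneg (Real.exp_pos _).le, Real.exp_le_one_iff]
    have := hv0 i
    have : 0 ≤ c i ^ 2 * v i / 2 := by positivity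
    linarith
  · rw [← nsmul_eq_mul, ← Finset.card_univ, ← Finset.sum_const]
    refine Finset.sum_le_sum fun i _ => ?_
    refine (norm_integral_exp_sub_le (μ i) (h3 i) (h0 i) (hv i) (hM i) (c i)).trans ?_
    have hM0 : 0 ≤ M := (integral_nonneg fun t => by positivity).trans (hM i)
    have h4 : c i ^ 4 ≤ C ^ 4 := by
      rw [← Even.pow_abs (by decide : Even 4)]
      exact pow_le_pow_left₀ (abs_nonneg _) (hc i) 4
    have := hv0 i
    gcongr
    · exact hc i
    · exact hV i

end CLT

/-! ### Riemann sums -/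

/-- The half-open cell of side `1 / N` of the unit cube whose upper corner is
`((j i + 1) / N)_i`. -/
def cell {d N : ℕ} (j : Fin d → Fin N) : Set (Fin d → ℝ) :=
  Set.univ.pi fun i => Set.Ioc ((j i : ℝ) / N) (gridPoint (j i))

/-- The upper corner of `cell j`. -/
noncomputable def corner {d N : ℕ} (j : Fin d → Fin N) : Fin d → ℝ := fun i => gridPoint (j i)

/-- The mean over the cells of mesh `1 / N` of the oscillation of `g` tends to `0`; for a bounded
function this is Darboux's criterion for Riemann integrability. -/
def SmallOscillation {d : ℕ} (g : (Fin d → ℝ) → ℝ) : Prop :=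
  ∀ ε > 0, ∀ᶠ N : ℕ in atTop, ∀ s : (Fin d → Fin N) → Fin d → ℝ, (∀ j, s j ∈ cell j) →
    ∑ j, |g (s j) - g (corner j)| ≤ ε * (N : ℝ) ^ d

lemma mem_cell {d N : ℕ} {j : Fin d → Fin N} {x : Fin d → ℝ} :
    x ∈ cell j ↔ ∀ i, (j i : ℝ) / N < x i ∧ x i ≤ gridPoint (j i) := by
  simp [cell, Set.mem_pi]

lemma cell_eq_box {d N : ℕ} [NeZero N] (j : Fin d → Fin N) :
    cell j = (BoxIntegral.unitPartition.box N (fun i => ((j i : ℕ) : ℤ)) : Set (Fin d → ℝ)) := by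
  ext x
  rw [mem_cell, BoxIntegral.Box.mem_coe, BoxIntegral.unitPartition.mem_box_iff]
  simp [gridPoint]

lemma corner_mem_cell {d N : ℕ} [NeZero N] (j : Fin d → Fin N) : corner j ∈ cell j := by
  rw [mem_cell]
  intro i
  have : (0 : ℝ) < N := Nat.cast_pos.2 (NeZero.pos N)
  exact ⟨by rw [corner, gridPoint]; gcongr; linarith, le_rfl⟩

lemma box_le_unitCube_iff {d N : ℕ} [NeZero N] {ν : Fin d → ℤ} :
    BoxIntegral.unitPartition.box N ν ≤ unitCube d ↔
      ∃ j : Fin d → Fin N, (fun i => ((j i : ℕ) : ℤ)) = ν := by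
  have hN : (0 : ℝ) < N := Nat.cast_pos.2 (NeZero.pos N)
  rw [BoxIntegral.Box.le_iff_bounds]
  simp only [BoxIntegral.unitPartition.box_lower, BoxIntegral.unitPartition.box_upper, Pi.le_def,
    unitCube]
  constructor
  · rintro ⟨h0, h1⟩
    have h0' : ∀ i, 0 ≤ ν i := fun i => by
      have := h0 i
      rw [le_div_iff₀ hN, zero_mul] at this
      exact_mod_cast this
    have h1' : ∀ i, ν i + 1 ≤ N := fun i => by
      have := h1 i
      rw [div_le_iff₀ hN, one_mul] at this
      exact_mod_cast this
    refine ⟨fun i => ⟨(ν i).toNat, by have := h0' i; have := h1' i; omega⟩, ?_⟩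
    ext i
    simpa using h0' i
  · rintro ⟨j, rfl⟩
    refine ⟨fun i => by positivity, fun i => ?_⟩
    rw [div_le_iff₀ hN, one_mul]
    have := (j i).2
    push_cast
    exact_mod_cast this

lemma hasIntegralVertices_unitCube (d : ℕ) : BoxIntegral.hasIntegralVertices (unitCube d) :=
  ⟨fun _ => 0, fun _ => 1, by simp [unitCube], by simp [unitCube]⟩

lemma iUnion_cell {d N : ℕ} [NeZero N] :
    ⋃ j : Fin d → Fin N, cell j = (unitCube d : Set (Fin d → ℝ)) := by
  ext x
  simp only [Set.mem_iUnion, cell_eq_box]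
  constructor
  · rintro ⟨j, hj⟩
    exact box_le_unitCube_iff.2 ⟨j, rfl⟩ hj
  · intro hx
    have h := BoxIntegral.unitPartition.mem_admissibleIndex_of_mem_box N
      (hasIntegralVertices_unitCube d) hx
    rw [BoxIntegral.unitPartition.mem_admissibleIndex_iff, box_le_unitCube_iff] at h
    obtain ⟨j, hj⟩ := h
    exact ⟨j, BoxIntegral.unitPartition.mem_box_iff_index.2 hj.symm⟩

lemma natCast_fin_injective (d N : ℕ) :
    Function.Injective (fun (j : Fin d → Fin N) (i : Fin d) => ((j i : ℕ) : ℤ)) := by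
  intro a b hab
  funext i
  have := congrFun hab i
  exact Fin.ext (by simpa using this)

lemma disjoint_cell {d N : ℕ} [NeZero N] {j j' : Fin d → Fin N} (h : j ≠ j') :
    Disjoint (cell j) (cell j') := by
  rw [cell_eq_box, cell_eq_box]
  exact BoxIntegral.unitPartition.disjoint.1 fun h' => h (natCast_fin_injective d N h')

lemma volume_cell {d N : ℕ} [NeZero N] (j : Fin d → Fin N) :
    volume.real (cell j) = 1 / (N : ℝ) ^ d := by
  rw [cell_eq_box, Measure.real, BoxIntegral.unitPartition.volume_box]
  simp

lemma measurableSet_cell {d N : ℕ} (j : Fin d → Fin N) : MeasurableSet (cell j) :=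
  MeasurableSet.univ_pi fun _ => measurableSet_Ioc

/-- The Riemann sum with tags `τ j ∈ cell j`, as an integral sum of the box-integration theory. -/
lemma exists_taggedPrepartition {d N : ℕ} [NeZero N] {τ : (Fin d → Fin N) → Fin d → ℝ}
    (hτ : ∀ j, τ j ∈ cell j) :
    ∃ π : BoxIntegral.TaggedPrepartition (unitCube d), π.IsPartition ∧ π.IsHenstock ∧
      (∀ r : ℝ, ∀ hr : 0 < r, 1 / N ≤ r → π.IsSubordinate fun _ => ⟨r, hr⟩) ∧
      ∀ g : (Fin d → ℝ) → ℝ,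
        BoxIntegral.integralSum g BoxIntegral.BoxAdditiveMap.volume π =
          (∑ j, g (τ j)) / (N : ℝ) ^ d := by
  classical
  set b : (Fin d → Fin N) → BoxIntegral.Box (Fin d) :=
    fun j => BoxIntegral.unitPartition.box N (fun i => ((j i : ℕ) : ℤ)) with hb
  have hbinj : Function.Injective b := fun x y hxy =>
    natCast_fin_injective d N (BoxIntegral.unitPartition.box_injective N hxy)
  have hcb : ∀ j, cell j = (b j : Set (Fin d → ℝ)) := fun j => cell_eq_box j
  have hble : ∀ j, b j ≤ unitCube d := fun j => box_le_unitCube_iff.2 ⟨j, rfl⟩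
  have hτb : ∀ j, τ j ∈ b j := fun j => by
    have := hτ j
    rwa [hcb] at this
  let π : BoxIntegral.TaggedPrepartition (unitCube d) :=
    { toPrepartition :=
        (BoxIntegral.unitPartition.prepartition N (unitCube d)).toPrepartition
      tag := fun I => if h : ∃ j, b j = I then τ h.choose else (unitCube d).upper
      tag_mem_Icc := fun I => by
        split_ifs with h
        · exact BoxIntegral.Box.coe_subset_Icc (hble _ (hτb _))
        · exact BoxIntegral.Box.coe_subset_Icc (unitCube d).upper_mem }
  have htag : ∀ j, π.tag (b j) = τ j := by
    intro j
    have h : ∃ j', b j' = b j := ⟨j, rfl⟩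
    change (if h : ∃ j', b j' = b j then τ h.choose else (unitCube d).upper) = τ j
    rw [dif_pos h]
    congr 1
    exact hbinj h.choose_spec
  have hboxes : π.boxes = Finset.univ.image b := by
    ext I
    change I ∈ (BoxIntegral.unitPartition.prepartition N (unitCube d)).boxes ↔ _
    rw [BoxIntegral.unitPartition.mem_prepartition_boxes_iff]
    simp only [Finset.mem_image, Finset.mem_univ, true_and,
      BoxIntegral.unitPartition.mem_admissibleIndex_iff, box_le_unitCube_iff]
    constructor
    · rintro ⟨ν, ⟨j, rfl⟩, rfl⟩
      exact ⟨j, rfl⟩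
    · rintro ⟨j, rfl⟩
      exact ⟨_, ⟨j, rfl⟩, rfl⟩
  have hmem : ∀ J ∈ π, ∃ j, b j = J := fun J hJ => by
    have : J ∈ π.boxes := hJ
    rw [hboxes] at this
    simpa using this
  refine ⟨π, ?_, ?_, ?_, ?_⟩
  · exact BoxIntegral.unitPartition.prepartition_isPartition N (hasIntegralVertices_unitCube d)
  · intro J hJ
    obtain ⟨j, rfl⟩ := hmem J hJ
    rw [htag]
    exact BoxIntegral.Box.coe_subset_Icc (hτb j)
  · intro r hr hrN J hJ
    obtain ⟨j, rfl⟩ := hmem J hJ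
    intro x hx
    rw [htag]
    exact (Metric.dist_le_diam_of_mem (BoxIntegral.Box.isBounded_Icc _) hx
      (BoxIntegral.Box.coe_subset_Icc (hτb j))).trans
        ((BoxIntegral.unitPartition.diam_boxIcc N _).trans hrN)
  · intro g
    rw [BoxIntegral.integralSum, hboxes, Finset.sum_image fun x _ y _ h => hbinj h,
      Finset.sum_div]
    refine Finset.sum_congr rfl fun j _ => ?_
    rw [htag, BoxIntegral.BoxAdditiveMap.volume_apply, ← BoxIntegral.Box.volume_apply,
      Measure.toBoxAdditive_apply, ← hcb, volume_cell]
    simp [div_eq_inv_mul]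

/-- Comparing two families of tags, chosen in each cell according to the sign of the difference,
turns the Cauchy criterion for Riemann sums into a bound for the mean oscillation. -/
theorem RiemannIntegrableOnCube.smallOscillation {d : ℕ} {g : (Fin d → ℝ) → ℝ}
    (hg : RiemannIntegrableOnCube g) : SmallOscillation g := by
  classical
  intro ε hε
  obtain ⟨r, hr, H⟩ := BoxIntegral.integrable_iff_cauchy_basis.1 hg ε hε
  have hr0 : (0 : ℝ) < r 0 0 := (r 0 0).2
  have hlim : ∀ᶠ N : ℕ in atTop, 1 / (N : ℝ) ≤ r 0 0 :=
    (tendsto_one_div_atTop_nhds_zero_nat (𝕜 := ℝ)).eventually_le_const hr0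
  filter_upwards [hlim, eventually_ne_atTop 0] with N hN hN0 s hs
  have : NeZero N := ⟨hN0⟩
  set τ₁ : (Fin d → Fin N) → Fin d → ℝ :=
    fun j => if g (corner j) ≤ g (s j) then s j else corner j
  set τ₂ : (Fin d → Fin N) → Fin d → ℝ :=
    fun j => if g (corner j) ≤ g (s j) then corner j else s j
  have hτ₁ : ∀ j, τ₁ j ∈ cell j := fun j => by
    simp only [τ₁]; split_ifs; exacts [hs j, corner_mem_cell j]
  have hτ₂ : ∀ j, τ₂ j ∈ cell j := fun j => by
    simp only [τ₂]; split_ifs; exacts [corner_mem_cell j, hs j]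
  obtain ⟨π₁, p₁, q₁, r₁, s₁⟩ := exists_taggedPrepartition hτ₁
  obtain ⟨π₂, p₂, q₂, r₂, s₂⟩ := exists_taggedPrepartition hτ₂
  have hconst : r 0 = fun _ => ⟨r 0 0, hr0⟩ := by
    funext x
    exact (hr 0) rfl x
  have hbase : ∀ π : BoxIntegral.TaggedPrepartition (unitCube d), π.IsHenstock →
      (∀ r : ℝ, ∀ hr : 0 < r, 1 / N ≤ r → π.IsSubordinate fun _ => ⟨r, hr⟩) →
      BoxIntegral.IntegrationParams.Riemann.MemBaseSet (unitCube d) 0 (r 0) π := by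
    intro π hq hs
    refine ⟨?_, fun _ => hq, fun h => ?_, fun h => ?_⟩
    · rw [hconst]
      exact hs _ hr0 hN
    · simp [BoxIntegral.IntegrationParams.Riemann] at h
    · simp [BoxIntegral.IntegrationParams.Riemann] at h
  have h := H 0 0 π₁ π₂ (hbase π₁ q₁ r₁) p₁ (hbase π₂ q₂ r₂) p₂
  rw [s₁, s₂, Real.dist_eq, ← sub_div, ← Finset.sum_sub_distrib, abs_div,
    abs_of_nonneg (by positivity : (0 : ℝ) ≤ (N : ℝ) ^ d),
    div_le_iff₀ (by have := Nat.pos_of_ne_zero hN0; positivity)] at h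
  refine le_trans (le_of_eq ?_) ((le_abs_self _).trans h)
  refine Finset.sum_congr rfl fun j _ => ?_
  simp only [τ₁, τ₂]
  split_ifs with hc
  · exact abs_of_nonneg (by linarith)
  · rw [abs_of_nonpos (by linarith)]
    ring

lemma mem_Icc_of_mem_cell {d N : ℕ} [NeZero N] {j : Fin d → Fin N} {x : Fin d → ℝ}
    (hx : x ∈ cell j) (i : Fin d) : x i ∈ Set.Icc (0 : ℝ) 1 := by
  have : x ∈ (unitCube d : Set (Fin d → ℝ)) := by
    rw [← iUnion_cell (N := N)]
    exact Set.mem_iUnion.2 ⟨j, hx⟩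
  have h := this i
  exact ⟨h.1.le, h.2⟩

lemma SmallOscillation.mul {d : ℕ} {g g' : (Fin d → ℝ) → ℝ} {C C' : ℝ}
    (hg : SmallOscillation g) (hg' : SmallOscillation g')
    (hC : ∀ x, (∀ i, x i ∈ Set.Icc (0 : ℝ) 1) → |g x| ≤ C)
    (hC' : ∀ x, (∀ i, x i ∈ Set.Icc (0 : ℝ) 1) → |g' x| ≤ C') :
    SmallOscillation fun x => g x * g' x := by
  intro ε hε
  have hC0 : 0 ≤ C := (abs_nonneg _).trans (hC 0 fun i => by simp)
  have hC0' : 0 ≤ C' := (abs_nonneg _).trans (hC' 0 fun i => by simp)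
  have hδ : 0 < ε / (C + C' + 1) := by positivity
  filter_upwards [hg _ hδ, hg' _ hδ, eventually_ne_atTop 0] with N h h' hN0 s hs
  have : NeZero N := ⟨hN0⟩
  have hle : ∀ j : Fin d → Fin N, |g (s j) * g' (s j) - g (corner j) * g' (corner j)| ≤
      C' * |g (s j) - g (corner j)| + C * |g' (s j) - g' (corner j)| := by
    intro j
    have e : g (s j) * g' (s j) - g (corner j) * g' (corner j) =
        g' (s j) * (g (s j) - g (corner j)) + g (corner j) * (g' (s j) - g' (corner j)) := by ring
    rw [e]
    refine (abs_add_le _ _).trans ?_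
    rw [abs_mul, abs_mul]
    exact add_le_add
      (mul_le_mul_of_nonneg_right (hC' _ (mem_Icc_of_mem_cell (hs j))) (abs_nonneg _))
      (mul_le_mul_of_nonneg_right (hC _ (mem_Icc_of_mem_cell (corner_mem_cell j)))
        (abs_nonneg _))
  refine (Finset.sum_le_sum fun j _ => hle j).trans ?_
  rw [Finset.sum_add_distrib, ← Finset.mul_sum, ← Finset.mul_sum]
  have a1 := mul_le_mul_of_nonneg_left (h s hs) hC0'
  have a2 := mul_le_mul_of_nonneg_left (h' s hs) hC0
  refine (add_le_add a1 a2).trans ?_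
  have e : C' * (ε / (C + C' + 1) * (N : ℝ) ^ d) + C * (ε / (C + C' + 1) * (N : ℝ) ^ d) =
      (ε * (N : ℝ) ^ d) * ((C + C') / (C + C' + 1)) := by field_simp; ring
  rw [e]
  refine mul_le_of_le_one_right (by positivity) ?_
  rw [div_le_one (by positivity)]
  linarith

/-- A function of one variable, viewed as a function of either coordinate of the square. -/
lemma SmallOscillation.comp_eval {g : ℝ → ℝ}
    (hg : SmallOscillation fun v : Fin 1 → ℝ => g (v 0)) (c : Fin 2) :
    SmallOscillation fun v : Fin 2 → ℝ => g (v c) := by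
  intro ε hε
  filter_upwards [hg ε hε] with N h s hs
  have key : ∀ t : Fin N → Fin N → (Fin 2 → Fin N), (∀ a b, t a b c = a) →
      ∀ b, ∑ a, |g (s (t a b) c) - g (corner (t a b) c)| ≤ ε * N := by
    intro t ht b
    have h1 := h (fun j _ => s (t (j 0) b) c) fun j => by
      rw [mem_cell]
      intro i
      have h2 := mem_cell.1 (hs (t (j 0) b)) c
      rw [ht] at h2
      obtain rfl : i = 0 := Subsingleton.elim _ _
      exact h2
    rw [pow_one] at h1
    refine le_trans (le_of_eq ?_) h1
    refine (Fintype.sum_equiv (Equiv.funUnique (Fin 1) (Fin N)) _ _ fun j => ?_).symm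
    simp [corner, ht]
  have hsum : ∑ j : Fin 2 → Fin N, |g (s j c) - g (corner j c)| =
      ∑ b, ∑ a, |g (s (if c = 0 then ![a, b] else ![b, a]) c) -
        g (corner (if c = 0 then ![a, b] else ![b, a]) c)| := by
    rw [Fintype.sum_equiv (finTwoArrowEquiv (Fin N)) _
      (fun p : Fin N × Fin N => |g (s ![p.1, p.2] c) - g (corner ![p.1, p.2] c)|)
      fun j => by
        have : j = ![j 0, j 1] := by ext i; fin_cases i <;> rfl
        change _ = |g (s ![j 0, j 1] c) - g (corner ![j 0, j 1] c)|
        rw [← this]]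
    rw [Fintype.sum_prod_type]
    by_cases hc : c = 0
    · simp only [hc, if_true]
      rw [Finset.sum_comm]
    · simp only [hc, if_false]
  rw [hsum]
  refine (Finset.sum_le_sum fun b _ => key (fun a b => if c = 0 then ![a, b] else ![b, a])
    (fun a b => ?_) b).trans ?_
  · fin_cases c <;> simp
  · rw [Finset.sum_const, Finset.card_univ, Fintype.card_fin, nsmul_eq_mul]
    exact le_of_eq (by ring)

/-- The function taking the value `φ j` on `cell j`, and `0` off the unit cube. -/
noncomputable def stepFunction {d N : ℕ} (φ : (Fin d → Fin N) → ℝ) (x : Fin d → ℝ) : ℝ :=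
  ∑ j, (cell j).indicator (fun _ => φ j) x

lemma stepFunction_apply {d N : ℕ} [NeZero N] (φ : (Fin d → Fin N) → ℝ) {x : Fin d → ℝ}
    {j : Fin d → Fin N} (hx : x ∈ cell j) : stepFunction φ x = φ j := by
  rw [stepFunction, Finset.sum_eq_single j]
  · exact Set.indicator_of_mem hx _
  · intro j' _ hj'
    exact Set.indicator_of_notMem (fun h => (disjoint_cell hj').le_bot ⟨h, hx⟩) _
  · simp

lemma measurable_stepFunction {d N : ℕ} (φ : (Fin d → Fin N) → ℝ) :
    Measurable (stepFunction φ) :=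
  Finset.measurable_sum _ fun j _ => measurable_const.indicator (measurableSet_cell j)

lemma integrable_indicator_cell {d N : ℕ} [NeZero N] (φ : (Fin d → Fin N) → ℝ)
    (j : Fin d → Fin N) :
    Integrable ((cell j).indicator (fun _ => φ j))
      (volume.restrict (unitCube d : Set (Fin d → ℝ))) := by
  have : IsFiniteMeasure (volume.restrict (unitCube d : Set (Fin d → ℝ))) :=
    ⟨by rw [Measure.restrict_apply_univ]; exact (unitCube d).measure_coe_lt_top _⟩
  exact (integrable_const _).indicator (measurableSet_cell j)

lemma integrable_stepFunction {d N : ℕ} [NeZero N] (φ : (Fin d → Fin N) → ℝ) :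
    Integrable (stepFunction φ) (volume.restrict (unitCube d : Set (Fin d → ℝ))) :=
  integrable_finsetSum _ fun j _ => integrable_indicator_cell φ j

lemma integral_stepFunction {d N : ℕ} [NeZero N] (φ : (Fin d → Fin N) → ℝ) :
    ∫ x in (unitCube d : Set (Fin d → ℝ)), stepFunction φ x = (∑ j, φ j) / (N : ℝ) ^ d := by
  simp only [stepFunction]
  rw [integral_finsetSum _ fun j _ => integrable_indicator_cell φ j, Finset.sum_div]
  refine Finset.sum_congr rfl fun j _ => ?_
  rw [integral_indicator (measurableSet_cell j), Measure.restrict_restrict (measurableSet_cell j),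
    Set.inter_eq_self_of_subset_left, setIntegral_const, volume_cell, smul_eq_mul]
  · ring
  · rw [← iUnion_cell (N := N)]
    exact Set.subset_iUnion _ j

/-- A bounded function of small oscillation lies within `L¹`-small step functions of its own step
functions: the dominating step function records a point of each cell at which the oscillation is
almost attained. -/
lemma SmallOscillation.exists_dominating {d : ℕ} {g : (Fin d → ℝ) → ℝ} {C : ℝ}
    (hg : SmallOscillation g) (hC : ∀ x, (∀ i, x i ∈ Set.Icc (0 : ℝ) 1) → |g x| ≤ C) :
    ∃ D : ∀ N : ℕ, (Fin d → Fin N) → ℝ,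
      (∀ N [NeZero N] (j : Fin d → Fin N), 0 ≤ D N j ∧
        ∀ x ∈ cell j, |g x - g (corner j)| ≤ D N j) ∧
      Tendsto (fun N : ℕ => (∑ j, D N j) / (N : ℝ) ^ d) atTop (𝓝 0) := by
  have hs : ∀ N : ℕ, ∀ j : Fin d → Fin N, ∃ y : Fin d → ℝ, NeZero N → y ∈ cell j ∧
      ∀ x ∈ cell j, |g x - g (corner j)| ≤ |g y - g (corner j)| + 1 / N := by
    intro N j
    by_cases hN0 : N = 0
    · exact ⟨0, fun h => (h.out hN0).elim⟩
    have : NeZero N := ⟨hN0⟩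
    have hN : (0 : ℝ) < N := Nat.cast_pos.2 (Nat.pos_of_ne_zero hN0)
    set S := (fun y => |g y - g (corner j)|) '' cell j with hS
    have hne : S.Nonempty := ⟨_, _, corner_mem_cell j, rfl⟩
    have hbd : BddAbove S := by
      refine ⟨C + C, ?_⟩
      rintro _ ⟨y, hy, rfl⟩
      exact (abs_sub _ _).trans (add_le_add (hC _ (mem_Icc_of_mem_cell hy))
        (hC _ (mem_Icc_of_mem_cell (corner_mem_cell j))))
    obtain ⟨_, ⟨y, hy, rfl⟩, hlt⟩ := exists_lt_of_lt_csSup hne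
      (show sSup S - 1 / N < sSup S by have : (0 : ℝ) < 1 / N := by positivity
                                       linarith)
    refine ⟨y, fun _ => ⟨hy, fun x hx => ?_⟩⟩
    have := le_csSup hbd ⟨x, hx, rfl⟩
    simp only at this hlt
    linarith
  choose s hs using hs
  refine ⟨fun N j => |g (s N j) - g (corner j)| + 1 / N, fun N hN j => ⟨by positivity,
    (hs N j hN).2⟩, ?_⟩
  rw [Metric.tendsto_nhds]
  intro ε hε
  filter_upwards [hg (ε / 3) (by positivity), eventually_ne_atTop 0,
    (tendsto_one_div_atTop_nhds_zero_nat (𝕜 := ℝ)).eventually_le_const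
      (show (0 : ℝ) < ε / 3 by positivity)] with N h hN0 hN1
  have hNe : NeZero N := ⟨hN0⟩
  have hN : (0 : ℝ) < N := Nat.cast_pos.2 (Nat.pos_of_ne_zero hN0)
  have h1 := h (s N) fun j => (hs N j hNe).1
  rw [Real.dist_eq, sub_zero, abs_of_nonneg (by positivity), div_lt_iff₀ (by positivity),
    Finset.sum_add_distrib, Finset.sum_const, Finset.card_univ, Fintype.card_fun,
    Fintype.card_fin, Fintype.card_fin, nsmul_eq_mul]
  push_cast
  have h2 := mul_le_mul_of_nonneg_left hN1 (show (0 : ℝ) ≤ (N : ℝ) ^ d by positivity)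
  have h3 : 0 < ε * (N : ℝ) ^ d := by positivity
  linarith

/-- A bounded function of small oscillation is Lebesgue integrable and its integral is the limit
of the Riemann sums over the upper corners of the cells. -/
theorem SmallOscillation.tendsto_riemannSum {d : ℕ} {g : (Fin d → ℝ) → ℝ} {C : ℝ}
    (hg : SmallOscillation g) (hC : ∀ x, (∀ i, x i ∈ Set.Icc (0 : ℝ) 1) → |g x| ≤ C) :
    Integrable g (volume.restrict (unitCube d : Set (Fin d → ℝ))) ∧
    Tendsto (fun N : ℕ => (∑ j : Fin d → Fin N, g (corner j)) / (N : ℝ) ^ d) atTop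
      (𝓝 (∫ x in (unitCube d : Set (Fin d → ℝ)), g x)) := by
  set μ := volume.restrict (unitCube d : Set (Fin d → ℝ)) with hμ
  have hfin : IsFiniteMeasure μ :=
    ⟨by rw [Measure.restrict_apply_univ]; exact (unitCube d).measure_coe_lt_top _⟩
  have hms : MeasurableSet (unitCube d : Set (Fin d → ℝ)) := (unitCube d).measurableSet_coe
  obtain ⟨D, hD, hD0⟩ := hg.exists_dominating hC
  have hdom : ∀ N : ℕ, NeZero N → ∀ x ∈ (unitCube d : Set (Fin d → ℝ)), 0 ≤ stepFunction (D N) x ∧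
      |g x - stepFunction (fun j : Fin d → Fin N => g (corner j)) x| ≤ stepFunction (D N) x := by
    intro N hN x hx
    rw [← iUnion_cell (N := N), Set.mem_iUnion] at hx
    obtain ⟨j, hj⟩ := hx
    rw [stepFunction_apply _ hj, stepFunction_apply _ hj]
    exact ⟨(hD N j).1, (hD N j).2 x hj⟩
  -- the dominating step functions tend to zero in measure, hence a.e. along a subsequence
  have hmeas : AEStronglyMeasurable g μ := by
    have hL : Tendsto (fun N => eLpNorm (stepFunction (D N) - (0 : (Fin d → ℝ) → ℝ)) 1 μ) atTop
        (𝓝 0) := by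
      have h1 := ENNReal.tendsto_ofReal hD0
      rw [ENNReal.ofReal_zero] at h1
      refine h1.congr' ?_
      filter_upwards [eventually_ne_atTop 0] with N hN0
      have : NeZero N := ⟨hN0⟩
      rw [sub_zero, eLpNorm_one_eq_lintegral_enorm, ← integral_stepFunction,
        ofReal_integral_eq_lintegral_ofReal (integrable_stepFunction _)
          ((ae_restrict_iff' hms).2 (Eventually.of_forall fun x hx => (hdom N this x hx).1))]
      refine lintegral_congr_ae ((ae_restrict_iff' hms).2 (Eventually.of_forall fun x hx => ?_))
      exact (Real.enorm_of_nonneg (hdom N this x hx).1).symm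
    have hM := tendstoInMeasure_of_tendsto_eLpNorm one_ne_zero
      (fun N => (measurable_stepFunction (D N)).aestronglyMeasurable)
      (aestronglyMeasurable_const (b := (0 : ℝ))) hL
    obtain ⟨ns, hns, hae⟩ := hM.exists_seq_tendsto_ae
    refine aestronglyMeasurable_of_tendsto_ae atTop
      (f := fun m => stepFunction (fun j : Fin d → Fin (ns m) => g (corner j)))
      (fun m => (measurable_stepFunction _).aestronglyMeasurable) ?_
    filter_upwards [hae, ae_restrict_mem hms] with x hx hxc
    rw [tendsto_iff_dist_tendsto_zero]
    refine squeeze_zero' (Eventually.of_forall fun _ => dist_nonneg) ?_ hx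
    filter_upwards [hns.tendsto_atTop.eventually_ne_atTop 0] with m hm
    rw [dist_comm, Real.dist_eq]
    exact (hdom (ns m) ⟨hm⟩ x hxc).2
  have hint : Integrable g μ := by
    refine Integrable.of_bound hmeas C ?_
    filter_upwards [ae_restrict_mem hms] with x hx
    exact hC x fun i => ⟨(hx i).1.le, (hx i).2⟩
  refine ⟨hint, ?_⟩
  rw [tendsto_iff_dist_tendsto_zero]
  refine squeeze_zero' (Eventually.of_forall fun _ => dist_nonneg) ?_ hD0
  filter_upwards [eventually_ne_atTop 0] with N hN0
  have : NeZero N := ⟨hN0⟩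
  rw [← integral_stepFunction, ← integral_stepFunction, dist_comm, Real.dist_eq,
    ← integral_sub hint (integrable_stepFunction _)]
  refine abs_integral_le_integral_abs.trans ?_
  refine setIntegral_mono_on (hint.sub (integrable_stepFunction _)).abs
    (integrable_stepFunction _) hms fun x hx => (hdom N this x hx).2

/-- One-dimensional form of the convergence of Riemann sums. -/
lemma tendsto_riemannSum_one {g : ℝ → ℝ} {C : ℝ}
    (hg : SmallOscillation fun v : Fin 1 → ℝ => g (v 0))
    (hC : ∀ x ∈ Set.Icc (0 : ℝ) 1, |g x| ≤ C) :
    Tendsto (fun N : ℕ => (∑ j : Fin N, g (gridPoint j)) / N) atTop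
      (𝓝 (∫ x in (0 : ℝ)..1, g x)) := by
  have h := (hg.tendsto_riemannSum fun x hx => hC _ (hx 0)).2
  have e : ∫ x in (unitCube 1 : Set (Fin 1 → ℝ)), g (x 0) = ∫ x in (0 : ℝ)..1, g x := by
    rw [intervalIntegral.integral_of_le zero_le_one]
    have := (volume_preserving_funUnique (Fin 1) ℝ).setIntegral_preimage_emb
      (MeasurableEquiv.measurableEmbedding _) g (Set.Ioc 0 1)
    rw [← this]
    congr 2
    ext x
    simp [unitCube, BoxIntegral.Box.mem_def]
  rw [e] at h
  refine h.congr fun N => ?_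
  rw [pow_one]
  congr 1
  exact Fintype.sum_equiv (Equiv.funUnique (Fin 1) (Fin N)) _ _ fun j => rfl

/-- Two-dimensional form of the convergence of Riemann sums, with an iterated integral. -/
lemma tendsto_riemannSum_two {g : ℝ → ℝ → ℝ} {C : ℝ}
    (hg : SmallOscillation fun v : Fin 2 → ℝ => g (v 0) (v 1))
    (hC : ∀ x ∈ Set.Icc (0 : ℝ) 1, ∀ y ∈ Set.Icc (0 : ℝ) 1, |g x y| ≤ C) :
    Tendsto (fun N : ℕ => (∑ j : Fin N, ∑ l : Fin N, g (gridPoint j) (gridPoint l)) / (N : ℝ) ^ 2)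
      atTop (𝓝 (∫ y in (0 : ℝ)..1, ∫ x in (0 : ℝ)..1, g x y)) := by
  obtain ⟨hi, h⟩ := hg.tendsto_riemannSum fun x hx => hC _ (hx 0) _ (hx 1)
  have hpre : MeasurableEquiv.finTwoArrow ⁻¹' (Set.Ioc (0 : ℝ) 1 ×ˢ Set.Ioc (0 : ℝ) 1) =
      (unitCube 2 : Set (Fin 2 → ℝ)) := by
    ext x
    simp [unitCube, BoxIntegral.Box.mem_def, Fin.forall_fin_two]
  have hi' : IntegrableOn (fun p : ℝ × ℝ => g p.1 p.2)
      (Set.Ioc (0 : ℝ) 1 ×ˢ Set.Ioc (0 : ℝ) 1) := by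
    have := (volume_preserving_finTwoArrow ℝ).integrableOn_comp_preimage
      (MeasurableEquiv.measurableEmbedding _) (f := fun p : ℝ × ℝ => g p.1 p.2)
      (s := Set.Ioc (0 : ℝ) 1 ×ˢ Set.Ioc (0 : ℝ) 1)
    rw [← this, hpre]
    exact hi
  have e : ∫ x in (unitCube 2 : Set (Fin 2 → ℝ)), g (x 0) (x 1) =
      ∫ y in (0 : ℝ)..1, ∫ x in (0 : ℝ)..1, g x y := by
    have h1 := (volume_preserving_finTwoArrow ℝ).setIntegral_preimage_emb
      (MeasurableEquiv.measurableEmbedding _) (fun p : ℝ × ℝ => g p.1 p.2)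
      (Set.Ioc (0 : ℝ) 1 ×ˢ Set.Ioc (0 : ℝ) 1)
    rw [hpre] at h1
    refine h1.trans ?_
    rw [IntegrableOn, Measure.volume_eq_prod, ← Measure.prod_restrict] at hi'
    rw [Measure.volume_eq_prod, ← Measure.prod_restrict, integral_prod_symm _ hi']
    simp only [intervalIntegral.integral_of_le zero_le_one]
  rw [e] at h
  refine h.congr fun N => ?_
  congr 1
  rw [← Fintype.sum_prod_type' fun j l : Fin N => g (gridPoint j) (gridPoint l)]
  exact Fintype.sum_equiv (finTwoArrowEquiv (Fin N)) _ _ fun j => rfl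

/-- Riemann sums of a product of two Riemann-integrable functions. -/
lemma tendsto_riemannSum_mul {g g' : ℝ → ℝ} (hg : BoundedRiemann₁ g) (hg' : BoundedRiemann₁ g') :
    Tendsto (fun N : ℕ => (∑ j : Fin N, g (gridPoint j) * g' (gridPoint j)) / N) atTop
      (𝓝 (∫ x in (0 : ℝ)..1, g x * g' x)) := by
  obtain ⟨⟨C, hC⟩, hi⟩ := hg
  obtain ⟨⟨C', hC'⟩, hi'⟩ := hg'
  refine tendsto_riemannSum_one (C := C * C') (hi.smallOscillation.mul hi'.smallOscillation
    (fun x hx => hC _ (hx 0)) fun x hx => hC' _ (hx 0)) fun x hx => ?_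
  rw [abs_mul]
  exact mul_le_mul (hC x hx) (hC' x hx) (abs_nonneg _) ((abs_nonneg _).trans (hC x hx))

/-- Riemann sums of the integrand of the limiting covariance. -/
lemma tendsto_riemannSum_cov {g g' : ℝ → ℝ} {f : ℝ → ℝ → ℝ} (hg : BoundedRiemann₁ g)
    (hg' : BoundedRiemann₁ g') (hf : BoundedRiemann₂ f) :
    Tendsto (fun N : ℕ => (∑ j : Fin N, ∑ l : Fin N, g (gridPoint j) * g (gridPoint l) *
      g' (gridPoint j) * g' (gridPoint l) * f (gridPoint j) (gridPoint l)) / (N : ℝ) ^ 2) atTop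
      (𝓝 (∫ y in (0 : ℝ)..1, ∫ x in (0 : ℝ)..1, g x * g y * g' x * g' y * f x y)) := by
  obtain ⟨⟨C, hC⟩, hi⟩ := hg
  obtain ⟨⟨C', hC'⟩, hi'⟩ := hg'
  obtain ⟨⟨C'', hC''⟩, hi''⟩ := hf
  have hmul : ∀ {a b A B : ℝ}, |a| ≤ A → |b| ≤ B → |a * b| ≤ A * B := by
    intro a b A B ha hb
    rw [abs_mul]
    exact mul_le_mul ha hb (abs_nonneg _) ((abs_nonneg _).trans ha)
  have o := fun c => hi.smallOscillation.comp_eval c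
  have o' := fun c => hi'.smallOscillation.comp_eval c
  have b : ∀ c, ∀ x : Fin 2 → ℝ, (∀ i, x i ∈ Set.Icc (0 : ℝ) 1) → |g (x c)| ≤ C :=
    fun c x hx => hC _ (hx c)
  have b' : ∀ c, ∀ x : Fin 2 → ℝ, (∀ i, x i ∈ Set.Icc (0 : ℝ) 1) → |g' (x c)| ≤ C' :=
    fun c x hx => hC' _ (hx c)
  have o2 := (o 0).mul (o 1) (b 0) (b 1)
  have b2 : ∀ x : Fin 2 → ℝ, (∀ i, x i ∈ Set.Icc (0 : ℝ) 1) → |g (x 0) * g (x 1)| ≤ C * C :=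
    fun x hx => hmul (b 0 x hx) (b 1 x hx)
  have o3 := o2.mul (o' 0) b2 (b' 0)
  have b3 : ∀ x : Fin 2 → ℝ, (∀ i, x i ∈ Set.Icc (0 : ℝ) 1) →
      |g (x 0) * g (x 1) * g' (x 0)| ≤ C * C * C' := fun x hx => hmul (b2 x hx) (b' 0 x hx)
  have o4 := o3.mul (o' 1) b3 (b' 1)
  have b4 : ∀ x : Fin 2 → ℝ, (∀ i, x i ∈ Set.Icc (0 : ℝ) 1) →
      |g (x 0) * g (x 1) * g' (x 0) * g' (x 1)| ≤ C * C * C' * C' :=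
    fun x hx => hmul (b3 x hx) (b' 1 x hx)
  refine tendsto_riemannSum_two
    (g := fun x y => g x * g y * g' x * g' y * f x y) (C := C * C * C' * C' * C'')
    (o4.mul hi''.smallOscillation b4 fun x hx => hC'' _ (hx 0) _ (hx 1)) fun x hx y hy => ?_
  exact hmul (hmul (hmul (hmul (hC x hx) (hC y hy)) (hC' x hx)) (hC' y hy)) (hC'' x hx y hy)

/-! ### Linearization of the top eigenvalues -/

/-- The laws `μ N p` of the independent entries `X N j l`, `p = (j, l)`, of a sequence of Wigner
matrices with variance profile `f` and moment constant `B`. -/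
structure IsWignerLaw (B : ℝ) (f : ℝ → ℝ → ℝ) (μ : ∀ N, UpperIdx N → Measure ℝ) : Prop where
  prob : ∀ N p, IsProbabilityMeasure (μ N p)
  mean : ∀ N p, ∫ t, t ∂(μ N p) = 0
  variance : ∀ N (j l : Fin N),
    ∫ t, t ^ 2 ∂(μ N ⟨(min j l, max j l), min_le_max⟩) = f (gridPoint j) (gridPoint l)
  moment : ∀ N p, ∀ m : ℕ, 1 ≤ m → Integrable (fun t => |t| ^ m) (μ N p) ∧
    ∫ t, |t| ^ m ∂(μ N p) ≤ (m : ℝ) ^ (B * m)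

section

variable {B : ℝ} {f : ℝ → ℝ → ℝ} {μ : ∀ N, UpperIdx N → Measure ℝ}

lemma IsWignerLaw.memLp (hμ : IsWignerLaw B f μ) (N : ℕ) (p : UpperIdx N) {m : ℕ} (hm : 1 ≤ m) :
    MemLp (fun t => t) m (μ N p) := by
  have h := (hμ.moment N p m hm).1
  have hm0 : (m : ENNReal) ≠ 0 := by
    rw [Ne, Nat.cast_eq_zero]
    omega
  refine (integrable_norm_rpow_iff measurable_id.aestronglyMeasurable hm0
    (ENNReal.natCast_ne_top m)).1 ?_
  simpa using h

lemma IsWignerLaw.integral_sq_le (hμ : IsWignerLaw B f μ) (N : ℕ) (p : UpperIdx N) :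
    ∫ t, t ^ 2 ∂(μ N p) ≤ (2 : ℝ) ^ (B * 2) := by
  have h := (hμ.moment N p 2 (by norm_num)).2
  simpa only [sq_abs, Nat.cast_ofNat] using h

lemma IsWignerLaw.integral_pow_four_le (hμ : IsWignerLaw B f μ) (N : ℕ) (p : UpperIdx N) :
    ∫ t, t ^ 4 ∂(μ N p) ≤ (4 : ℝ) ^ (B * 4) := by
  have h := (hμ.moment N p 4 (by norm_num)).2
  have e : ∀ t : ℝ, |t| ^ 4 = t ^ 4 := fun t => Even.pow_abs (by decide) t
  simpa only [e, Nat.cast_ofNat] using h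

end

lemma entryBound_nonneg (B : ℝ) (N : ℕ) : 0 ≤ entryBound B N := by
  unfold entryBound
  positivity

/-- The growth condition on `θ` absorbs the cube of the bound on the entries: this is where the
exponent `ξ > 4 (B + 1)` of the logarithm enters. -/
lemma tendsto_entryBound_pow_mul_sqrt_div {B ξ : ℝ} (hB : 0 < B) (hξ : 4 * (B + 1) < ξ)
    {θ : ℕ → ℝ} (hθ : ∀ N, 0 < θ N)
    (hθ_lower : (fun N : ℕ => √(N : ℝ) * Real.log N ^ ξ) =O[atTop] θ) :
    Tendsto (fun N => entryBound B N ^ 3 * √N / θ N) atTop (𝓝 0) := by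
  obtain ⟨c, hc0, hc⟩ := hθ_lower.exists_pos
  have hlog : Tendsto (fun N : ℕ => Real.log N) atTop atTop :=
    Real.tendsto_log_atTop.comp tendsto_natCast_atTop_atTop
  have hlim : Tendsto (fun N : ℕ => ((Real.exp 10 * 2 ^ B) ^ 3 * c) *
      Real.log N ^ (-(ξ - 3 * B))) atTop (𝓝 0) := by
    have := ((tendsto_rpow_neg_atTop (show 0 < ξ - 3 * B by linarith)).comp hlog).const_mul
      ((Real.exp 10 * 2 ^ B) ^ 3 * c)
    rw [mul_zero] at this
    exact this
  refine squeeze_zero' (Eventually.of_forall fun N => ?_) ?_ hlim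
  · have := entryBound_nonneg B N
    have := (hθ N).le
    positivity
  · filter_upwards [hc.bound, hlog.eventually_ge_atTop 1] with N hN hl
    have hl0 : 0 < Real.log N := by linarith
    rw [Real.norm_of_nonneg (by positivity), Real.norm_of_nonneg (hθ N).le] at hN
    have hceil : (⌈Real.log N⌉₊ : ℝ) ≤ 2 * Real.log N := by
      have := (Nat.ceil_lt_add_one hl0.le).le
      linarith
    have hK : entryBound B N ≤ Real.exp 10 * 2 ^ B * Real.log N ^ B := by
      rw [entryBound, mul_assoc, ← Real.mul_rpow (by norm_num) hl0.le]
      gcongr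
    rw [div_le_iff₀ (hθ N)]
    calc entryBound B N ^ 3 * √N ≤ (Real.exp 10 * 2 ^ B * Real.log N ^ B) ^ 3 * √N := by
          have := entryBound_nonneg B N
          gcongr
      _ = ((Real.exp 10 * 2 ^ B) ^ 3 * Real.log N ^ (-(ξ - 3 * B))) *
            (√N * Real.log N ^ ξ) := by
          have e : (Real.log N ^ B) ^ 3 = Real.log N ^ (-(ξ - 3 * B)) * Real.log N ^ ξ := by
            rw [← Real.rpow_natCast, ← Real.rpow_mul hl0.le, ← Real.rpow_add hl0]
            congr 1
            push_cast
            ring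
          rw [mul_pow _ (Real.log N ^ B), e]
          ring
      _ ≤ ((Real.exp 10 * 2 ^ B) ^ 3 * Real.log N ^ (-(ξ - 3 * B))) * (c * θ N) := by
          gcongr
      _ = _ := by ring

lemma one_le_entryBound {B : ℝ} (hB : 0 < B) {N : ℕ} (hN : 2 ≤ N) : 1 ≤ entryBound B N := by
  have h1 : (1 : ℝ) ≤ Real.exp 10 := Real.one_le_exp (by norm_num)
  have h2 : (1 : ℝ) ≤ (⌈Real.log N⌉₊ : ℝ) := by
    have : 0 < Real.log N := Real.log_pos (by exact_mod_cast (by omega : 1 < N))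
    exact_mod_cast Nat.one_le_ceil_iff.2 this
  have h3 : (1 : ℝ) ≤ (⌈Real.log N⌉₊ : ℝ) ^ B := Real.one_le_rpow h2 hB.le
  unfold entryBound
  nlinarith

lemma tendsto_entryBound_mul_sqrt_div {B : ℝ} (hB : 0 < B) {θ : ℕ → ℝ} (hθ : ∀ N, 0 < θ N)
    (hgrow : Tendsto (fun N => entryBound B N ^ 3 * √N / θ N) atTop (𝓝 0)) :
    Tendsto (fun N => entryBound B N * √N / θ N) atTop (𝓝 0) := by
  refine squeeze_zero' (Eventually.of_forall fun N => ?_) ?_ hgrow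
  · have := entryBound_nonneg B N
    have := (hθ N).le
    positivity
  · filter_upwards [eventually_ge_atTop 2] with N hN
    have h1 := one_le_entryBound hB hN
    have := hθ N
    gcongr
    exact le_self_pow₀ h1 (by norm_num)

section

variable {B : ℝ} {f : ℝ → ℝ → ℝ} {μ : ∀ N, UpperIdx N → Measure ℝ} {k : ℕ}
  {e : ∀ N, Fin k → EuclideanSpace ℝ (Fin N)} {α : Fin k → ℝ} {θ : ℕ → ℝ}

/-- The `(i+1)`-th largest eigenvalue of `W + θ ∑ₘ αₘ eₘ eₘ'` as a function of the upper triangular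
entries of `W`. -/
noncomputable def topEigenvalue (θ : ℕ → ℝ) (α : Fin k → ℝ)
    (e : ∀ N, Fin k → EuclideanSpace ℝ (Fin N)) (N i : ℕ) (x : UpperIdx N → ℝ) : ℝ :=
  orderedEigenvalue (isHermitian_symOf_add_smul x (θ N)
    (spikeSum_isHermitian α fun m => (e N m : Fin N → ℝ))) i

/-- The quadratic form `e' W e` as a function of the upper triangular entries of `W`. -/
noncomputable def quadForm (e : ∀ N, Fin k → EuclideanSpace ℝ (Fin N)) (N : ℕ) (i : Fin k)
    (x : UpperIdx N → ℝ) : ℝ :=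
  (e N i : Fin N → ℝ) ⬝ᵥ (symOf x).mulVec (e N i : Fin N → ℝ)

/-- The sum of the top `i` eigenvalues is asymptotically linear in the entries: the remainder has
vanishing variance. -/
theorem tendsto_variance_topSum_sub (hμ : IsWignerLaw B f μ) (hθ : ∀ N, 0 < θ N)
    (hgrow : Tendsto (fun N => entryBound B N ^ 3 * √N / θ N) atTop (𝓝 0))
    (he : ∀ i j, Tendsto (fun N => inner ℝ (e N i) (e N j)) atTop (𝓝 (if i = j then 1 else 0)))
    (hα : StrictAnti α) (hα0 : ∀ m, 0 < α m) {i : ℕ} (hi : i ≤ k) :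
    Tendsto (fun N => Var[fun x => topSum (isHermitian_symOf_add_smul x (θ N)
        (spikeSum_isHermitian α fun m => (e N m : Fin N → ℝ))) i -
      (symOf x * spikeSum (firstOnes k i) (fun m => (e N m : Fin N → ℝ))).trace;
      Measure.pi (μ N)]) atTop (𝓝 0) := by
  rcases Nat.eq_zero_or_pos i with rfl | hi1
  · have h0 : ∀ N : ℕ, ∀ x : UpperIdx N → ℝ, topSum (isHermitian_symOf_add_smul x (θ N)
        (spikeSum_isHermitian α fun m => (e N m : Fin N → ℝ))) 0 -
      (symOf x * spikeSum (firstOnes k 0) (fun m => (e N m : Fin N → ℝ))).trace = 0 := by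
      intro N x
      simp [topSum, spikeSum, firstOnes]
    simp only [h0]
    have h1 : ∀ N, Var[fun _ : UpperIdx N → ℝ => (0 : ℝ); Measure.pi (μ N)] = 0 := fun N =>
      variance_zero _
    simp only [h1]
    exact tendsto_const_nhds
  obtain ⟨κ, hκ, hQ⟩ := (spikeSum_spectrum he hα hα0 hi).2 hi1
  set V₂ : ℝ := (2 : ℝ) ^ (B * 2) with hV₂
  set V₄ : ℝ := (4 : ℝ) ^ (B * 4) with hV₄
  have hV₂0 : 0 < V₂ := by positivity
  have hV₄0 : 0 < V₄ := by positivity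
  rw [Metric.tendsto_nhds]
  intro ε hε
  have lim1 : Tendsto (fun N => (64 * 17 * i / κ) * (entryBound B N ^ 3 * √N / θ N)) atTop
      (𝓝 0) := by
    have := hgrow.const_mul (64 * 17 * i / κ)
    rwa [mul_zero] at this
  have lim2 : Tendsto (fun N : ℕ => 32 * (2 + 8 * V₄) * (1 / (N : ℝ))) atTop (𝓝 0) := by
    have := (tendsto_one_div_atTop_nhds_zero_nat (𝕜 := ℝ)).const_mul (32 * (2 + 8 * V₄))
    rwa [mul_zero] at this
  filter_upwards [hQ (ε / (64 * V₂)) (by positivity), eventually_exists_good_set B,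
    lim1.eventually_le_const (show 0 < ε / 4 by positivity),
    lim2.eventually_le_const (show 0 < ε / 4 by positivity), eventually_ge_atTop (k + 1)]
    with N ⟨Q, hQ1, hQ2, hQ3⟩ hG h1 h2 hN
  obtain ⟨G, hGm, hGη, hGx⟩ := hG (μ N) (hμ.prob N) (hμ.mean N) (hμ.moment N)
  have := hμ.prob N
  have hN1 : (1 : ℝ) ≤ N := by exact_mod_cast (by omega : 1 ≤ N)
  have hN0 : (0 : ℝ) < N := by linarith
  have hvar := variance_topSum_sub_trace_le (fun p => hμ.memLp N p (m := 4) (by norm_num))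
    (hμ.integral_sq_le N) (hμ.integral_pow_four_le N) hV₂0.le
    (spikeSum_isHermitian α fun m => (e N m : Fin N → ℝ))
    (spikeSum_transpose (firstOnes k i) fun m => (e N m : Fin N → ℝ)) (hθ N) hκ
    (by have := entryBound_nonneg B N; positivity) (show i ≤ N by omega) hQ1 hQ2 hGm
    (r := (N : ℝ) ^ 4) (by positivity) hGη hGx
  rw [Real.dist_eq, sub_zero, abs_of_nonneg (variance_nonneg _ _)]
  -- with `r = N⁴` the bad event contributes `O(N⁻⁴)` for each of the `O(N²)` entries
  have t1 : 64 * entryBound B N ^ 2 * (i * (17 * entryBound B N * √N)) / (κ * θ N) =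
      (64 * 17 * i / κ) * (entryBound B N ^ 3 * √N / θ N) := by
    have := (hθ N).ne'
    field_simp
  have t2 : (Fintype.card (UpperIdx N) : ℝ) * ((N : ℝ) ^ 4 * (2 / (N : ℝ) ^ 8) +
      8 * V₄ / (N : ℝ) ^ 4) ≤ (2 + 8 * V₄) * (1 / (N : ℝ)) := by
    calc (Fintype.card (UpperIdx N) : ℝ) * ((N : ℝ) ^ 4 * (2 / (N : ℝ) ^ 8) +
          8 * V₄ / (N : ℝ) ^ 4)
        ≤ (N : ℝ) ^ 2 * ((N : ℝ) ^ 4 * (2 / (N : ℝ) ^ 8) + 8 * V₄ / (N : ℝ) ^ 4) :=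
          mul_le_mul_of_nonneg_right (card_upperIdx_le N) (by positivity)
      _ = (2 + 8 * V₄) * (1 / (N : ℝ) ^ 2) := by field_simp
      _ ≤ (2 + 8 * V₄) * (1 / (N : ℝ)) := by
          refine mul_le_mul_of_nonneg_left ?_ (by positivity)
          exact one_div_le_one_div_of_le hN0 (le_self_pow₀ hN1 (by norm_num))
  have t3 : 16 * V₂ * frobSq (Q - spikeSum (firstOnes k i) fun m => (e N m : Fin N → ℝ)) ≤
      ε / 4 := by
    have := mul_le_mul_of_nonneg_left hQ3 (show 0 ≤ 16 * V₂ by positivity)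
    refine this.trans (le_of_eq ?_)
    field_simp
    norm_num
  rw [t1] at hvar
  linarith

lemma measurable_topEigenvalue (N i : ℕ) : Measurable (topEigenvalue θ α e N i) := by
  by_cases hi : i < N
  · have h1 := continuous_topSum (spikeSum_isHermitian α fun m => (e N m : Fin N → ℝ)) (θ N)
      (show i + 1 ≤ N by omega)
    have h0 := continuous_topSum (spikeSum_isHermitian α fun m => (e N m : Fin N → ℝ)) (θ N)
      (show i ≤ N by omega)
    have h2 := (h1.sub h0).measurable
    unfold topEigenvalue
    simp only [orderedEigenvalue_eq_sub]
    exact h2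
  · have : topEigenvalue θ α e N i = fun _ => 0 := by
      ext x
      simp [topEigenvalue, orderedEigenvalue, hi]
    rw [this]
    exact measurable_const

lemma memLp_topEigenvalue (hμ : IsWignerLaw B f μ) (N i : ℕ) :
    MemLp (topEigenvalue θ α e N i) 2 (Measure.pi (μ N)) := by
  have := hμ.prob N
  have hμ2 : ∀ p, MemLp (fun t => t) 2 (μ N p) := fun p => hμ.memLp N p (m := 2) (by norm_num)
  by_cases hi : i < N
  · have h1 := memLp_topSum hμ2 (spikeSum_isHermitian α fun m => (e N m : Fin N → ℝ)) (θ N)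
      (show i + 1 ≤ N by omega)
    have h0 := memLp_topSum hμ2 (spikeSum_isHermitian α fun m => (e N m : Fin N → ℝ)) (θ N)
      (show i ≤ N by omega)
    unfold topEigenvalue
    simp only [orderedEigenvalue_eq_sub]
    exact h1.sub h0
  · have : topEigenvalue θ α e N i = fun _ => 0 := by
      ext x
      simp [topEigenvalue, orderedEigenvalue, hi]
    rw [this]
    exact MemLp.zero'

lemma quadForm_eq_sum (N : ℕ) (i : Fin k) (x : UpperIdx N → ℝ) :
    quadForm e N i x = ∑ p, upperCoef (Matrix.vecMulVec (e N i : Fin N → ℝ) (e N i)) p * x p :=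
  dotProduct_symOf_mulVec _ _ _

lemma memLp_quadForm (hμ : IsWignerLaw B f μ) (N : ℕ) (i : Fin k) :
    MemLp (quadForm e N i) 2 (Measure.pi (μ N)) := by
  have := hμ.prob N
  have h : quadForm e N i = fun x : UpperIdx N → ℝ =>
      ∑ p, upperCoef (Matrix.vecMulVec (e N i : Fin N → ℝ) (e N i)) p * x p :=
    funext fun x => quadForm_eq_sum N i x
  rw [h]
  exact memLp_finsetSum _ fun p _ =>
    (memLp_eval (fun p => hμ.memLp N p (m := 2) (by norm_num)) p).const_mul _

lemma integral_eval (hμ : IsWignerLaw B f μ) (N : ℕ) (p : UpperIdx N) :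
    ∫ x, x p ∂(Measure.pi (μ N)) = 0 := by
  have := hμ.prob N
  have h := integral_map (μ := Measure.pi (μ N)) (measurable_pi_apply p).aemeasurable
    (measurable_id (α := ℝ)).aestronglyMeasurable
  rw [(measurePreserving_eval (μ N) p).map_eq] at h
  exact h.symm.trans (hμ.mean N p)

lemma integral_quadForm (hμ : IsWignerLaw B f μ) (N : ℕ) (i : Fin k) :
    ∫ x, quadForm e N i x ∂(Measure.pi (μ N)) = 0 := by
  have := hμ.prob N
  simp only [quadForm_eq_sum]
  rw [integral_finsetSum]
  · refine Finset.sum_eq_zero fun p _ => ?_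
    rw [integral_const_mul, integral_eval hμ, mul_zero]
  · intro p _
    exact ((memLp_eval (fun p => hμ.memLp N p (m := 2) (by norm_num)) p).const_mul
      _).integrable (by norm_num)

/-- The trace form of the first `i + 1` spikes exceeds that of the first `i` spikes by the
quadratic form of the next one. -/
lemma trace_mul_firstOnes_succ (N : ℕ) (i : Fin k) (x : UpperIdx N → ℝ) :
    (symOf x * spikeSum (firstOnes k (i + 1)) (fun m => (e N m : Fin N → ℝ))).trace =
      (symOf x * spikeSum (firstOnes k i) (fun m => (e N m : Fin N → ℝ))).trace +
        quadForm e N i x := by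
  have h1 : spikeSum (firstOnes k (i + 1)) (fun m => (e N m : Fin N → ℝ)) =
      spikeSum (firstOnes k i) (fun m => (e N m : Fin N → ℝ)) +
        Matrix.vecMulVec (e N i : Fin N → ℝ) (e N i) := by
    have h2 : ∀ m : Fin k, firstOnes k (i + 1) m = firstOnes k i m + if m = i then 1 else 0 := by
      intro m
      unfold firstOnes
      rcases lt_trichotomy (m : ℕ) i with h | h | h
      · simp [h, Fin.ne_of_lt (Fin.lt_def.2 h), Nat.lt_succ_of_lt h]
      · simp [Fin.ext h]
      · have h3 : m ≠ i := fun h' => by simp [h'] at h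
        simp [h3, show ¬ (m : ℕ) < i by omega, show ¬ (m : ℕ) < i + 1 by omega]
    simp only [spikeSum, h2, add_smul, Finset.sum_add_distrib]
    simp
  rw [h1, mul_add, Matrix.trace_add]
  congr 1
  rw [quadForm, Matrix.mul_vecMulVec, Matrix.trace_vecMulVec, dotProduct_comm]

/-- The fluctuation of an outlier is asymptotically, in `L²`, the quadratic form of its spike. -/
theorem tendsto_integral_sq_topEigenvalue_sub (hμ : IsWignerLaw B f μ) (hθ : ∀ N, 0 < θ N)
    (hgrow : Tendsto (fun N => entryBound B N ^ 3 * √N / θ N) atTop (𝓝 0))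
    (he : ∀ i j, Tendsto (fun N => inner ℝ (e N i) (e N j)) atTop (𝓝 (if i = j then 1 else 0)))
    (hα : StrictAnti α) (hα0 : ∀ m, 0 < α m) (i : Fin k) :
    Tendsto (fun N => ∫ x, (topEigenvalue θ α e N i x -
      (∫ y, topEigenvalue θ α e N i y ∂(Measure.pi (μ N))) - quadForm e N i x) ^ 2
        ∂(Measure.pi (μ N))) atTop (𝓝 0) := by
  have h1 := tendsto_variance_topSum_sub hμ hθ hgrow he hα hα0 (show (i : ℕ) + 1 ≤ k from i.2)
  have h0 := tendsto_variance_topSum_sub hμ hθ hgrow he hα hα0 (show (i : ℕ) ≤ k from i.2.le)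
  have h2 := (h1.const_mul 2).add (h0.const_mul 2)
  rw [mul_zero, add_zero] at h2
  refine squeeze_zero' (Eventually.of_forall fun N => integral_nonneg fun _ => sq_nonneg _) ?_ h2
  filter_upwards [eventually_ge_atTop (k + 1)] with N hN
  have := hμ.prob N
  have hμ2 : ∀ p, MemLp (fun t => t) 2 (μ N p) := fun p => hμ.memLp N p (m := 2) (by norm_num)
  set T := spikeSum_isHermitian α fun m => (e N m : Fin N → ℝ) with hT
  set g : ℕ → (UpperIdx N → ℝ) → ℝ := fun a x => topSum (isHermitian_symOf_add_smul x (θ N) T) a -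
    (symOf x * spikeSum (firstOnes k a) (fun m => (e N m : Fin N → ℝ))).trace with hg
  have hgL : ∀ a ≤ N, MemLp (g a) 2 (Measure.pi (μ N)) := fun a ha =>
    (memLp_topSum hμ2 T (θ N) ha).sub (memLp_trace_mul hμ2 (spikeSum_transpose _ _))
  have hdiff : ∀ x, topEigenvalue θ α e N i x - quadForm e N i x = g (i + 1) x - g i x := by
    intro x
    simp only [hg]
    rw [trace_mul_firstOnes_succ, topEigenvalue, orderedEigenvalue_eq_sub]
    ring
  have hi := i.2
  have m1 := hgL (i + 1) (by omega)
  have m0 := hgL i (by omega)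
  have i1 := m1.integrable (by norm_num)
  have i0 := m0.integrable (by norm_num)
  have hmean : ∫ y, topEigenvalue θ α e N i y ∂(Measure.pi (μ N)) =
      (∫ y, g (i + 1) y ∂(Measure.pi (μ N))) - ∫ y, g i y ∂(Measure.pi (μ N)) := by
    rw [← integral_sub i1 i0]
    simp only [← hdiff]
    rw [integral_sub ((memLp_topEigenvalue hμ N i).integrable (by norm_num))
      ((memLp_quadForm hμ N i).integrable (by norm_num)), integral_quadForm hμ, sub_zero]
  rw [variance_eq_integral m1.aestronglyMeasurable.aemeasurable,
    variance_eq_integral m0.aestronglyMeasurable.aemeasurable, ← integral_const_mul,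
    ← integral_const_mul]
  have s1 := (m1.sub (memLp_const (∫ y, g (i + 1) y ∂(Measure.pi (μ N))))).integrable_sq
  have s0 := (m0.sub (memLp_const (∫ y, g i y ∂(Measure.pi (μ N))))).integrable_sq
  simp only [Pi.sub_apply] at s1 s0
  rw [← integral_add (s1.const_mul 2) (s0.const_mul 2)]
  refine integral_mono_of_nonneg (Eventually.of_forall fun _ => sq_nonneg _)
    ((s1.const_mul 2).add (s0.const_mul 2)) (Eventually.of_forall fun x => ?_)
  have hx := hdiff x
  beta_reduce
  rw [hmean, show topEigenvalue θ α e N i x - ((∫ y, g (i + 1) y ∂(Measure.pi (μ N))) -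
    ∫ y, g i y ∂(Measure.pi (μ N))) - quadForm e N i x =
      (g (i + 1) x - ∫ y, g (i + 1) y ∂(Measure.pi (μ N))) -
        (g i x - ∫ y, g i y ∂(Measure.pi (μ N))) by linarith]
  nlinarith [sq_nonneg ((g (i + 1) x - ∫ y, g (i + 1) y ∂(Measure.pi (μ N))) +
        (g i x - ∫ y, g i y ∂(Measure.pi (μ N))))]

/-- With high probability the outlier is close to `θ αᵢ`, by Weyl's inequality. -/
theorem tendsto_measure_topEigenvalue_sub (hμ : IsWignerLaw B f μ) (hB : 0 < B)
    (hθ : ∀ N, 0 < θ N)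
    (hgrow : Tendsto (fun N => entryBound B N ^ 3 * √N / θ N) atTop (𝓝 0))
    (he : ∀ i j, Tendsto (fun N => inner ℝ (e N i) (e N j)) atTop (𝓝 (if i = j then 1 else 0)))
    (hα : StrictAnti α) (hα0 : ∀ m, 0 < α m) (i : Fin k) {δ : ℝ} (hδ : 0 < δ) :
    Tendsto (fun N => (Measure.pi (μ N)).real
      {x | δ * θ N < |topEigenvalue θ α e N i x - θ N * α i|}) atTop (𝓝 0) := by
  have h1 := (spikeSum_spectrum he hα hα0 (show (i : ℕ) + 1 ≤ k from i.2)).1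
  have h0 := (spikeSum_spectrum he hα hα0 (show (i : ℕ) ≤ k from i.2.le)).1
  have hαi : partialSum α (i + 1) - partialSum α i = α i := by
    rw [partialSum_succ, extendZero, dif_pos i.2]
    simp
  have h2 := h1.sub h0
  rw [hαi] at h2
  have lim1 : Tendsto (fun N => ((2 * i + 1) * 17 : ℝ) * (entryBound B N * √N / θ N)) atTop
      (𝓝 0) := by
    have := (tendsto_entryBound_mul_sqrt_div hB hθ hgrow).const_mul ((2 * i + 1) * 17 : ℝ)
    rwa [mul_zero] at this
  have lim2 : Tendsto (fun N : ℕ => 2 / (N : ℝ)) atTop (𝓝 0) :=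
    tendsto_const_div_atTop_nhds_zero_nat 2
  refine squeeze_zero' (Eventually.of_forall fun N => measureReal_nonneg) ?_ lim2
  filter_upwards [h2.eventually (Metric.closedBall_mem_nhds (α i) (half_pos hδ)),
    eventually_exists_good_set B, lim1.eventually_le_const (half_pos hδ),
    eventually_ge_atTop (k + 1)] with N hN1 hG hN2 hN
  have := hμ.prob N
  obtain ⟨G, hGm, hGη, hGx⟩ := hG (μ N) (hμ.prob N) (hμ.mean N) (hμ.moment N)
  have hNr : (1 : ℝ) ≤ N := by exact_mod_cast (by omega : 1 ≤ N)
  refine (measureReal_mono (fun x hx => ?_)).trans (hGη.trans ?_)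
  · intro hxG
    have hw := (hGx x hxG).2
    set T := spikeSum_isHermitian α fun m => (e N m : Fin N → ℝ) with hT
    set L := 17 * entryBound B N * √N with hL
    have hθT : (θ N • spikeSum α fun m => (e N m : Fin N → ℝ)).IsHermitian := by
      rw [Matrix.IsHermitian, Matrix.conjTranspose_smul, T]
      simp
    have hi := i.2
    have key : ∀ a ≤ N, |topSum (isHermitian_symOf_add_smul x (θ N) T) a - θ N * topSum T a| ≤
        a * L := by
      intro a ha
      rw [← topSum_smul (hθ N) T hθT ha]
      exact abs_topSum_sub_le _ hθT rfl ha fun R hR => hR.abs_trace_mul_le hw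
    have k1 := abs_le.1 (key (i + 1) (by omega))
    have k0 := abs_le.1 (key i (by omega))
    rw [Real.dist_eq] at hN1
    have hN1' := abs_le.1 hN1
    have hL2 : (2 * i + 1) * L ≤ δ / 2 * θ N := by
      rw [← mul_div_assoc, div_le_iff₀ (hθ N)] at hN2
      rw [hL]
      linarith
    have hx' : δ * θ N < |topEigenvalue θ α e N i x - θ N * α i| := hx
    refine absurd hx' (not_lt.2 (abs_le.2 ?_))
    rw [topEigenvalue, orderedEigenvalue_eq_sub]
    push_cast at k1
    have u1 := mul_le_mul_of_nonneg_left hN1'.1 (hθ N).le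
    have u2 := mul_le_mul_of_nonneg_left hN1'.2 (hθ N).le
    constructor <;> linarith
  · refine div_le_div_of_nonneg_left (by norm_num) (by linarith) ?_
    exact le_self_pow₀ hNr (by norm_num)

end

/-! ### The central limit theorem for the quadratic forms -/

lemma gridPoint_mem {N : ℕ} (j : Fin N) : gridPoint j ∈ Set.Icc (0 : ℝ) 1 := by
  have hN : (0 : ℝ) < N := by exact_mod_cast (show 0 < N from j.pos)
  rw [gridPoint]
  refine ⟨by positivity, ?_⟩
  rw [div_le_one hN]
  exact_mod_cast j.2

/-- The discretized signals as vectors of Euclidean space. -/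
noncomputable def signal {k : ℕ} (h : Fin k → ℝ → ℝ) (N : ℕ) (m : Fin k) :
    EuclideanSpace ℝ (Fin N) :=
  WithLp.toLp 2 (signalVector N (h m))

/-- Orthonormality of the signals in `L²[0,1]` makes their discretizations asymptotically
orthonormal. -/
lemma tendsto_inner_signal {k : ℕ} {h : Fin k → ℝ → ℝ} (hh : ∀ i, BoundedRiemann₁ (h i))
    (hh_orth : ∀ i j, ∫ x in (0 : ℝ)..1, h i x * h j x = if i = j then 1 else 0) (i j : Fin k) :
    Tendsto (fun N => inner ℝ (signal h N i) (signal h N j)) atTop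
      (𝓝 (if i = j then 1 else 0)) := by
  rw [← hh_orth]
  refine (tendsto_riemannSum_mul (hh i) (hh j)).congr fun N => ?_
  rw [PiLp.inner_apply, Finset.sum_div]
  refine Finset.sum_congr rfl fun a _ => ?_
  have hN : (0 : ℝ) ≤ N := by positivity
  simp only [signal, signalVector, RCLike.inner_apply, conj_trivial]
  rw [div_mul_div_comm, Real.mul_self_sqrt hN]
  ring

lemma IsWignerLaw.integral_sq_eq {B : ℝ} {f : ℝ → ℝ → ℝ} {μ : ∀ N, UpperIdx N → Measure ℝ}
    (hμ : IsWignerLaw B f μ) (N : ℕ) (p : UpperIdx N) :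
    ∫ t, t ^ 2 ∂(μ N p) = f (gridPoint p.1.1) (gridPoint p.1.2) ∧
    ∫ t, t ^ 2 ∂(μ N p) = f (gridPoint p.1.2) (gridPoint p.1.1) := by
  obtain ⟨⟨j, l⟩, hjl⟩ := p
  have hle : j ≤ l := hjl
  have h1 := hμ.variance N j l
  have h2 := hμ.variance N l j
  simp only [min_eq_left hle, max_eq_right hle] at h1
  simp only [min_eq_right hle, max_eq_left hle] at h2
  exact ⟨h1, h2⟩

/-- The variance of the linear form `tr (W a)`, as a sum over all entries: the diagonal, where the
variance profile is not doubled, enters as a correction. -/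
lemma sum_upperCoef_sq_mul {N : ℕ} {a : Matrix (Fin N) (Fin N) ℝ} (ha : ∀ j l, a j l = a l j)
    (v : UpperIdx N → ℝ) (w : Fin N → Fin N → ℝ)
    (hw : ∀ p, v p = w p.1.1 p.1.2 ∧ v p = w p.1.2 p.1.1) :
    ∑ p, upperCoef a p ^ 2 * v p =
      2 * (∑ j, ∑ l, a j l ^ 2 * w j l) - ∑ j, a j j ^ 2 * w j j := by
  have h := sum_eq_sum_upperCoef (Matrix.of fun j l : Fin N =>
    2 * (a j l ^ 2 * w j l) - if j = l then a j j ^ 2 * w j j else 0)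
  simp only [Matrix.of_apply, Finset.sum_sub_distrib, Finset.sum_ite_eq, Finset.mem_univ,
    if_true, ← Finset.mul_sum] at h
  rw [h]
  refine Finset.sum_congr rfl fun p _ => ?_
  obtain ⟨h1, h2⟩ := hw p
  unfold upperCoef
  split_ifs with hp
  · simp only [Matrix.of_apply, hp, if_true]
    rw [h1, hp]
    ring
  · simp only [Matrix.of_apply, hp, Ne.symm hp, if_false]
    rw [← h1, ← h2, ha p.1.2 p.1.1]
    ring

lemma spikeSum_signal_apply {k N : ℕ} (h : Fin k → ℝ → ℝ) (t : Fin k → ℝ) (j l : Fin N) :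
    spikeSum t (fun m => (signal h N m : Fin N → ℝ)) j l =
      (∑ m, t m * (h m (gridPoint j) * h m (gridPoint l))) / N := by
  have hN : (0 : ℝ) ≤ N := by positivity
  simp only [spikeSum, Matrix.sum_apply, Matrix.smul_apply, Matrix.vecMulVec_apply, signal,
    signalVector, smul_eq_mul, Finset.sum_div]
  refine Finset.sum_congr rfl fun m _ => ?_
  rw [div_mul_div_comm, Real.mul_self_sqrt hN]
  ring

/-- The entries of a combination of the rank-one spikes are of order `1 / N`. -/
lemma exists_abs_spikeSum_signal_le {k : ℕ} {h : Fin k → ℝ → ℝ} (hh : ∀ i, BoundedRiemann₁ (h i))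
    (t : Fin k → ℝ) : ∃ D : ℝ, 0 ≤ D ∧ ∀ N (j l : Fin N),
      |spikeSum t (fun m => (signal h N m : Fin N → ℝ)) j l| ≤ D / N := by
  choose C hC using fun i => (hh i).1
  have hC0 : ∀ i, 0 ≤ C i := fun i => (abs_nonneg _).trans (hC i 0 (by simp))
  refine ⟨∑ m, |t m| * (C m * C m), Finset.sum_nonneg fun m _ =>
    mul_nonneg (abs_nonneg _) (mul_nonneg (hC0 m) (hC0 m)), fun N j l => ?_⟩
  rw [spikeSum_signal_apply, abs_div, Nat.abs_cast]
  refine div_le_div_of_nonneg_right ((Finset.abs_sum_le_sum_abs _ _).trans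
    (Finset.sum_le_sum fun m _ => ?_)) (by positivity)
  rw [abs_mul, abs_mul]
  exact mul_le_mul_of_nonneg_left (mul_le_mul (hC m _ (gridPoint_mem j)) (hC m _ (gridPoint_mem l))
    (abs_nonneg _) (hC0 m)) (abs_nonneg _)

/-- The limit of the variances of the combinations of the quadratic forms. -/
theorem tendsto_sum_upperCoef_sq_mul {k : ℕ} {h : Fin k → ℝ → ℝ}
    (hh : ∀ i, BoundedRiemann₁ (h i)) {f : ℝ → ℝ → ℝ} (hf : BoundedRiemann₂ f)
    (v : ∀ N, UpperIdx N → ℝ)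
    (hv : ∀ N p, v N p = f (gridPoint p.1.1) (gridPoint p.1.2) ∧
      v N p = f (gridPoint p.1.2) (gridPoint p.1.1)) (t : Fin k → ℝ) :
    Tendsto (fun N => ∑ p, upperCoef (spikeSum t fun m => (signal h N m : Fin N → ℝ)) p ^ 2 *
      v N p) atTop (𝓝 (t ⬝ᵥ (limitCov h f).mulVec t)) := by
  obtain ⟨D, hD0, hD⟩ := exists_abs_spikeSum_signal_le hh t
  obtain ⟨F, hF⟩ := hf.1
  have hF0 : 0 ≤ F := (abs_nonneg _).trans (hF 0 (by simp) 0 (by simp))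
  set a : ∀ N : ℕ, Matrix (Fin N) (Fin N) ℝ :=
    fun N => spikeSum t fun m => (signal h N m : Fin N → ℝ) with ha
  set S : Fin k → Fin k → ℕ → ℝ := fun m m' N =>
    (∑ j : Fin N, ∑ l : Fin N, h m (gridPoint j) * h m (gridPoint l) * h m' (gridPoint j) *
      h m' (gridPoint l) * f (gridPoint j) (gridPoint l)) / (N : ℝ) ^ 2 with hS
  have hdiag : Tendsto (fun N => ∑ j, a N j j ^ 2 * f (gridPoint j) (gridPoint j)) atTop
      (𝓝 0) := by
    have hlim := (tendsto_one_div_atTop_nhds_zero_nat (𝕜 := ℝ)).const_mul (D ^ 2 * F)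
    rw [mul_zero] at hlim
    refine squeeze_zero_norm' ?_ hlim
    filter_upwards [eventually_ne_atTop 0] with N hN0
    have hN : (0 : ℝ) < N := Nat.cast_pos.2 (Nat.pos_of_ne_zero hN0)
    rw [Real.norm_eq_abs]
    calc |∑ j, a N j j ^ 2 * f (gridPoint j) (gridPoint j)|
        ≤ ∑ j : Fin N, (D / N) ^ 2 * F := by
          refine (Finset.abs_sum_le_sum_abs _ _).trans (Finset.sum_le_sum fun j _ => ?_)
          rw [abs_mul, abs_pow]
          exact mul_le_mul (pow_le_pow_left₀ (abs_nonneg _) (hD N j j) 2)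
            (hF _ (gridPoint_mem j) _ (gridPoint_mem j)) (abs_nonneg _) (by positivity)
      _ = D ^ 2 * F * (1 / N) := by
          rw [Finset.sum_const, Finset.card_univ, Fintype.card_fin, nsmul_eq_mul]
          field_simp
  have hmain : ∀ N : ℕ, 2 * (∑ j, ∑ l, a N j l ^ 2 * f (gridPoint j) (gridPoint l)) =
      ∑ m, t m * ∑ m', 2 * S m m' N * t m' := by
    intro N
    have e1 : ∀ j l : Fin N, a N j l ^ 2 * f (gridPoint j) (gridPoint l) =
        ∑ q : Fin k × Fin k, t q.1 * t q.2 * ((h q.1 (gridPoint j) * h q.1 (gridPoint l) *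
          h q.2 (gridPoint j) * h q.2 (gridPoint l) * f (gridPoint j) (gridPoint l)) /
            (N : ℝ) ^ 2) := by
      intro j l
      rw [ha]
      beta_reduce
      rw [spikeSum_signal_apply, div_pow, sq (∑ m, _), Finset.sum_mul_sum,
        ← Fintype.sum_prod_type' (f := fun m m' : Fin k =>
          t m * (h m (gridPoint j) * h m (gridPoint l)) *
            (t m' * (h m' (gridPoint j) * h m' (gridPoint l)))), Finset.sum_div, Finset.sum_mul]
      refine Finset.sum_congr rfl fun q _ => ?_
      ring
    simp only [e1]
    have e2 : ∑ j : Fin N, ∑ l : Fin N, ∑ q : Fin k × Fin k, t q.1 * t q.2 *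
        ((h q.1 (gridPoint j) * h q.1 (gridPoint l) *
          h q.2 (gridPoint j) * h q.2 (gridPoint l) * f (gridPoint j) (gridPoint l)) /
            (N : ℝ) ^ 2) = ∑ q : Fin k × Fin k, t q.1 * t q.2 * S q.1 q.2 N := by
      simp only [hS, Finset.sum_div, Finset.mul_sum]
      exact (Finset.sum_congr rfl fun j _ => Finset.sum_comm).trans Finset.sum_comm
    rw [e2, Fintype.sum_prod_type, Finset.mul_sum]
    refine Finset.sum_congr rfl fun m _ => ?_
    rw [Finset.mul_sum, Finset.mul_sum]
    refine Finset.sum_congr rfl fun m' _ => ?_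
    ring
  have hlim : Tendsto (fun N => ∑ m, t m * ∑ m', 2 * S m m' N * t m') atTop
      (𝓝 (t ⬝ᵥ (limitCov h f).mulVec t)) := by
    refine tendsto_finsetSum _ fun m _ => Tendsto.const_mul _ ?_
    refine tendsto_finsetSum _ fun m' _ => Tendsto.mul_const _ ?_
    exact (tendsto_riemannSum_cov (hh m) (hh m') hf).const_mul 2
  have := hlim.sub hdiag
  rw [sub_zero] at this
  refine this.congr fun N => ?_
  rw [sum_upperCoef_sq_mul (fun j l => ?_) (v N)
    (fun j l => f (gridPoint j) (gridPoint l)) (hv N), hmain N]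
  exact congrFun (congrFun (spikeSum_transpose t fun m => (signal h N m : Fin N → ℝ)) l) j

/-- The limiting covariance matrix is positive semidefinite, since its quadratic form is a limit
of nonnegative sums. -/
lemma posSemidef_limitCov {k : ℕ} {h : Fin k → ℝ → ℝ}
    (hh : ∀ i, BoundedRiemann₁ (h i)) {f : ℝ → ℝ → ℝ} (hf : BoundedRiemann₂ f)
    (v : ∀ N, UpperIdx N → ℝ) (hv0 : ∀ N p, 0 ≤ v N p)
    (hv : ∀ N p, v N p = f (gridPoint p.1.1) (gridPoint p.1.2) ∧
      v N p = f (gridPoint p.1.2) (gridPoint p.1.1)) :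
    (limitCov h f).PosSemidef := by
  refine Matrix.PosSemidef.of_dotProduct_mulVec_nonneg ?_ fun t => ?_
  · ext i j
    simp only [Matrix.conjTranspose_apply, limitCov, Matrix.of_apply, star_trivial]
    congr 1
    refine intervalIntegral.integral_congr fun y _ => intervalIntegral.integral_congr fun x _ => ?_
    ring
  · rw [star_trivial]
    exact ge_of_tendsto' (tendsto_sum_upperCoef_sq_mul hh hf v hv t) fun N =>
      Finset.sum_nonneg fun p _ => mul_nonneg (sq_nonneg _) (hv0 N p)

section

variable {B : ℝ} {f : ℝ → ℝ → ℝ} {μ : ∀ N, UpperIdx N → Measure ℝ} {k : ℕ}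
  {h : Fin k → ℝ → ℝ}

lemma sum_mul_quadForm {e : ∀ N, Fin k → EuclideanSpace ℝ (Fin N)} (N : ℕ) (t : Fin k → ℝ)
    (x : UpperIdx N → ℝ) :
    ∑ m, t m * quadForm e N m x =
      ∑ p, upperCoef (spikeSum t fun m => (e N m : Fin N → ℝ)) p * x p := by
  rw [← sum_mul_symOf, ← trace_mul_eq_sum _ _ (spikeSum_transpose _ _), spikeSum, Finset.mul_sum,
    Matrix.trace_sum]
  refine Finset.sum_congr rfl fun m _ => ?_
  rw [Matrix.mul_smul, Matrix.trace_smul, smul_eq_mul, quadForm, Matrix.mul_vecMulVec,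
    Matrix.trace_vecMulVec, dotProduct_comm]

/-- The characteristic functions of the quadratic forms converge to that of the Gaussian. -/
theorem tendsto_integral_exp_quadForm (hμ : IsWignerLaw B f μ) (hf : BoundedRiemann₂ f)
    (hh : ∀ i, BoundedRiemann₁ (h i)) (t : Fin k → ℝ) :
    Tendsto (fun N => ∫ x, Complex.exp ((∑ m, t m * quadForm (signal h) N m x : ℝ) * Complex.I)
      ∂(Measure.pi (μ N))) atTop
      (𝓝 (Real.exp (-(t ⬝ᵥ (limitCov h f).mulVec t) / 2) : ℝ)) := by
  obtain ⟨D, hD0, hD⟩ := exists_abs_spikeSum_signal_le hh t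
  have hvar := tendsto_sum_upperCoef_sq_mul hh hf (fun N p => ∫ s, s ^ 2 ∂(μ N p))
    hμ.integral_sq_eq t
  have hexp : Tendsto (fun N => ((Real.exp (-(∑ p, upperCoef (spikeSum t fun m =>
      (signal h N m : Fin N → ℝ)) p ^ 2 * ∫ s, s ^ 2 ∂(μ N p)) / 2) : ℝ) : ℂ)) atTop
      (𝓝 (Real.exp (-(t ⬝ᵥ (limitCov h f).mulVec t) / 2) : ℝ)) :=
    (Complex.continuous_ofReal.tendsto _).comp
      ((Real.continuous_exp.tendsto _).comp (hvar.neg.div_const 2))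
  set M : ℝ := (3 : ℝ) ^ (B * 3) with hM
  set V : ℝ := (2 : ℝ) ^ (B * 2) with hV
  have hlim : Tendsto (fun N : ℕ => (4 * (2 * D) ^ 3 * M + (2 * D) ^ 4 * V ^ 2) * (1 / (N : ℝ)))
      atTop (𝓝 0) := by
    have := (tendsto_one_div_atTop_nhds_zero_nat (𝕜 := ℝ)).const_mul
      (4 * (2 * D) ^ 3 * M + (2 * D) ^ 4 * V ^ 2)
    rwa [mul_zero] at this
  refine (tendsto_iff_of_dist (squeeze_zero' (Eventually.of_forall fun _ => dist_nonneg) ?_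
    hlim)).1 hexp
  filter_upwards [eventually_ge_atTop 1] with N hN1
  have hNr : (1 : ℝ) ≤ N := by exact_mod_cast hN1
  have hN : (0 : ℝ) < N := by linarith
  have := hμ.prob N
  simp only [sum_mul_quadForm]
  rw [dist_comm, dist_eq_norm]
  have hM' : ∀ p, ∫ s, |s| ^ 3 ∂(μ N p) ≤ M := fun p => by
    simpa only [Nat.cast_ofNat] using (hμ.moment N p 3 (by norm_num)).2
  refine (norm_integral_exp_sum_sub_le (μ N) (fun p => ∫ s, s ^ 2 ∂(μ N p))
    (fun p => hμ.memLp N p (m := 3) (by norm_num)) (hμ.mean N) (fun _ => rfl)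
    (hμ.integral_sq_le N) hM' _ (abs_upperCoef_le (hD N))).trans ?_
  have hM0 : 0 ≤ M := by positivity
  calc (Fintype.card (UpperIdx N) : ℝ) * (4 * (2 * (D / N)) ^ 3 * M + (2 * (D / N)) ^ 4 * V ^ 2)
      ≤ (N : ℝ) ^ 2 * (4 * (2 * (D / N)) ^ 3 * M + (2 * (D / N)) ^ 4 * V ^ 2) :=
        mul_le_mul_of_nonneg_right (card_upperIdx_le N) (by positivity)
    _ = 4 * (2 * D) ^ 3 * M * (1 / N) + (2 * D) ^ 4 * V ^ 2 * (1 / (N : ℝ) ^ 2) := by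
        field_simp
    _ ≤ 4 * (2 * D) ^ 3 * M * (1 / N) + (2 * D) ^ 4 * V ^ 2 * (1 / N) := by
        refine add_le_add le_rfl (mul_le_mul_of_nonneg_left ?_ (by positivity))
        exact one_div_le_one_div_of_le hN (le_self_pow₀ hNr (by norm_num))
    _ = _ := by ring

end

/-- Characteristic functions are controlled by the `L²` distance. -/
lemma norm_integral_exp_sub_le_sqrt {Ω : Type*} [MeasurableSpace Ω] {P : Measure Ω}
    [IsProbabilityMeasure P] {U V : Ω → ℝ} (hU : MemLp U 2 P) (hV : MemLp V 2 P) :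
    ‖∫ ω, Complex.exp (U ω * Complex.I) ∂P - ∫ ω, Complex.exp (V ω * Complex.I) ∂P‖ ≤
      √(∫ ω, (U ω - V ω) ^ 2 ∂P) := by
  have hint : ∀ {Z : Ω → ℝ}, MemLp Z 2 P →
      Integrable (fun ω => Complex.exp (Z ω * Complex.I)) P := by
    intro Z hZ
    refine Integrable.of_bound (C := 1) ?_ (Eventually.of_forall fun ω => ?_)
    · exact (show Continuous fun u : ℝ => Complex.exp (u * Complex.I) by
        fun_prop).comp_aestronglyMeasurable
        hZ.aestronglyMeasurable
    · rw [Complex.norm_exp_ofReal_mul_I]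
  have hD : MemLp (fun ω => |U ω - V ω|) 2 P := (hU.sub hV).abs
  have hvar := variance_nonneg (fun ω => |U ω - V ω|) P
  rw [variance_eq_sub hD] at hvar
  have h1 : (∫ ω, |U ω - V ω| ∂P) ^ 2 ≤ ∫ ω, (U ω - V ω) ^ 2 ∂P := by
    have e : ∀ ω, ((fun ω => |U ω - V ω|) ^ 2) ω = (U ω - V ω) ^ 2 := fun ω => by
      simp only [Pi.pow_apply, sq_abs]
    simp only [e] at hvar
    linarith
  rw [← integral_sub (hint hU) (hint hV)]
  refine (norm_integral_le_integral_norm _).trans (le_trans ?_ (Real.le_sqrt_of_sq_le h1))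
  refine integral_mono ((hint hU).sub (hint hV)).norm (hD.integrable (by norm_num)) fun ω => ?_
  have e : Complex.exp (U ω * Complex.I) - Complex.exp (V ω * Complex.I) =
      Complex.exp (V ω * Complex.I) * (Complex.exp (Complex.I * (U ω - V ω : ℝ)) - 1) := by
    rw [mul_sub, ← Complex.exp_add, mul_one]
    congr 2
    push_cast
    ring
  beta_reduce
  rw [e, norm_mul, Complex.norm_exp_ofReal_mul_I, one_mul]
  exact Real.norm_exp_I_mul_ofReal_sub_one_le

/-! ### The expansion of the outliers -/

section

variable {B : ℝ} {f : ℝ → ℝ → ℝ} {μ : ∀ N, UpperIdx N → Measure ℝ} {k : ℕ}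
  {e : ∀ N, Fin k → EuclideanSpace ℝ (Fin N)} {α : Fin k → ℝ} {θ : ℕ → ℝ}

lemma integral_sq_quadForm_le (hμ : IsWignerLaw B f μ) (N : ℕ) (i : Fin k) :
    ∫ x, quadForm e N i x ^ 2 ∂(Measure.pi (μ N)) ≤
      2 * (2 : ℝ) ^ (B * 2) * (inner ℝ (e N i) (e N i)) ^ 2 := by
  have := hμ.prob N
  set c := upperCoef (Matrix.vecMulVec (e N i : Fin N → ℝ) (e N i)) with hc
  have hμ2 : ∀ p, MemLp (fun t => t) 2 (μ N p) := fun p => hμ.memLp N p (m := 2) (by norm_num)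
  have h1 : ∫ x, quadForm e N i x ^ 2 ∂(Measure.pi (μ N)) =
      ∑ p, c p ^ 2 * ∫ t, t ^ 2 ∂(μ N p) := by
    rw [← variance_of_integral_eq_zero (memLp_quadForm hμ N i).aestronglyMeasurable.aemeasurable
      (integral_quadForm hμ N i)]
    have h2 : quadForm e N i = ∑ p, fun x : UpperIdx N → ℝ => (fun t => c p * t) (x p) := by
      ext x
      rw [quadForm_eq_sum, Finset.sum_apply]
    rw [h2, variance_sum_pi fun p => (hμ2 p).const_mul (c p)]
    refine Finset.sum_congr rfl fun p _ => ?_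
    rw [variance_const_mul, variance_of_integral_eq_zero aemeasurable_id' (hμ.mean N p)]
  have h3 : inner ℝ (e N i) (e N i) = ∑ j, (e N i : Fin N → ℝ) j ^ 2 := by
    rw [PiLp.inner_apply]
    simp
  have h4 : frobSq (Matrix.vecMulVec (e N i : Fin N → ℝ) (e N i)) =
      (inner ℝ (e N i) (e N i)) ^ 2 := by
    rw [frobSq_vecMulVec, h3, sq]
  rw [h1, ← h4]
  calc ∑ p, c p ^ 2 * ∫ t, t ^ 2 ∂(μ N p) ≤ ∑ p, c p ^ 2 * (2 : ℝ) ^ (B * 2) :=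
        Finset.sum_le_sum fun p _ =>
          mul_le_mul_of_nonneg_left (hμ.integral_sq_le N p) (sq_nonneg _)
    _ = (∑ p, c p ^ 2) * (2 : ℝ) ^ (B * 2) := by rw [Finset.sum_mul]
    _ ≤ 2 * frobSq (Matrix.vecMulVec (e N i : Fin N → ℝ) (e N i)) * (2 : ℝ) ^ (B * 2) :=
        mul_le_mul_of_nonneg_right (sum_upperCoef_sq_le _) (by positivity)
    _ = _ := by ring

lemma measureReal_le_abs_le {Ω : Type*} [MeasurableSpace Ω] {P : Measure Ω}
    [IsProbabilityMeasure P] {Z : Ω → ℝ} (hZ : Integrable (fun ω => Z ω ^ 2) P) {M : ℝ}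
    (hM : 0 < M) : P.real {ω | M ≤ |Z ω|} ≤ (∫ ω, Z ω ^ 2 ∂P) / M ^ 2 := by
  have h := mul_meas_ge_le_integral_of_nonneg
    (Eventually.of_forall fun ω => sq_nonneg (Z ω)) hZ (M ^ 2)
  rw [le_div_iff₀ (by positivity), mul_comm]
  refine le_trans (mul_le_mul_of_nonneg_left (measureReal_mono fun ω hω => ?_) (sq_nonneg _)) h
  have hω' : M ≤ |Z ω| := hω
  rw [Set.mem_ofPred_eq, ← sq_abs (Z ω)]
  exact pow_le_pow_left₀ hM.le hω' 2

lemma integrable_sq_topEigenvalue_sub (hμ : IsWignerLaw B f μ) (N : ℕ) (i : Fin k) :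
    Integrable (fun x => (topEigenvalue θ α e N i x -
      (∫ y, topEigenvalue θ α e N i y ∂(Measure.pi (μ N))) - quadForm e N i x) ^ 2)
        (Measure.pi (μ N)) := by
  have := hμ.prob N
  exact (((memLp_topEigenvalue hμ N i).sub (memLp_const _)).sub (memLp_quadForm hμ N
    i)).integrable_sq

/-- The first order expansion of an outlier, with the random normalization `θ αᵢ / λᵢ`. -/
theorem tendsto_measure_expansion (hμ : IsWignerLaw B f μ) (hB : 0 < B)
    (hθ : ∀ N, 0 < θ N)
    (hgrow : Tendsto (fun N => entryBound B N ^ 3 * √N / θ N) atTop (𝓝 0))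
    (he : ∀ i j, Tendsto (fun N => inner ℝ (e N i) (e N j)) atTop (𝓝 (if i = j then 1 else 0)))
    (hα : StrictAnti α) (hα0 : ∀ m, 0 < α m) (i : Fin k) {δ : ℝ} (hδ : 0 < δ) :
    Tendsto (fun N => (Measure.pi (μ N)).real
      {x | δ < |topEigenvalue θ α e N i x -
        ((∫ y, topEigenvalue θ α e N i y ∂(Measure.pi (μ N))) +
          θ N * α i / topEigenvalue θ α e N i x * quadForm e N i x)|}) atTop (𝓝 0) := by
  set V : ℝ := 2 * (2 : ℝ) ^ (B * 2) * 2 ^ 2 with hV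
  have hV0 : 0 < V := by positivity
  rw [Metric.tendsto_nhds]
  intro ε hε
  -- the quadratic form exceeds `M` with small probability
  set M : ℝ := 4 * V / ε + 1 with hM
  have hM1 : 1 ≤ M := by
    rw [hM]
    have : 0 ≤ 4 * V / ε := by positivity
    linarith
  have hM0 : 0 < M := by linarith
  have hVM : V / M ^ 2 ≤ ε / 4 := by
    have h1 : 4 * V / ε ≤ M ^ 2 := (by linarith : 4 * V / ε ≤ M).trans
      (le_self_pow₀ hM1 (by norm_num))
    rw [div_le_iff₀ hε] at h1
    rw [div_le_iff₀ (by positivity)]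
    linarith
  -- if `|λᵢ - θ αᵢ| ≤ γ θ` then `λᵢ ≥ θ αᵢ / 2` and `|1 - θ αᵢ / λᵢ| ≤ δ / (2 M)`
  set γ : ℝ := min (α i / 2) (α i * δ / (4 * M)) with hγ
  have hαi := hα0 i
  have hγ0 : 0 < γ := lt_min (by positivity) (by positivity)
  have hγ1 : γ ≤ α i / 2 := min_le_left _ _
  have hγ2 : γ ≤ α i * δ / (4 * M) := min_le_right _ _
  have hin := he i i
  rw [if_pos rfl] at hin
  have lim1 := (tendsto_integral_sq_topEigenvalue_sub hμ hθ hgrow he hα hα0 i).div_const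
    ((δ / 2) ^ 2)
  rw [zero_div] at lim1
  filter_upwards [lim1.eventually_le_const (show 0 < ε / 4 by positivity),
    (tendsto_measure_topEigenvalue_sub hμ hB hθ hgrow he hα hα0 i hγ0).eventually_le_const
      (show 0 < ε / 4 by positivity), hin.eventually_le_const (show (1 : ℝ) < 2 by norm_num)]
    with N h1 h2 h3
  have := hμ.prob N
  rw [Real.dist_eq, sub_zero, abs_of_nonneg measureReal_nonneg]
  have p1 := (measureReal_le_abs_le (integrable_sq_topEigenvalue_sub (θ := θ) (α := α) (e := e)
    hμ N i) (half_pos hδ)).trans h1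
  have p2 : (Measure.pi (μ N)).real {x | M ≤ |quadForm e N i x|} ≤ ε / 4 := by
    refine (measureReal_le_abs_le (memLp_quadForm hμ N i).integrable_sq hM0).trans
      (le_trans (div_le_div_of_nonneg_right ?_ (by positivity)) hVM)
    refine (integral_sq_quadForm_le hμ N i).trans ?_
    exact mul_le_mul_of_nonneg_left (pow_le_pow_left₀ real_inner_self_nonneg h3 2) (by positivity)
  refine lt_of_le_of_lt ((measureReal_mono (s₂ := ({x | δ / 2 ≤ |topEigenvalue θ α e N i x -
      (∫ y, topEigenvalue θ α e N i y ∂(Measure.pi (μ N))) - quadForm e N i x|} ∪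
      {x | M ≤ |quadForm e N i x|}) ∪
      {x | γ * θ N < |topEigenvalue θ α e N i x - θ N * α i|}) fun x hx => ?_).trans
        ((measureReal_union_le _ _).trans (add_le_add (measureReal_union_le _ _) le_rfl)))
    (by linarith : _ + _ + _ < ε)
  by_contra hcon
  simp only [Set.mem_union, Set.mem_ofPred_eq, not_or, not_le, not_lt] at hcon hx
  obtain ⟨⟨c1, c2⟩, c3⟩ := hcon
  set lam := topEigenvalue θ α e N i x with hlam
  set q := quadForm e N i x with hq
  set m := ∫ y, topEigenvalue θ α e N i y ∂(Measure.pi (μ N)) with hm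
  have hθN := hθ N
  have hlam1 : θ N * α i / 2 ≤ lam := by
    have c3' := (abs_le.1 c3).1
    have := mul_le_mul_of_nonneg_right hγ1 hθN.le
    linarith
  have hlam0 : 0 < lam := lt_of_lt_of_le (by positivity) hlam1
  have hratio : |1 - θ N * α i / lam| ≤ δ / (2 * M) := by
    have e1 : 1 - θ N * α i / lam = (lam - θ N * α i) / lam := by field_simp
    rw [e1, abs_div, abs_of_pos hlam0, div_le_iff₀ hlam0]
    calc |lam - θ N * α i| ≤ γ * θ N := c3
      _ ≤ α i * δ / (4 * M) * θ N := mul_le_mul_of_nonneg_right hγ2 hθN.le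
      _ = δ / (2 * M) * (θ N * α i / 2) := by field_simp; ring
      _ ≤ δ / (2 * M) * lam := mul_le_mul_of_nonneg_left hlam1 (by positivity)
  have e2 : lam - (m + θ N * α i / lam * q) = (lam - m - q) + q * (1 - θ N * α i / lam) := by ring
  rw [e2] at hx
  have h5 := abs_add_le (lam - m - q) (q * (1 - θ N * α i / lam))
  rw [abs_mul] at h5
  have h6 : |q| * |1 - θ N * α i / lam| ≤ M * (δ / (2 * M)) :=
    mul_le_mul c2.le hratio (abs_nonneg _) hM0.le
  have h7 : M * (δ / (2 * M)) = δ / 2 := by field_simp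
  linarith

end

section

variable {B : ℝ} {f : ℝ → ℝ → ℝ} {μ : ∀ N, UpperIdx N → Measure ℝ} {k : ℕ}
  {α : Fin k → ℝ} {θ : ℕ → ℝ} {h : Fin k → ℝ → ℝ}

/-- The characteristic functions of the centered outliers converge to that of the Gaussian. -/
theorem tendsto_integral_exp_topEigenvalue (hμ : IsWignerLaw B f μ) (hθ : ∀ N, 0 < θ N)
    (hgrow : Tendsto (fun N => entryBound B N ^ 3 * √N / θ N) atTop (𝓝 0))
    (hf : BoundedRiemann₂ f) (hh : ∀ i, BoundedRiemann₁ (h i))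
    (hh_orth : ∀ i j, ∫ x in (0 : ℝ)..1, h i x * h j x = if i = j then 1 else 0)
    (hα : StrictAnti α) (hα0 : ∀ m, 0 < α m) (t : Fin k → ℝ) :
    Tendsto (fun N => ∫ x, Complex.exp ((∑ m, t m * (topEigenvalue θ α (signal h) N m x -
      ∫ y, topEigenvalue θ α (signal h) N m y ∂(Measure.pi (μ N))) : ℝ) * Complex.I)
        ∂(Measure.pi (μ N))) atTop
      (𝓝 (Real.exp (-(t ⬝ᵥ (limitCov h f).mulVec t) / 2) : ℝ)) := by
  have he := tendsto_inner_signal hh hh_orth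
  have hlim : Tendsto (fun N => √((k : ℝ) * ∑ m, t m ^ 2 *
      ∫ x, (topEigenvalue θ α (signal h) N m x -
        (∫ y, topEigenvalue θ α (signal h) N m y ∂(Measure.pi (μ N))) -
          quadForm (signal h) N m x) ^ 2 ∂(Measure.pi (μ N)))) atTop (𝓝 0) := by
    have h1 := (tendsto_finsetSum Finset.univ fun m _ =>
      (tendsto_integral_sq_topEigenvalue_sub hμ hθ hgrow he hα hα0 m).const_mul
        (t m ^ 2)).const_mul (k : ℝ)
    simp only [mul_zero, Finset.sum_const_zero] at h1
    have h2 := (Real.continuous_sqrt.tendsto 0).comp h1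
    rw [Real.sqrt_zero] at h2
    exact h2
  refine (tendsto_iff_of_dist (squeeze_zero (fun _ => dist_nonneg) (fun N => ?_)
    hlim)).1 (tendsto_integral_exp_quadForm hμ hf hh t)
  have := hμ.prob N
  set P := Measure.pi (μ N) with hP
  have m1 : MemLp (fun x => ∑ m, t m * (topEigenvalue θ α (signal h) N m x -
      ∫ y, topEigenvalue θ α (signal h) N m y ∂P)) 2 P :=
    memLp_finsetSum _ fun m _ =>
      ((memLp_topEigenvalue hμ N m).sub (memLp_const _)).const_mul (t m)
  have m2 : MemLp (fun x => ∑ m, t m * quadForm (signal h) N m x) 2 P :=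
    memLp_finsetSum _ fun m _ => (memLp_quadForm hμ N m).const_mul (t m)
  rw [dist_comm, dist_eq_norm]
  refine (norm_integral_exp_sub_le_sqrt m1 m2).trans (Real.sqrt_le_sqrt ?_)
  have hI : ∀ m, Integrable (fun x => t m ^ 2 * (topEigenvalue θ α (signal h) N m x -
      (∫ y, topEigenvalue θ α (signal h) N m y ∂P) - quadForm (signal h) N m x) ^ 2) P :=
    fun m => (integrable_sq_topEigenvalue_sub hμ N m).const_mul _
  simp only [← integral_const_mul]
  rw [← integral_finsetSum _ fun m _ => hI m, ← integral_const_mul]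
  refine integral_mono (m1.sub m2).integrable_sq
    ((integrable_finsetSum _ fun m _ => hI m).const_mul _) fun x => ?_
  beta_reduce
  rw [← Finset.sum_sub_distrib]
  have h3 := sq_sum_le_card_mul_sum_sq (s := (Finset.univ : Finset (Fin k)))
    (f := fun m => t m * (topEigenvalue θ α (signal h) N m x -
      ∫ y, topEigenvalue θ α (signal h) N m y ∂P) - t m * quadForm (signal h) N m x)
  rw [Finset.card_univ, Fintype.card_fin] at h3
  refine h3.trans (le_of_eq ?_)
  congr 1
  refine Finset.sum_congr rfl fun m _ => ?_
  ring

end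

/-! ### Transfer to the probability spaces of the entries -/

/-- The entries on and above the diagonal, as a random vector. -/
def entries {Ω : ℕ → Type*} (X : ∀ N, Fin N → Fin N → Ω N → ℝ) (N : ℕ) (ω : Ω N) :
    UpperIdx N → ℝ :=
  fun p => X N p.1.1 p.1.2 ω

section

variable {Ω : ℕ → Type*} [∀ N, MeasurableSpace (Ω N)] {P : ∀ N, Measure (Ω N)}
  {X : ∀ N, Fin N → Fin N → Ω N → ℝ}

/-- Independence of the entries: their joint law is the product of their laws. -/
lemma measurePreserving_entries [∀ N, IsProbabilityMeasure (P N)]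
    (hX_meas : ∀ N, ∀ j l : Fin N, j ≤ l → Measurable (X N j l))
    (hX_indep : ∀ N, iIndepFun
      (fun p : {p : Fin N × Fin N // p.1 ≤ p.2} => X N p.1.1 p.1.2) (P N)) (N : ℕ) :
    MeasurePreserving (entries X N) (P N)
      (Measure.pi fun p : UpperIdx N => (P N).map (X N p.1.1 p.1.2)) :=
  ⟨measurable_pi_lambda _ fun p => hX_meas N _ _ p.2,
    (iIndepFun_iff_map_fun_eq_pi_map fun p => (hX_meas N _ _ p.2).aemeasurable).1 (hX_indep N)⟩

/-- The hypotheses on the entries, as properties of their laws. -/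
lemma isWignerLaw_map [∀ N, IsProbabilityMeasure (P N)] {B : ℝ} {f : ℝ → ℝ → ℝ}
    (hX_meas : ∀ N, ∀ j l : Fin N, j ≤ l → Measurable (X N j l))
    (hX_mean : ∀ N, ∀ j l : Fin N, j ≤ l → ∫ ω, X N j l ω ∂(P N) = 0)
    (hW_var : ∀ N, ∀ j l : Fin N,
      ∫ ω, (wignerMatrix (fun a b => X N a b ω) j l) ^ 2 ∂(P N) = f (gridPoint j) (gridPoint l))
    (hX_mom : ∀ N, ∀ j l : Fin N, j ≤ l → ∀ m : ℕ, 1 ≤ m →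
      Integrable (fun ω => |X N j l ω| ^ m) (P N) ∧
        ∫ ω, |X N j l ω| ^ m ∂(P N) ≤ (m : ℝ) ^ (B * m)) :
    IsWignerLaw B f fun N p => (P N).map (X N p.1.1 p.1.2) := by
  have hm : ∀ N (p : UpperIdx N), AEMeasurable (X N p.1.1 p.1.2) (P N) :=
    fun N p => (hX_meas N _ _ p.2).aemeasurable
  refine ⟨fun N p => Measure.isProbabilityMeasure_map (hm N p), fun N p => ?_, fun N j l => ?_,
    fun N p m hm1 => ?_⟩
  · rw [integral_map (hm N p) measurable_id'.aestronglyMeasurable]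
    exact hX_mean N _ _ p.2
  · rw [integral_map (hm N _) (by fun_prop)]
    exact hW_var N j l
  · have hc : AEStronglyMeasurable (fun t : ℝ => |t| ^ m) ((P N).map (X N p.1.1 p.1.2)) :=
      (continuous_abs.pow m).aestronglyMeasurable
    rw [integrable_map_measure hc (hm N p), integral_map (hm N p) hc]
    exact hX_mom N _ _ p.2 m hm1

/-- Convergence to zero of probabilities, transferred from the law of the entries. -/
lemma tendsto_measure_of_subset {μ : ∀ N, Measure (UpperIdx N → ℝ)}
    [∀ N, IsProbabilityMeasure (μ N)] (hμ : ∀ N, MeasurePreserving (entries X N) (P N) (μ N))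
    {S : ∀ N, Set (Ω N)} {T : ∀ N, Set (UpperIdx N → ℝ)}
    (hST : ∀ N, S N ⊆ entries X N ⁻¹' T N)
    (hT : Tendsto (fun N => (μ N).real (T N)) atTop (𝓝 0)) :
    Tendsto (fun N => P N (S N)) atTop (𝓝 0) := by
  have h1 := ENNReal.tendsto_ofReal hT
  rw [ENNReal.ofReal_zero] at h1
  refine tendsto_of_tendsto_of_tendsto_of_le_of_le tendsto_const_nhds h1 (fun _ => zero_le)
    fun N => ?_
  rw [ofReal_measureReal, ← (hμ N).map_eq]
  exact (measure_mono (hST N)).trans (Measure.le_map_apply (hμ N).aemeasurable _)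

lemma integral_comp_entries {N : ℕ} {μ : Measure (UpperIdx N → ℝ)}
    (hμ : MeasurePreserving (entries X N) (P N) μ) {F : Type*} [NormedAddCommGroup F]
    [NormedSpace ℝ F] {g : (UpperIdx N → ℝ) → F} (hg : AEStronglyMeasurable g μ) :
    ∫ ω, g (entries X N ω) ∂(P N) = ∫ x, g x ∂μ := by
  rw [← hμ.map_eq] at hg ⊢
  rw [integral_map hμ.aemeasurable hg]

/-- Joint convergence in distribution of the centered outliers. -/
theorem tendstoInDistribution_topEigenvalue [∀ N, IsProbabilityMeasure (P N)] {B : ℝ}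
    {f : ℝ → ℝ → ℝ} {μ : ∀ N, UpperIdx N → Measure ℝ} (hμ : IsWignerLaw B f μ)
    (hmp : ∀ N, MeasurePreserving (entries X N) (P N) (Measure.pi (μ N)))
    {k : ℕ} {α : Fin k → ℝ} {θ : ℕ → ℝ} {h : Fin k → ℝ → ℝ} (hθ : ∀ N, 0 < θ N)
    (hgrow : Tendsto (fun N => entryBound B N ^ 3 * √N / θ N) atTop (𝓝 0))
    (hf : BoundedRiemann₂ f) (hh : ∀ i, BoundedRiemann₁ (h i))
    (hh_orth : ∀ i j, ∫ x in (0 : ℝ)..1, h i x * h j x = if i = j then 1 else 0)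
    (hα : StrictAnti α) (hα0 : ∀ m, 0 < α m) (hpsd : (limitCov h f).PosSemidef) :
    TendstoInDistribution
      (fun N ω => (WithLp.toLp 2 (fun i => topEigenvalue θ α (signal h) N i (entries X N ω) -
        ∫ x, topEigenvalue θ α (signal h) N i x ∂(Measure.pi (μ N))) :
          EuclideanSpace ℝ (Fin k)))
      atTop id P (multivariateGaussian 0 (limitCov h f)) := by
  have hvec : ∀ N, Measurable fun ω => (WithLp.toLp 2 (fun i : Fin k =>
      topEigenvalue θ α (signal h) N i (entries X N ω) -
        ∫ x, topEigenvalue θ α (signal h) N i x ∂(Measure.pi (μ N))) :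
          EuclideanSpace ℝ (Fin k)) := fun N =>
    (PiLp.continuous_toLp 2 _).measurable.comp (measurable_pi_lambda _ fun i =>
      ((measurable_topEigenvalue N i).comp (hmp N).measurable).sub_const _)
  refine ⟨fun N => (hvec N).aemeasurable, by fun_prop, ?_⟩
  refine ProbabilityMeasure.tendsto_iff_tendsto_charFun.2 fun t => ?_
  have hlim := tendsto_integral_exp_topEigenvalue hμ hθ hgrow hf hh hh_orth hα hα0
    (t : Fin k → ℝ)
  have hgauss : charFun ((multivariateGaussian 0 (limitCov h f)).map id) t =
      (Real.exp (-((t : Fin k → ℝ) ⬝ᵥ (limitCov h f).mulVec t) / 2) : ℝ) := by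
    rw [Measure.map_id, charFun_multivariateGaussian hpsd, inner_zero_right]
    push_cast
    congr 1
    ring
  simp only [ProbabilityMeasure.coe_mk]
  rw [hgauss]
  refine hlim.congr fun N => ?_
  rw [charFun_apply, integral_map (hvec N).aemeasurable (by fun_prop),
    ← integral_comp_entries (hmp N)]
  · refine integral_congr_ae (Eventually.of_forall fun ω => ?_)
    simp only [PiLp.inner_apply, RCLike.inner_apply, conj_trivial]
  · have hc : Continuous fun u : ℝ => Complex.exp (u * Complex.I) := by fun_prop
    have hm : Measurable fun x => ∑ m : Fin k, t m * (topEigenvalue θ α (signal h) N m x -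
        ∫ y, topEigenvalue θ α (signal h) N m y ∂(Measure.pi (μ N))) :=
      Finset.measurable_sum _ fun m _ =>
        ((measurable_topEigenvalue N m).sub_const _).const_mul _
    exact (hc.measurable.comp hm).aestronglyMeasurable

/-- The coordinates of a sequence with a Gaussian limit have Gaussian limits. -/
lemma tendstoInDistribution_eval_gaussian [∀ N, IsProbabilityMeasure (P N)] {k : ℕ}
    {S : Matrix (Fin k) (Fin k) ℝ} (hS : S.PosSemidef)
    {Y : ∀ N, Ω N → EuclideanSpace ℝ (Fin k)}
    (hY : TendstoInDistribution Y atTop id P (multivariateGaussian 0 S)) (i : Fin k) :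
    TendstoInDistribution (fun N ω => Y N ω i) atTop id P (gaussianReal 0 (S i i).toNNReal) := by
  have hcont : Continuous fun v : EuclideanSpace ℝ (Fin k) => v i := by fun_prop
  have hcomp := hY.continuous_comp hcont
  refine ⟨hcomp.forall_aemeasurable, by fun_prop, ?_⟩
  have e : (⟨(gaussianReal 0 (S i i).toNNReal).map id,
      Measure.isProbabilityMeasure_map (by fun_prop)⟩ : ProbabilityMeasure ℝ) =
      ⟨(multivariateGaussian 0 S).map ((fun v : EuclideanSpace ℝ (Fin k) => v i) ∘ id),
        Measure.isProbabilityMeasure_map hcomp.aemeasurable_limit⟩ := by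
    refine Subtype.ext ?_
    have hmap := (measurePreserving_eval_multivariateGaussian (μ := 0) hS (i := i)).map_eq
    simp only [Measure.map_id, Function.comp_id]
    rw [hmap]
    rfl
  rw [e]
  exact hcomp.tendsto

end

end SpikedWigner

open SpikedWigner in
theorem mainTheorem1
    -- the number of spikes, the signal strengths and the signal functions
    (k : ℕ) (hk : 1 ≤ k)
    (α : Fin k → ℝ) (hα_anti : StrictAnti α) (hα_pos : ∀ i, 0 < α i)
    (h : Fin k → ℝ → ℝ) (hh : ∀ i, BoundedRiemann₁ (h i))
    (hh_orth : ∀ i j, ∫ x in (0 : ℝ)..1, h i x * h j x = if i = j then 1 else 0)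
    -- the variance profile
    (f : ℝ → ℝ → ℝ) (hf : BoundedRiemann₂ f)
    (hf_nonneg : ∀ x ∈ Set.Icc (0 : ℝ) 1, ∀ y ∈ Set.Icc (0 : ℝ) 1, 0 ≤ f x y)
    -- for every `N` a probability space with the entries `X N j l`, `j ≤ l`, on it
    (Ω : ℕ → Type*) [∀ N, MeasurableSpace (Ω N)]
    (P : ∀ N, Measure (Ω N)) [∀ N, IsProbabilityMeasure (P N)]
    (X : ∀ N, Fin N → Fin N → Ω N → ℝ)
    (hX_meas : ∀ N, ∀ j l : Fin N, j ≤ l → Measurable (X N j l))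
    (hX_indep : ∀ N, iIndepFun
      (fun p : {p : Fin N × Fin N // p.1 ≤ p.2} => X N p.1.1 p.1.2) (P N))
    (hX_mean : ∀ N, ∀ j l : Fin N, j ≤ l → ∫ ω, X N j l ω ∂(P N) = 0)
    (hW_var : ∀ N, ∀ j l : Fin N,
      ∫ ω, (wignerMatrix (fun a b => X N a b ω) j l) ^ 2 ∂(P N) = f (gridPoint j) (gridPoint l))
    -- the moment condition
    (B : ℝ) (hB : 0 < B)
    (hX_mom : ∀ N, ∀ j l : Fin N, j ≤ l → ∀ m : ℕ, 1 ≤ m →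
      Integrable (fun ω => |X N j l ω| ^ m) (P N) ∧
        ∫ ω, |X N j l ω| ^ m ∂(P N) ≤ (m : ℝ) ^ (B * m))
    -- the growth of the perturbation
    (θ : ℕ → ℝ) (hθ_pos : ∀ N, 0 < θ N)
    (ξ : ℝ) (hξ : max (4 * (B + 1)) 8 < ξ)
    (hθ_lower : (fun N : ℕ => √(N : ℝ) * Real.log N ^ ξ) =O[atTop] θ)
    (hθ_upper : θ =O[atTop] (fun N : ℕ => (N : ℝ))) :
    let lam : ∀ N, Fin k → Ω N → ℝ :=
      fun N i ω => outlier (θ N) α h (fun a b => X N a b ω) i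
    -- the expectations and the quotients below are meaningful
    (∀ N i, Integrable (lam N i) (P N)) ∧
    (∀ i, Tendsto (fun N => P N {ω | lam N i ω = 0}) atTop (𝓝 0)) ∧
    -- the expansion
    (∀ i, IsLittleOp P
      (fun N ω => lam N i ω - ((∫ ω', lam N i ω' ∂(P N)) +
        θ N * α i / lam N i ω * signalForm (h i) (fun a b => X N a b ω)))
      (fun _ _ => 1)) ∧
    -- joint convergence to the centered Gaussian vector
    (limitCov h f).PosSemidef ∧
    TendstoInDistribution
      (fun N ω => (WithLp.toLp 2 (fun i => lam N i ω - ∫ ω', lam N i ω' ∂(P N)) :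
        EuclideanSpace ℝ (Fin k)))
      atTop id P (multivariateGaussian 0 (limitCov h f)) ∧
    -- convergence of each eigenvalue
    (∀ i, TendstoInDistribution
      (fun N ω => lam N i ω - ∫ ω', lam N i ω' ∂(P N)) atTop id P
      (gaussianReal 0 (Real.toNNReal
        (2 * ∫ y in (0 : ℝ)..1, ∫ x in (0 : ℝ)..1, h i x ^ 2 * f x y * h i y ^ 2)))) := by
  intro lam
  have hmp := measurePreserving_entries hX_meas hX_indep
  have hμ := isWignerLaw_map hX_meas hX_mean hW_var hX_mom
  set μ : ∀ N, UpperIdx N → Measure ℝ := fun N p => (P N).map (X N p.1.1 p.1.2) with hμdef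
  have hprob : ∀ N p, IsProbabilityMeasure (μ N p) := hμ.prob
  have hξ' : 4 * (B + 1) < ξ := (le_max_left _ _).trans_lt hξ
  have hgrow := tendsto_entryBound_pow_mul_sqrt_div hB hξ' hθ_pos hθ_lower
  have he := tendsto_inner_signal hh hh_orth
  have hlam : ∀ N i ω, lam N i ω = topEigenvalue θ α (signal h) N i (entries X N ω) :=
    fun _ _ _ => rfl
  clear_value lam
  have hform : ∀ N i ω, signalForm (h i) (fun a b => X N a b ω) =
      quadForm (signal h) N i (entries X N ω) := fun _ _ _ => rfl
  have hmean : ∀ N i, ∫ ω, lam N i ω ∂(P N) =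
      ∫ x, topEigenvalue θ α (signal h) N i x ∂(Measure.pi (μ N)) := fun N i => by
    simp only [hlam]
    exact integral_comp_entries (hmp N) (measurable_topEigenvalue N i).aestronglyMeasurable
  have hpsd : (limitCov h f).PosSemidef :=
    posSemidef_limitCov hh hf (fun N p => ∫ s, s ^ 2 ∂(μ N p))
      (fun N p => integral_nonneg fun s => sq_nonneg s) hμ.integral_sq_eq
  have hjoint : TendstoInDistribution
      (fun N ω => (WithLp.toLp 2 (fun i => lam N i ω - ∫ ω', lam N i ω' ∂(P N)) :
        EuclideanSpace ℝ (Fin k)))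
      atTop id P (multivariateGaussian 0 (limitCov h f)) := by
    simp only [hmean]
    simp only [hlam]
    exact tendstoInDistribution_topEigenvalue hμ hmp hθ_pos hgrow hf hh hh_orth hα_anti hα_pos hpsd
  refine ⟨fun N i => ?_, fun i => ?_, fun i => ?_, hpsd, hjoint, fun i => ?_⟩
  · rw [show lam N i = topEigenvalue θ α (signal h) N i ∘ entries X N from
      funext fun ω => hlam N i ω]
    exact ((memLp_topEigenvalue hμ N i).comp_measurePreserving (hmp N)).integrable (by norm_num)
  · -- a vanishing outlier is at distance `θ αᵢ` from its typical location
    refine tendsto_measure_of_subset hmp (fun N ω hω => ?_)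
      (tendsto_measure_topEigenvalue_sub hμ hB hθ_pos hgrow he hα_anti hα_pos i
        (half_pos (hα_pos i)))
    have hω' : topEigenvalue θ α (signal h) N i (entries X N ω) = 0 :=
      (hlam N i ω).symm.trans hω
    have hpos := mul_pos (hθ_pos N) (hα_pos i)
    simp only [Set.mem_preimage, Set.mem_ofPred_eq, hω', zero_sub, abs_neg, abs_of_pos hpos]
    linarith
  · intro δ hδ
    refine tendsto_measure_of_subset hmp (fun N ω hω => ?_)
      (tendsto_measure_expansion hμ hB hθ_pos hgrow he hα_anti hα_pos i hδ)
    simp only [hmean] at hω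
    simpa only [Set.mem_preimage, Set.mem_ofPred_eq, abs_one, mul_one, hlam, hform] using hω
  · have hcov : limitCov h f i i =
        2 * ∫ y in (0 : ℝ)..1, ∫ x in (0 : ℝ)..1, h i x ^ 2 * f x y * h i y ^ 2 := by
      simp only [limitCov, Matrix.of_apply]
      congr 1
      refine intervalIntegral.integral_congr fun y _ => intervalIntegral.integral_congr fun x _ => ?_
      ring
    rw [← hcov]
    exact tendstoInDistribution_eval_gaussian hpsd hjoint i
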